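/- Setting. Let $Z$ be a complete Riemannian manifold, $S$ a hermitian vector bundle on $Z$, $Z=U_0\cup U_1$ an open covering, and $\eta_0\colon Z\to[0,1]$ a smooth function with $\operatorname{supp}\eta_0\subset U_0$ and $\operatorname{supp}(1-\eta_0)\subset U_1$. Let $L\colon C^\infty_c(Z;S)\to C^\infty_c(Z;S)$ be a first-order elliptic differential operator with symbol $\sigma_L$ (so $L(f\Phi)=fL\Phi+\sigma_L(df)\Phi$ for smooth real $f$) that is essentially self-adjoint on $L^2(Z;S)$, and let $h$ be a measurable (not necessarily smooth) field of self-adjoint endomorphisms of $S$ whose eigenvalues are uniformly bounded on $Z$. For $m>0$ put $L_m:=L+mh$; its spectrum, its Fredholm property and its kernel refer to its closure in $L^2(Z;S)$. Let $(Z'=U_0'\cup U_1',\eta_0',S',L',h')$ be a second set of such data, and $L'_m:=L'+mh'$. Theorem. Assume the following. 1. $|\sigma_L(d\eta_0)|$ is bounded on $U_0\cap U_1$ and $|\sigma_{L'}(d\eta_0')|$ is bounded on $U_0'\cap U_1'$. 2. $h$ is smooth and anticommutes with $L$ on $U_1$; $h'$ is smooth and anticommutes with $L'$ on $U_1'$.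 3. The eigenvalues of $h^2$ are $\ge 1$ on $U_1$, and those of $(h')^2$ are $\ge 1$ on $U_1'$. 4. $S$ and $S'$ are $\mathbb Z_2$-graded hermitian bundles (orthogonal sums $S=S_+\oplus S_-$, $S'=S'_+\oplus S'_-$), and $L,h$, respectively $L',h'$, are odd with respect to these gradings. Then there is a constant $C>0$ that depends only on $\eta_0,\eta_0',\sigma_L,\sigma_{L'}$ such that the following holds for all $\Lambda>0$ and $m>0$. Suppose that there is an isometry $\tau\colon U_0\to U_0'$ covered by a grading-preserving bundle isometry $\tilde\tau\colon S|_{U_0}\to S'|_{U_0'}$ with $\tilde\tau^{-1}\circ L'_m\circ\tilde\tau=L_m$ on $U_0$. If $L_m$ is a Fredholm operator with $\operatorname{Spec}(L_m)\cap[-\Lambda,\Lambda]\subseteq\{0\}$ and $$m>\frac{2(C^2+\Lambda^2)}{\Lambda},$$ then $L'_m$ is also a Fredholm operator and $$\operatorname{ind}(L_m)=\operatorname{ind}(L'_m),$$ where $\operatorname{ind}(D):=\dim(\operatorname{Ker}D\cap L^2(S_+))-\dim(\operatorname{Ker}D\cap L^2(S_-))$. -/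

import Mathlib

open Bundle Manifold MeasureTheory
open scoped ContDiff ENNReal

-- The real inner product `Re ⟪u, v⟫` on the fibres of a hermitian vector bundle.
attribute [local instance] InnerProductSpace.complexToReal

noncomputable section

namespace Excision

/-! ### The Riemannian volume measure -/

section Volume

variable (n : ℕ) {Z : Type*} [TopologicalSpace Z] [ChartedSpace (EuclideanSpace ℝ (Fin n)) Z]

/-- The `i`-th coordinate vector field of the preferred chart at `c`, at the point with
coordinates `u`. -/
def coordVector (c : Z) (u : EuclideanSpace ℝ (Fin n)) (i : Fin n) :
    TangentSpace (𝓡 n) ((chartAt (EuclideanSpace ℝ (Fin n)) c).symm u) :=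
  mfderiv (𝓡 n) (𝓡 n) (chartAt (EuclideanSpace ℝ (Fin n)) c).symm u
    (EuclideanSpace.single i (1 : ℝ))

variable [RiemannianBundle (fun x : Z => TangentSpace (𝓡 n) x)]

/-- The Gram determinant `det (g_ij)` in the preferred chart at `c`. -/
def gramDet (c : Z) (u : EuclideanSpace ℝ (Fin n)) : ℝ :=
  Matrix.det (Matrix.of fun i j : Fin n => inner ℝ (coordVector n c u i) (coordVector n c u j))

variable [MeasurableSpace Z]

/-- The measure `√det (g_ij) du` on the domain of the preferred chart at `c`. -/
def chartVolume (c : Z) : Measure Z :=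
  ((volume.restrict (chartAt (EuclideanSpace ℝ (Fin n)) c).target).withDensity
    (fun u => ENNReal.ofReal (Real.sqrt (gramDet n c u)))).map
      (chartAt (EuclideanSpace ℝ (Fin n)) c).symm

variable (Z) in
/-- The Riemannian volume measure. The measures `chartVolume n c` agree on overlaps of chart
domains, so their supremum (as measures) is the measure that restricts to `chartVolume n c` on
the domain of the chart at `c`, for every `c`. -/
def riemannianVolume : Measure Z := ⨆ c : Z, chartVolume n c

end Volume

/-! ### Sections of a hermitian vector bundle -/

section Sections

variable (n : ℕ) {Z : Type*} [TopologicalSpace Z] [ChartedSpace (EuclideanSpace ℝ (Fin n)) Z]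
  [RiemannianBundle (fun x : Z => TangentSpace (𝓡 n) x)] [MeasurableSpace Z]
  (F : Type*) [NormedAddCommGroup F] [NormedSpace ℂ F]
  (S : Z → Type*) [TopologicalSpace (TotalSpace F S)]
  [∀ x, NormedAddCommGroup (S x)] [∀ x, InnerProductSpace ℂ (S x)]
  [FiberBundle F S]

variable {S} in
/-- Smoothness of a section on a set. -/
def SmoothOn (s : ∀ x, S x) (U : Set Z) : Prop :=
  ContMDiffOn (𝓡 n) ((𝓡 n).prod 𝓘(ℝ, F)) ∞ (fun x => TotalSpace.mk' F x (s x)) U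

variable {S} in
/-- A section is measurable if it is so in the local trivialisations (up to null sets). -/
def MeasurableSection (s : ∀ x, S x) : Prop :=
  ∀ c : Z, AEStronglyMeasurable (fun x => (trivializationAt F S c ⟨x, s x⟩).2)
    ((riemannianVolume n Z).restrict (trivializationAt F S c).baseSet)

variable {n F}

theorem MeasurableSection.add [VectorBundle ℂ F S] [OpensMeasurableSpace Z] {s t : ∀ x, S x}
    (hs : MeasurableSection n F s) (ht : MeasurableSection n F t) :
    MeasurableSection n F (s + t) := fun c => by
  refine ((hs c).add (ht c)).congr ?_
  refine ae_restrict_of_forall_mem (trivializationAt F S c).open_baseSet.measurableSet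
    fun x hx => ?_
  exact (((trivializationAt F S c).linear ℂ hx).1 (s x) (t x)).symm

theorem MeasurableSection.smul [VectorBundle ℂ F S] [OpensMeasurableSpace Z] {s : ∀ x, S x}
    (a : ℂ) (hs : MeasurableSection n F s) : MeasurableSection n F (a • s) := fun c => by
  refine ((hs c).const_smul a).congr ?_
  refine ae_restrict_of_forall_mem (trivializationAt F S c).open_baseSet.measurableSet
    fun x hx => ?_
  exact (((trivializationAt F S c).linear ℂ hx).2 a (s x)).symm

theorem MeasurableSection.zero [VectorBundle ℂ F S] [OpensMeasurableSpace Z] :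
    MeasurableSection n F (0 : ∀ x, S x) := fun c => by
  refine (aestronglyMeasurable_const (b := (0 : F))).congr ?_
  refine ae_restrict_of_forall_mem (trivializationAt F S c).open_baseSet.measurableSet
    fun x hx => ?_
  exact (((trivializationAt F S c).linear ℂ hx).map_zero).symm

variable [VectorBundle ℂ F S] [VectorBundle ℝ F S]

set_option linter.unusedSectionVars false in
theorem continuousOn_inner_symm [IsContinuousRiemannianBundle F S]
    (e : Trivialization F (π F S)) [MemTrivializationAtlas e]
    (v w : F) : ContinuousOn (fun x => inner ℂ (e.symm x v) (e.symm x w)) e.baseSet := by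
  have hc : ∀ v : F, ContinuousOn (fun x => (⟨x, e.symm x v⟩ : TotalSpace F S)) e.baseSet := by
    intro v
    refine (e.continuousOn_symm_prodMk_left (v := v)).congr fun x hx => ?_
    exact e.mk_symm hx v
  have h1 : ∀ v w : F, ContinuousOn
      (fun x => (inner ℂ (e.symm x v) (e.symm x w)).re) e.baseSet := fun v w =>
    (hc v).inner_bundle (hc w)
  have h2 : Set.EqOn (fun x => (inner ℂ (e.symm x v) (e.symm x w)).im)
      (fun x => (inner ℂ (e.symm x (Complex.I • v)) (e.symm x w)).re) e.baseSet := by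
    intro x hx
    have : e.symm x (Complex.I • v) = Complex.I • e.symm x v := by
      rw [← e.symmₗ_apply (R := ℂ) hx, ← e.symmₗ_apply (R := ℂ) hx, map_smul]
    simp [this]
  have := (Complex.continuous_ofReal.comp_continuousOn (h1 v w)).add
    ((Complex.continuous_ofReal.comp_continuousOn ((h1 (Complex.I • v) w).congr h2)).mul
      (continuousOn_const (c := Complex.I)))
  refine this.congr fun x _ => ?_
  exact (Complex.re_add_im _).symm

variable [IsContMDiffRiemannianBundle (𝓡 n) ∞ F S] [OpensMeasurableSpace Z]

theorem MeasurableSection.aestronglyMeasurable_inner [SecondCountableTopology Z] [FiniteDimensional ℂ F]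
    {s t : ∀ x, S x} (hs : MeasurableSection n F s) (ht : MeasurableSection n F t) :
    AEStronglyMeasurable (fun x => inner ℂ (s x) (t x)) (riemannianVolume n Z) := by
  have : IsContinuousRiemannianBundle F S := by
    obtain ⟨g, hg, h⟩ := IsContMDiffRiemannianBundle.exists_contMDiff
      (IB := 𝓡 n) (n := ∞) (F := F) (E := S)
    exact ⟨g, hg.continuous, h⟩
  obtain ⟨A, hA, hU⟩ := TopologicalSpace.countable_cover_nhds
    (f := fun c : Z => (trivializationAt F S c).baseSet)
    (fun c => (trivializationAt F S c).open_baseSet.mem_nhds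
      (FiberBundle.mem_baseSet_trivializationAt' c))
  have : Countable A := hA
  have hU' : (⋃ c : A, (trivializationAt F S c.1).baseSet) = Set.univ := by
    rw [← hU, Set.biUnion_eq_iUnion]
  rw [← Measure.restrict_univ (μ := riemannianVolume n Z), ← hU',
    aestronglyMeasurable_iUnion_iff]
  rintro ⟨c, -⟩
  set e := trivializationAt F S c with he
  let b := Module.finBasis ℂ F
  have hcoord : ∀ {s : ∀ x, S x}, MeasurableSection n F s → ∀ i,
      AEStronglyMeasurable (fun x => b.repr (e ⟨x, s x⟩).2 i)
        ((riemannianVolume n Z).restrict e.baseSet) := fun hs i => by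
    have : Continuous (b.coord i) := LinearMap.continuous_of_finiteDimensional _
    exact this.comp_aestronglyMeasurable (hs c)
  have hexp : ∀ (s : ∀ x, S x), ∀ x ∈ e.baseSet,
      s x = ∑ i, b.repr (e ⟨x, s x⟩).2 i • e.symm x (b i) := by
    intro s x hx
    conv_lhs => rw [← e.symm_apply_apply_mk hx (s x), ← b.sum_repr (e ⟨x, s x⟩).2]
    simp only [← e.symmₗ_apply (R := ℂ) hx, map_sum, map_smul]
  have key : AEStronglyMeasurable (fun x => ∑ i, ∑ j,
      (starRingEnd ℂ (b.repr (e ⟨x, s x⟩).2 i) * b.repr (e ⟨x, t x⟩).2 j) *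
        inner ℂ (e.symm x (b i)) (e.symm x (b j)))
      ((riemannianVolume n Z).restrict e.baseSet) := by
    refine Finset.aestronglyMeasurable_fun_sum _ fun i _ =>
      Finset.aestronglyMeasurable_fun_sum _ fun j _ => ?_
    refine ((Complex.continuous_conj.comp_aestronglyMeasurable (hcoord hs i)).mul
      (hcoord ht j)).mul ?_
    exact (continuousOn_inner_symm S e (b i) (b j)).aestronglyMeasurable
      e.open_baseSet.measurableSet
  refine key.congr (ae_restrict_of_forall_mem e.open_baseSet.measurableSet fun x hx => ?_)
  beta_reduce
  conv_rhs => rw [hexp s x hx, hexp t x hx]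
  simp only [sum_inner, inner_sum, inner_smul_left, inner_smul_right]
  rw [Finset.sum_comm]
  refine Finset.sum_congr rfl fun i _ => ?_
  rw [Finset.mul_sum]
  refine Finset.sum_congr rfl fun j _ => ?_
  ring

theorem MeasurableSection.aestronglyMeasurable_norm [SecondCountableTopology Z] [FiniteDimensional ℂ F]
    {s : ∀ x, S x} (hs : MeasurableSection n F s) :
    AEStronglyMeasurable (fun x => ‖s x‖) (riemannianVolume n Z) := by
  have h := Real.continuous_sqrt.comp_aestronglyMeasurable
    (Complex.continuous_re.comp_aestronglyMeasurable (hs.aestronglyMeasurable_inner S hs))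
  refine h.congr (Filter.Eventually.of_forall fun x => ?_)
  exact (norm_eq_sqrt_re_inner (𝕜 := ℂ) (s x)).symm

variable [SecondCountableTopology Z] [FiniteDimensional ℂ F]

variable (n F) in
/-- The space of square-integrable measurable sections (not yet modulo null sets). -/
def squareIntegrable : Submodule ℂ (∀ x, S x) where
  carrier := {s | MeasurableSection n F s ∧ MemLp (fun x => ‖s x‖) 2 (riemannianVolume n Z)}
  zero_mem' := ⟨MeasurableSection.zero S, by simp⟩
  add_mem' := fun {s t} hs ht => ⟨hs.1.add S ht.1, by
    refine (hs.2.add ht.2).mono (MeasurableSection.aestronglyMeasurable_norm S (hs.1.add S ht.1))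
      (Filter.Eventually.of_forall fun x => ?_)
    simp only [Pi.add_apply, norm_norm]
    exact (norm_add_le _ _).trans (le_abs_self _)⟩
  smul_mem' := fun a s hs => ⟨hs.1.smul S a, by
    have : (fun x => ‖(a • s) x‖) = fun x => ‖a‖ * ‖s x‖ := by
      funext x; simp [norm_smul]
    rw [this]
    exact hs.2.const_mul _⟩

variable (n F) in
/-- The square-integrable sections as a space of its own, to carry the `L²` seminorm. -/
def PreL2 : Type _ := squareIntegrable n F S

namespace PreL2

instance : AddCommGroup (PreL2 n F S) := inferInstanceAs (AddCommGroup (squareIntegrable n F S))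
instance : Module ℂ (PreL2 n F S) := inferInstanceAs (Module ℂ (squareIntegrable n F S))

variable {S}

/-- The section underlying an element of `PreL2`. -/
def toSection : PreL2 n F S →ₗ[ℂ] (∀ x, S x) := (squareIntegrable n F S).subtype

theorem integrable_inner (u v : PreL2 n F S) :
    Integrable (fun x => inner ℂ (u.toSection x) (v.toSection x)) (riemannianVolume n Z) := by
  have h : Integrable (fun x => ‖u.toSection x‖ * ‖v.toSection x‖) (riemannianVolume n Z) :=
    u.2.2.integrable_mul v.2.2
  refine h.mono (MeasurableSection.aestronglyMeasurable_inner S u.2.1 v.2.1) (Filter.Eventually.of_forall fun x => ?_)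
  refine (norm_inner_le_norm _ _).trans ?_
  exact le_abs_self _

/-- The `L²` inner product `∫ ⟪u, v⟫`. -/
abbrev core : PreInnerProductSpace.Core ℂ (PreL2 n F S) where
  inner u v := ∫ x, inner ℂ (u.toSection x) (v.toSection x) ∂(riemannianVolume n Z)
  conj_inner_symm u v := by
    rw [← integral_conj]
    simp only [inner_conj_symm]
  re_inner_nonneg u := by
    rw [← integral_re (integrable_inner u u)]
    exact integral_nonneg fun x => inner_self_nonneg
  add_left u v w := by
    rw [← integral_add (integrable_inner u w) (integrable_inner v w)]
    simp only [map_add, Pi.add_apply, inner_add_left]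
  smul_left u v a := by
    rw [← integral_const_mul]
    simp only [map_smul, Pi.smul_apply, inner_smul_left]

instance : SeminormedAddCommGroup (PreL2 n F S) :=
  InnerProductSpace.Core.toSeminormedAddCommGroup (c := core)

instance : InnerProductSpace ℂ (PreL2 n F S) := InnerProductSpace.ofCore core

end PreL2

variable (n F) in
/-- The Hilbert space `L²(Z; S)`: the completion (including the passage to the quotient by the
sections vanishing almost everywhere) of the space of square-integrable sections. -/
abbrev L2 : Type _ := UniformSpace.Completion (PreL2 n F S)

end Sections

/-! ### Unbounded operators on a Hilbert space -/

section Unbounded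

variable {H : Type*} [NormedAddCommGroup H] [InnerProductSpace ℂ H]

/-- The resolvent set of an unbounded operator `A`: those `z` for which `A - z` is a bijection
from the domain of `A` onto `H` with bounded inverse. -/
def resolventSet (A : H →ₗ.[ℂ] H) : Set ℂ :=
  {z | ∃ R : H →L[ℂ] H,
    (∀ y : H, ∃ x : A.domain, (x : H) = R y ∧ A x - z • (x : H) = y) ∧
    ∀ x : A.domain, R (A x - z • (x : H)) = x}

/-- The spectrum of an unbounded operator. -/
def spectrum (A : H →ₗ.[ℂ] H) : Set ℂ := (resolventSet A)ᶜ

/-- The kernel of an unbounded operator, as a subspace of `H`. -/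
def kernel (A : H →ₗ.[ℂ] H) : Submodule ℂ H :=
  (LinearMap.ker A.toFun).map A.domain.subtype

/-- An unbounded operator is Fredholm if it is closed and densely defined, its kernel is finite
dimensional and its range is closed and of finite codimension. -/
structure IsFredholm (A : H →ₗ.[ℂ] H) : Prop where
  isClosed : A.IsClosed
  dense_domain : Dense (A.domain : Set H)
  finite_kernel : FiniteDimensional ℂ (kernel A)
  isClosed_range : IsClosed (LinearMap.range A.toFun : Set H)
  finite_cokernel : FiniteDimensional ℂ (H ⧸ LinearMap.range A.toFun)

end Unbounded

/-! ### Differential operators, potentials and gradings -/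

section Operators

variable (n : ℕ) {Z : Type*} [TopologicalSpace Z] [ChartedSpace (EuclideanSpace ℝ (Fin n)) Z]
  (F : Type*) [NormedAddCommGroup F] [NormedSpace ℂ F]
  (S : Z → Type*) [TopologicalSpace (TotalSpace F S)]
  [∀ x, NormedAddCommGroup (S x)] [∀ x, InnerProductSpace ℂ (S x)]
  [FiberBundle F S] [VectorBundle ℂ F S] [VectorBundle ℝ F S]

set_option linter.unusedSectionVars false in
theorem contMDiff_const_smul_section (a : ℂ) {s : ∀ x, S x}
    (hs : ContMDiff (𝓡 n) ((𝓡 n).prod 𝓘(ℝ, F)) ∞ (fun x => TotalSpace.mk' F x (s x))) :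
    ContMDiff (𝓡 n) ((𝓡 n).prod 𝓘(ℝ, F)) ∞ (fun x => TotalSpace.mk' F x ((a • s) x)) := by
  intro x₀
  have h := hs x₀
  rw [contMDiffAt_section] at h ⊢
  have h' : ContMDiffAt (𝓡 n) 𝓘(ℝ, F) ∞
      (fun x => (a • ContinuousLinearMap.id ℝ F) (trivializationAt F S x₀ ⟨x, s x⟩).2) x₀ :=
    (a • ContinuousLinearMap.id ℝ F).contMDiff.contMDiffAt.comp x₀ h
  refine h'.congr_of_eventuallyEq ?_
  filter_upwards [(trivializationAt F S x₀).open_baseSet.mem_nhds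
    (FiberBundle.mem_baseSet_trivializationAt' x₀)] with x hx
  exact ((trivializationAt F S x₀).linear ℂ hx).2 a (s x)

/-- `C^∞_c(Z; S)`, the space of compactly supported smooth sections. -/
def TestSections : Submodule ℂ (∀ x, S x) where
  carrier := {s | ContMDiff (𝓡 n) ((𝓡 n).prod 𝓘(ℝ, F)) ∞ (fun x => TotalSpace.mk' F x (s x)) ∧
    ∃ K : Set Z, IsCompact K ∧ ∀ x ∉ K, s x = 0}
  zero_mem' := ⟨contMDiff_zeroSection ℝ S, ∅, isCompact_empty, fun _ _ => rfl⟩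
  add_mem' := by
    rintro s t ⟨hs, K, hK, hsK⟩ ⟨ht, K', hK', htK⟩
    refine ⟨hs.add_section ht, K ∪ K', hK.union hK', fun x hx => ?_⟩
    simp only [Set.mem_union, not_or] at hx
    simp [hsK x hx.1, htK x hx.2]
  smul_mem' := by
    rintro a s ⟨hs, K, hK, hsK⟩
    exact ⟨contMDiff_const_smul_section n F S a hs, K, hK, fun x hx => by simp [hsK x hx]⟩

variable {n F S}

/-- The section `Φ` has compact support contained in `U`. -/
def SupportedIn (Φ : TestSections n F S) (U : Set Z) : Prop :=
  ∃ K : Set Z, IsCompact K ∧ K ⊆ U ∧ ∀ x ∉ K, Φ.1 x = 0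

variable (n S) in
/-- Fields of fibrewise linear maps `T*_x Z → End (S_x)`. -/
abbrev SymbolField : Type _ :=
  ∀ x : Z, (TangentSpace (𝓡 n) x →L[ℝ] ℝ) →ₗ[ℝ] Module.End ℂ (S x)

/-- `L` is a differential operator of first order with symbol `σ`, i.e.
`L (f Φ) = f (L Φ) + σ(df) Φ` for all smooth real functions `f` and all test sections `Φ`.
(For a linear operator on test sections this is equivalent to being given in local coordinates by
`∑ a_j ∂_j + b` with smooth coefficients, with `σ(ξ) = ∑ ξ_j a_j`.) -/
def HasSymbol (L : TestSections n F S →ₗ[ℂ] TestSections n F S) (σ : SymbolField n S) : Prop :=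
  ∀ f : Z → ℝ, ContMDiff (𝓡 n) 𝓘(ℝ, ℝ) ∞ f →
    ∀ Φ Ψ : TestSections n F S, (∀ x, Ψ.1 x = (f x : ℂ) • Φ.1 x) →
      ∀ x, (L Ψ).1 x = (f x : ℂ) • (L Φ).1 x + σ x (mvfderiv (𝓡 n) f x) (Φ.1 x)

/-- Ellipticity: `σ(ξ)` is invertible for every nonzero covector `ξ`. -/
def IsElliptic (σ : SymbolField n S) : Prop :=
  ∀ (x : Z) (ξ : TangentSpace (𝓡 n) x →L[ℝ] ℝ), ξ ≠ 0 → Function.Bijective (σ x ξ)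

/-- The endomorphism field `h` is smooth on `U`. -/
def SmoothEndOn (n : ℕ) [ChartedSpace (EuclideanSpace ℝ (Fin n)) Z] (F : Type*)
    [NormedAddCommGroup F] [NormedSpace ℂ F] [TopologicalSpace (TotalSpace F S)]
    [FiberBundle F S] [VectorBundle ℂ F S] [VectorBundle ℝ F S]
    (h : ∀ x, Module.End ℂ (S x)) (U : Set Z) : Prop :=
  ∀ Φ : TestSections n F S, SmoothOn n F (fun x => h x (Φ.1 x)) U

/-- `h` anticommutes with `L` on `U`: `L (h Φ) = - h (L Φ)` for every `Φ ∈ C^∞_c(U; S)`. -/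
def AnticommutesOn (L : TestSections n F S →ₗ[ℂ] TestSections n F S)
    (h : ∀ x, Module.End ℂ (S x)) (U : Set Z) : Prop :=
  ∀ Φ Ψ : TestSections n F S, SupportedIn Φ U → (∀ x, Ψ.1 x = h x (Φ.1 x)) →
    ∀ x, (L Ψ).1 x = - h x ((L Φ).1 x)

/-- The eigenvalues of `h²` are at least `1` on `U`. -/
def SqEigenvaluesGeOneOn (h : ∀ x, Module.End ℂ (S x)) (U : Set Z) : Prop :=
  ∀ x ∈ U, ∀ μ : ℝ, Module.End.HasEigenvalue (h x * h x) (μ : ℂ) → 1 ≤ μ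

/-- A `ℤ/2`-grading of the hermitian vector bundle `S`: a smooth field of self-adjoint
involutions `Γ`, whose `±1`-eigenbundles are the summands of `S = S₊ ⊕ S₋`. -/
structure IsGrading (n : ℕ) [ChartedSpace (EuclideanSpace ℝ (Fin n)) Z] (F : Type*)
    [NormedAddCommGroup F] [NormedSpace ℂ F] [TopologicalSpace (TotalSpace F S)]
    [FiberBundle F S] [VectorBundle ℂ F S] [VectorBundle ℝ F S]
    (Γ : ∀ x, Module.End ℂ (S x)) : Prop where
  smooth : SmoothEndOn n F Γ Set.univ
  sq : ∀ x, Γ x * Γ x = 1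
  symmetric : ∀ x, (Γ x).IsSymmetric

/-- `L` is an odd operator: it anticommutes with the grading operator. -/
def IsOddOp (L : TestSections n F S →ₗ[ℂ] TestSections n F S)
    (Γ : ∀ x, Module.End ℂ (S x)) : Prop :=
  AnticommutesOn L Γ Set.univ

/-- `h` is an odd endomorphism: it anticommutes with the grading operator. -/
def IsOddEnd (h Γ : ∀ x, Module.End ℂ (S x)) : Prop :=
  ∀ x, h x * Γ x = - (Γ x * h x)

/-- The operator `L_m = L + m h` on test sections. -/
def withPotential (L : TestSections n F S →ₗ[ℂ] TestSections n F S)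
    (h : ∀ x, Module.End ℂ (S x)) (m : ℝ) : TestSections n F S →ₗ[ℂ] (∀ x, S x) :=
  (TestSections n F S).subtype ∘ₗ L +
    (m : ℂ) • (LinearMap.pi fun x => h x ∘ₗ LinearMap.proj x) ∘ₗ (TestSections n F S).subtype

variable [RiemannianBundle (fun x : Z => TangentSpace (𝓡 n) x)] [MeasurableSpace Z]

/-- A potential: a measurable field `h` of self-adjoint endomorphisms whose eigenvalues are
uniformly bounded. Measurability is expressed by saying that `h` maps measurable sections to
measurable sections. -/
structure IsPotential (n : ℕ) [ChartedSpace (EuclideanSpace ℝ (Fin n)) Z]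
    [RiemannianBundle (fun x : Z => TangentSpace (𝓡 n) x)] (F : Type*)
    [NormedAddCommGroup F] [NormedSpace ℂ F] [TopologicalSpace (TotalSpace F S)]
    [FiberBundle F S] (h : ∀ x, Module.End ℂ (S x)) : Prop where
  symmetric : ∀ x, (h x).IsSymmetric
  measurable : ∀ s : ∀ x, S x, MeasurableSection n F s →
    MeasurableSection n F (fun x => h x (s x))
  bounded : ∃ B : ℝ, ∀ x, ∀ μ : ℝ, Module.End.HasEigenvalue (h x) (μ : ℂ) → |μ| ≤ B

variable [IsContMDiffRiemannianBundle (𝓡 n) ∞ F S] [OpensMeasurableSpace Z]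
  [SecondCountableTopology Z] [FiniteDimensional ℂ F]

/-- The graph in `L² × L²` of an operator `T` from test sections to square-integrable sections. -/
def opGraph (T : TestSections n F S →ₗ[ℂ] (∀ x, S x)) : Submodule ℂ (L2 n F S × L2 n F S) where
  carrier := {p | ∃ (Φ : TestSections n F S) (u v : PreL2 n F S),
    u.toSection = Φ.1 ∧ v.toSection = T Φ ∧ p = ((u : L2 n F S), (v : L2 n F S))}
  zero_mem' := ⟨0, 0, 0, map_zero _, by rw [map_zero, map_zero], by
    rw [UniformSpace.Completion.coe_zero]; rfl⟩
  add_mem' := by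
    rintro _ _ ⟨Φ, u, v, hu, hv, rfl⟩ ⟨Φ', u', v', hu', hv', rfl⟩
    exact ⟨Φ + Φ', u + u', v + v', by simp [hu, hu'], by simp [hv, hv'], by
      simp [UniformSpace.Completion.coe_add]⟩
  smul_mem' := by
    rintro a _ ⟨Φ, u, v, hu, hv, rfl⟩
    exact ⟨a • Φ, a • u, a • v, by simp [hu], by simp [hv], by
      rw [UniformSpace.Completion.coe_smul, UniformSpace.Completion.coe_smul]; rfl⟩

/-- The closure in `L²` of the operator `T` with domain the test sections. -/
def closureOp (T : TestSections n F S →ₗ[ℂ] (∀ x, S x)) : L2 n F S →ₗ.[ℂ] L2 n F S :=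
  (opGraph T).toLinearPMap.closure

/-- `L` is essentially self-adjoint: its closure in `L²` is self-adjoint. -/
def IsEssentiallySelfAdjoint (L : TestSections n F S →ₗ[ℂ] TestSections n F S) : Prop :=
  IsSelfAdjoint (closureOp ((TestSections n F S).subtype ∘ₗ L))

/-- The subspace `L²(Z; S_ε)` of `L²(Z; S)`, where `S_ε` is the `ε`-eigenbundle of the grading
operator `Γ`. -/
def gradedPart (n : ℕ) [ChartedSpace (EuclideanSpace ℝ (Fin n)) Z]
    [RiemannianBundle (fun x : Z => TangentSpace (𝓡 n) x)] (F : Type*)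
    [NormedAddCommGroup F] [NormedSpace ℂ F] [TopologicalSpace (TotalSpace F S)]
    [FiberBundle F S] [VectorBundle ℂ F S] [VectorBundle ℝ F S]
    [IsContMDiffRiemannianBundle (𝓡 n) ∞ F S] [FiniteDimensional ℂ F]
    (Γ : ∀ x, Module.End ℂ (S x)) (ε : ℂ) : Submodule ℂ (L2 n F S) :=
  (Submodule.map (UniformSpace.Completion.toComplₗᵢ (𝕜 := ℂ) (E := PreL2 n F S)).toLinearMap
    ((LinearMap.pi fun x => (Γ x - ε • 1) ∘ₗ LinearMap.proj x ∘ₗ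
      PreL2.toSection (n := n) (F := F) (S := S)).ker)).topologicalClosure

/-- The index `dim Ker A₊ - dim Ker A₋` of an operator that is odd with respect to `Γ`. -/
def index (A : L2 n F S →ₗ.[ℂ] L2 n F S) (Γ : ∀ x, Module.End ℂ (S x)) : ℤ :=
  (Module.finrank ℂ ↥(kernel A ⊓ gradedPart n F Γ 1) : ℤ) -
    (Module.finrank ℂ ↥(kernel A ⊓ gradedPart n F Γ (-1)) : ℤ)

end Operators

/-! ### Coincidence of two operators over open sets -/

section Coincidence

/-- An isometry `τ : U → U'` between open subsets of Riemannian manifolds, covered by an isometry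
`lift` of hermitian vector bundles `S|_U → S'|_U'`. Only the values over `U` of the fields `toFun`
and `lift` matter. -/
structure BundleIsometry (n : ℕ) {Z : Type*} [TopologicalSpace Z]
    [ChartedSpace (EuclideanSpace ℝ (Fin n)) Z]
    [RiemannianBundle (fun x : Z => TangentSpace (𝓡 n) x)]
    (F : Type*) [NormedAddCommGroup F] [NormedSpace ℂ F]
    (S : Z → Type*) [TopologicalSpace (TotalSpace F S)]
    [∀ x, NormedAddCommGroup (S x)] [∀ x, InnerProductSpace ℂ (S x)]
    [FiberBundle F S]
    (n' : ℕ) {Z' : Type*} [TopologicalSpace Z']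
    [ChartedSpace (EuclideanSpace ℝ (Fin n')) Z']
    [RiemannianBundle (fun x : Z' => TangentSpace (𝓡 n') x)]
    (F' : Type*) [NormedAddCommGroup F'] [NormedSpace ℂ F']
    (S' : Z' → Type*) [TopologicalSpace (TotalSpace F' S')]
    [∀ x, NormedAddCommGroup (S' x)] [∀ x, InnerProductSpace ℂ (S' x)]
    [FiberBundle F' S']
    (U : Set Z) (U' : Set Z') where
  /-- The underlying diffeomorphism `τ`. -/
  τ : OpenPartialHomeomorph Z Z'
  source_eq : τ.source = U
  target_eq : τ.target = U'
  contMDiffOn : ContMDiffOn (𝓡 n) (𝓡 n') ∞ τ U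
  contMDiffOn_symm : ContMDiffOn (𝓡 n') (𝓡 n) ∞ τ.symm U'
  norm_mfderiv : ∀ x ∈ U, ∀ v : TangentSpace (𝓡 n) x, ‖mfderiv (𝓡 n) (𝓡 n') τ x v‖ = ‖v‖
  /-- The map `S_x → S'_{τ x}` covering `τ`. -/
  lift : ∀ x, S x →ₗ[ℂ] S' (τ x)
  norm_lift : ∀ x ∈ U, ∀ v, ‖lift x v‖ = ‖v‖
  surjective_lift : ∀ x ∈ U, Function.Surjective (lift x)
  contMDiffOn_lift : ContMDiffOn ((𝓡 n).prod 𝓘(ℝ, F)) ((𝓡 n').prod 𝓘(ℝ, F')) ∞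
    (fun p : TotalSpace F S => (⟨τ p.1, lift p.1 p.2⟩ : TotalSpace F' S')) {p | p.1 ∈ U}

variable {n : ℕ} {Z : Type*} [TopologicalSpace Z] [ChartedSpace (EuclideanSpace ℝ (Fin n)) Z]
  [RiemannianBundle (fun x : Z => TangentSpace (𝓡 n) x)]
  {F : Type*} [NormedAddCommGroup F] [NormedSpace ℂ F]
  {S : Z → Type*} [TopologicalSpace (TotalSpace F S)]
  [∀ x, NormedAddCommGroup (S x)] [∀ x, InnerProductSpace ℂ (S x)]
  [FiberBundle F S] [VectorBundle ℂ F S] [VectorBundle ℝ F S]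
  {n' : ℕ} {Z' : Type*} [TopologicalSpace Z'] [ChartedSpace (EuclideanSpace ℝ (Fin n')) Z']
  [RiemannianBundle (fun x : Z' => TangentSpace (𝓡 n') x)]
  {F' : Type*} [NormedAddCommGroup F'] [NormedSpace ℂ F']
  {S' : Z' → Type*} [TopologicalSpace (TotalSpace F' S')]
  [∀ x, NormedAddCommGroup (S' x)] [∀ x, InnerProductSpace ℂ (S' x)]
  [FiberBundle F' S'] [VectorBundle ℂ F' S'] [VectorBundle ℝ F' S']
  {U : Set Z} {U' : Set Z'}

/-- The bundle isometry is compatible with the gradings. -/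
def BundleIsometry.IsEven (T : BundleIsometry n F S n' F' S' U U')
    (Γ : ∀ x, Module.End ℂ (S x)) (Γ' : ∀ x, Module.End ℂ (S' x)) : Prop :=
  ∀ x ∈ U, ∀ v, T.lift x (Γ x v) = Γ' (T.τ x) (T.lift x v)

/-- The bundle isometry intertwines `D` over `U` and `D'` over `U'`: whenever `Φ' ∈ C^∞_c(U'; S')`
corresponds to `Φ ∈ C^∞_c(U; S)`, then `D' Φ'` corresponds to `D Φ`, almost everywhere on `U`. -/
def BundleIsometry.Intertwines [MeasurableSpace Z] (T : BundleIsometry n F S n' F' S' U U')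
    (D : TestSections n F S →ₗ[ℂ] (∀ x, S x))
    (D' : TestSections n' F' S' →ₗ[ℂ] (∀ x, S' x)) : Prop :=
  ∀ (Φ : TestSections n F S) (Φ' : TestSections n' F' S'),
    SupportedIn Φ U → SupportedIn Φ' U' → (∀ x ∈ U, Φ'.1 (T.τ x) = T.lift x (Φ.1 x)) →
      ∀ᵐ x ∂(riemannianVolume n Z), x ∈ U → D' Φ' (T.τ x) = T.lift x (D Φ x)

end Coincidence

/-- `U₀ ∪ U₁` is an open covering and `1 = η + (1 - η)` a smooth partition of unity subordinate
to it. -/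
structure IsPartition (n : ℕ) {Z : Type*} [TopologicalSpace Z]
    [ChartedSpace (EuclideanSpace ℝ (Fin n)) Z] (U₀ U₁ : Set Z) (η : Z → ℝ) : Prop where
  isOpen₀ : IsOpen U₀
  isOpen₁ : IsOpen U₁
  cover : U₀ ∪ U₁ = Set.univ
  smooth : ContMDiff (𝓡 n) 𝓘(ℝ, ℝ) ∞ η
  mem_Icc : ∀ x, η x ∈ Set.Icc (0 : ℝ) 1
  tsupport₀ : tsupport η ⊆ U₀
  tsupport₁ : tsupport (fun x => 1 - η x) ⊆ U₁

end Excision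

end

/-!
The operator `L_m = L + m h` is large away from the region `U₀` that the two manifolds share: over
`U₁` the potential `h` is smooth and anticommutes with the symmetric operator `L`, so that
`‖L_m Φ‖² = ‖L Φ‖² + m² ‖h Φ‖² ≥ m² ‖Φ‖²` for test sections `Φ` supported there
(`CalliasData.mul_norm_le`). Applied to `(1 - η) Φ`, this gives
`m ‖(1 - η) Φ‖ ≤ ‖L_m Φ‖ + K ‖Φ‖` for every test section, where `K` bounds `|σ(dη)|`. Sections of
small energy are therefore concentrated on `U₀`, where the bundle isometry identifies `L_m` with
`L'_m`.

Sections are cut off with `χ = 1 - (1 - η)²` rather than with `η`, because the derivative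
`dχ = 2 (1 - η) dη` has a factor `1 - η`: the commutator of `L` with `χ` is bounded by
`2 K ‖(1 - η) Φ‖`, which has just been seen to be small for large `m`. Cutting off and transplanting
defines bounded operators `W : L²(Z; S) → L²(Z'; S')` and `W'` in the opposite direction
(`CalliasData.exists_transfer`). They nearly preserve `‖x‖`, do not much increase `‖L_m x‖`, are
nearly adjoint to each other (`BundleIsometry.almostAdjoint`) and commute with the gradings
(`BundleIsometry.transfer_grading`).

From here on the argument takes place in Hilbert spaces (`index_eq_of_transfer`). As `L_m` is
self-adjoint and has no spectrum in `[-Λ, Λ]` other than `0`, it is bounded below by `Λ` on the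
complement of its kernel (`norm_le_of_spectral_gap`). Then `V = W (ker L_m)` is an approximate kernel
of `L'_m` (`isAlmostKernel_map`): on `V` the operator `L'_m` is at most `Λ / 8`, and on `Vᗮ` it is at
least `Λ / 4`, since a vector violating the latter bound would be carried by `W'` to one violating
the spectral gap. A self-adjoint operator `A` with such a finite-dimensional `V` is Fredholm
(`IsAlmostKernel.isFredholm`): its compression to `Vᗮ` is invertible, and eliminating `Vᗮ` leaves an
odd symmetric endomorphism of `V` with kernel isomorphic to `ker A`. By rank-nullity the graded
dimension of `V` is the index of `A` (`IsAlmostKernel.finrank_sub_finrank`). As `W` is injective on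
`ker L_m` and even, that graded dimension is also the index of `L_m`.

Three facts on the concrete side support this. The Riemannian volume is invariant under local
isometries by the change of variables formula (`map_riemannianVolume`), so that transplantation
preserves `L²` norms. The potential is a bounded self-adjoint operator, so that adding it to `L`
shears the graph of the closure, and `L_m` is essentially self-adjoint
(`isSelfAdjoint_closureOp_withPotential`). The grading acts on `L²` as an involution whose
eigenspaces are the spaces `L²(S_±)` (`IsGrading.exists_clm`, `mem_gradedPart_iff`).
-/

noncomputable section

namespace Excision

set_option linter.unusedSectionVars false

/-! ### Self-adjoint unbounded operators, in terms of their graphs -/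

section SelfAdjoint

variable {H : Type*} [NormedAddCommGroup H] [InnerProductSpace ℂ H]

theorem mem_kernel_iff {A : H →ₗ.[ℂ] H} {x : H} : x ∈ kernel A ↔ (x, 0) ∈ A.graph := by
  simp only [kernel, Submodule.mem_map, LinearMap.mem_ker, LinearPMap.mem_graph_iff]
  constructor
  · rintro ⟨y, hy, rfl⟩
    exact ⟨y, rfl, hy⟩
  · rintro ⟨y, hy, h⟩
    exact ⟨y, h, hy⟩

theorem mem_range_toFun_iff {A : H →ₗ.[ℂ] H} {y : H} :
    y ∈ LinearMap.range A.toFun ↔ ∃ x, (x, y) ∈ A.graph := by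
  simp only [LinearMap.mem_range, LinearPMap.mem_graph_iff]
  constructor
  · rintro ⟨x, hx⟩
    exact ⟨x, x, rfl, hx⟩
  · rintro ⟨_, x, _, hx⟩
    exact ⟨x, hx⟩

variable [CompleteSpace H] {A : H →ₗ.[ℂ] H}

theorem inner_eq_of_mem_graph (hA : IsSelfAdjoint A) {x y x' y' : H}
    (h : (x, y) ∈ A.graph) (h' : (x', y') ∈ A.graph) : inner ℂ y x' = inner ℂ x y' := by
  have hf := LinearPMap.adjoint_isFormalAdjoint hA.dense_domain
  rw [LinearPMap.isSelfAdjoint_def.1 hA] at hf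
  rw [LinearPMap.mem_graph_iff] at h h'
  obtain ⟨u, rfl, rfl⟩ := h
  obtain ⟨u', rfl, rfl⟩ := h'
  exact hf u u'

theorem mem_graph_of_forall_inner (hA : IsSelfAdjoint A) {w z : H}
    (h : ∀ x y, (x, y) ∈ A.graph → inner ℂ y w = inner ℂ x z) : (w, z) ∈ A.graph := by
  have hg := LinearPMap.adjoint_graph_eq_graph_adjoint hA.dense_domain
  rw [LinearPMap.isSelfAdjoint_def.1 hA] at hg
  rw [hg, Submodule.mem_adjoint_iff]
  intro a b hab
  rw [h a b hab, sub_self]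

theorem isClosed_graph (hA : IsSelfAdjoint A) : IsClosed (A.graph : Set (H × H)) :=
  hA.isClosed

/-- The criterion by which self-adjointness is verified: a densely defined operator is
self-adjoint as soon as it is symmetric and has no proper formal adjoint. -/
theorem isSelfAdjoint_of_graph (hd : Dense (A.domain : Set H))
    (hs : ∀ x y x' y', (x, y) ∈ A.graph → (x', y') ∈ A.graph → inner ℂ y x' = inner ℂ x y')
    (hm : ∀ w z, (∀ x y, (x, y) ∈ A.graph → inner ℂ y w = inner ℂ x z) → (w, z) ∈ A.graph) :
    IsSelfAdjoint A := by
  rw [LinearPMap.isSelfAdjoint_def]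
  apply LinearPMap.eq_of_eq_graph
  rw [LinearPMap.adjoint_graph_eq_graph_adjoint hd]
  ext ⟨w, z⟩
  rw [Submodule.mem_adjoint_iff]
  constructor
  · intro h
    exact hm w z fun x y hxy => sub_eq_zero.1 (h x y hxy)
  · intro h a b hab
    exact sub_eq_zero.2 (hs a b w z hab h)

/-- The image of a closed subspace of the graph under a continuous linear map that controls the
graph norm is closed. -/
theorem isClosed_map_of_graph_bound (g : Submodule ℂ (H × H)) (hg : IsClosed (g : Set (H × H)))
    (f : H × H →L[ℂ] H) {c : ℝ} (hf : ∀ p ∈ g, ‖p‖ ≤ c * ‖f p‖) :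
    IsClosed ((g.map f.toLinearMap : Submodule ℂ H) : Set H) := by
  have hc : CompleteSpace g := hg.completeSpace_coe
  have ha : AntilipschitzWith (Real.toNNReal c) (f.comp g.subtypeL) := by
    refine ContinuousLinearMap.antilipschitz_of_bound _ fun p => ?_
    refine (hf p p.2).trans ?_
    exact mul_le_mul_of_nonneg_right (Real.le_coe_toNNReal c) (norm_nonneg _)
  have h := ha.isClosed_range (f.comp g.subtypeL).uniformContinuous
  convert h using 1
  ext y
  simp

/-- Spectral gap of a self-adjoint operator: if zero is the only possible point of the spectrum
in `[-Λ, Λ]` and the range is closed, then `A` is bounded below by `Λ` on the orthogonal complement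
of its kernel. The inverse of `A` on that complement is a bounded self-adjoint operator, whose norm
is its spectral radius. -/
theorem norm_le_of_spectral_gap (hA : IsSelfAdjoint A)
    (hr : IsClosed (LinearMap.range A.toFun : Set H)) {Λ : ℝ} (hΛ : 0 < Λ)
    (hgap : ∀ t : ℝ, t ∈ Set.Icc (-Λ) Λ → (t : ℂ) ∈ Excision.spectrum A → t = 0)
    {x y : H} (hxy : (x, y) ∈ A.graph) (hx : x ∈ (kernel A)ᗮ) : Λ * ‖x‖ ≤ ‖y‖ := by
  set N := kernel A with hN
  have hNc : IsClosed (N : Set H) := by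
    have : (N : Set H) = (fun x => (x, (0 : H))) ⁻¹' (A.graph : Set (H × H)) := by
      ext x; exact mem_kernel_iff
    rw [this]
    exact (isClosed_graph hA).preimage (by fun_prop)
  have : CompleteSpace N := hNc.completeSpace_coe
  have hrange : LinearMap.range A.toFun = Nᗮ := by
    have : CompleteSpace (LinearMap.range A.toFun) := hr.completeSpace_coe
    rw [← Submodule.orthogonal_orthogonal (LinearMap.range A.toFun)]
    congr 1
    ext w
    rw [Submodule.mem_orthogonal, mem_kernel_iff]
    constructor
    · intro h
      refine mem_graph_of_forall_inner hA fun a b hab => ?_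
      rw [inner_zero_right]
      exact h b (mem_range_toFun_iff.2 ⟨a, hab⟩)
    · intro h b hb
      obtain ⟨a, hab⟩ := mem_range_toFun_iff.1 hb
      rw [inner_eq_of_mem_graph hA hab h, inner_zero_right]
  have huniq : ∀ a a' b : H, a ∈ Nᗮ → a' ∈ Nᗮ → (a, b) ∈ A.graph → (a', b) ∈ A.graph →
      a = a' := by
    intro a a' b ha ha' hab hab'
    have h1 : a - a' ∈ N := mem_kernel_iff.2 (by simpa using A.graph.sub_mem hab hab')
    have h2 : a - a' ∈ Nᗮ := Submodule.sub_mem _ ha ha'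
    exact sub_eq_zero.1 (inner_self_eq_zero.1 ((Submodule.mem_orthogonal _ _).1 h2 _ h1))
  have hex : ∀ y : H, ∃ a ∈ Nᗮ, (a, Nᗮ.starProjection y) ∈ A.graph := by
    intro y
    have : Nᗮ.starProjection y ∈ LinearMap.range A.toFun := by
      rw [hrange]; exact Submodule.starProjection_apply_mem _ _
    obtain ⟨a, ha⟩ := mem_range_toFun_iff.1 this
    refine ⟨a - N.starProjection a, Submodule.sub_starProjection_mem_orthogonal _, ?_⟩
    have h2 : (N.starProjection a, 0) ∈ A.graph :=
      mem_kernel_iff.1 (Submodule.starProjection_apply_mem _ _)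
    simpa using A.graph.sub_mem ha h2
  choose R₀ hR₀ hR₀g using hex
  let R₁ : H →ₗ[ℂ] H :=
    { toFun := R₀
      map_add' := fun a b => huniq _ _ _ (hR₀ _) (Submodule.add_mem _ (hR₀ _) (hR₀ _)) (hR₀g _)
        (by rw [map_add]; exact A.graph.add_mem (hR₀g a) (hR₀g b))
      map_smul' := fun c a => huniq _ _ _ (hR₀ _) (Submodule.smul_mem _ _ (hR₀ _)) (hR₀g _)
        (by rw [map_smul]; exact A.graph.smul_mem c (hR₀g a)) }
  have hgc : IsClosed (R₁.graph : Set (H × H)) := by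
    have : (R₁.graph : Set (H × H)) = {p | p.2 ∈ Nᗮ ∧ (p.2, Nᗮ.starProjection p.1) ∈ A.graph} := by
      ext ⟨a, b⟩
      simp only [SetLike.mem_coe, LinearMap.mem_graph_iff, Set.mem_ofPred_eq]
      constructor
      · rintro rfl
        exact ⟨hR₀ a, hR₀g a⟩
      · rintro ⟨h1, h2⟩
        exact huniq _ _ _ h1 (hR₀ a) h2 (hR₀g a)
    rw [this]
    refine IsClosed.inter (s₁ := {p : H × H | p.2 ∈ Nᗮ})
      ((Submodule.isClosed_orthogonal N).preimage continuous_snd) ?_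
    exact (isClosed_graph hA).preimage (by fun_prop)
  let R : H →L[ℂ] H := ContinuousLinearMap.ofIsClosedGraph hgc
  have hRN : ∀ a, R a ∈ Nᗮ := hR₀
  have hRg : ∀ a, (R a, Nᗮ.starProjection a) ∈ A.graph := hR₀g
  have hR_self : IsSelfAdjoint R := by
    rw [ContinuousLinearMap.isSelfAdjoint_iff_isSymmetric]
    intro a b
    have h := inner_eq_of_mem_graph hA (hRg a) (hRg b)
    change inner ℂ (R a) b = inner ℂ a (R b)
    have h1 : inner ℂ (R a) (Nᗮ.starProjection b) = inner ℂ (R a) b := by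
      rw [← Submodule.inner_starProjection_left_eq_right,
        Submodule.starProjection_eq_self_iff.2 (hRN a)]
    have h2 : inner ℂ (Nᗮ.starProjection a) (R b) = inner ℂ a (R b) := by
      rw [Submodule.inner_starProjection_left_eq_right,
        Submodule.starProjection_eq_self_iff.2 (hRN b)]
    rw [← h1, ← h2, h]
  have hRx : R y = x := by
    have hy : y ∈ Nᗮ := by rw [← hrange]; exact mem_range_toFun_iff.2 ⟨x, hxy⟩
    refine huniq _ _ y (hRN y) hx ?_ hxy
    have := hRg y
    rwa [Submodule.starProjection_eq_self_iff.2 hy] at this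
  have hnorm : ‖R‖ ≤ Λ⁻¹ := by
    by_contra! hlt
    have hnt : Nontrivial H := by
      by_contra hn
      rw [not_nontrivial_iff_subsingleton] at hn
      have : R = 0 := by ext a; exact Subsingleton.elim _ _
      rw [this, norm_zero] at hlt
      exact absurd hlt (not_lt.2 (inv_nonneg.2 hΛ.le))
    obtain ⟨k, hk, hkr⟩ := spectrum.exists_nnnorm_eq_spectralRadius R
    rw [IsSelfAdjoint.spectralRadius_eq_nnnorm hR_self] at hkr
    have hkn : ‖k‖ = ‖R‖ := by
      have : ‖k‖₊ = ‖R‖₊ := by exact_mod_cast hkr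
      exact congrArg NNReal.toReal this
    have hkre := hR_self.mem_spectrum_eq_re hk
    set s : ℝ := k.re with hs
    have hsR : |s| = ‖R‖ := by rw [← hkn, hkre, Complex.norm_real, Real.norm_eq_abs]
    have hspos : 0 < |s| := by rw [hsR]; exact (inv_pos.2 hΛ).trans hlt
    have hs0 : s ≠ 0 := abs_pos.1 hspos
    have ht : s⁻¹ ∈ Set.Icc (-Λ) Λ := by
      rw [Set.mem_Icc, ← abs_le, abs_inv, hsR]
      exact (inv_le_comm₀ ((inv_pos.2 hΛ).trans hlt) hΛ).2 hlt.le
    have htres : ((s⁻¹ : ℝ) : ℂ) ∈ resolventSet A := by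
      by_contra hne
      exact inv_ne_zero hs0 (hgap _ ht hne)
    obtain ⟨Q, hQ1, hQ2⟩ := htres
    have hsC : (s : ℂ) ≠ 0 := by exact_mod_cast hs0
    -- `s - R` is bijective because `A - 1/s` is
    apply hk
    rw [hkre]
    rw [spectrum.mem_resolventSet_iff, ContinuousLinearMap.isUnit_iff_bijective]
    constructor
    · rw [injective_iff_map_eq_zero]
      intro a ha
      have ha' : (s : ℂ) • a = R a := by
        have : (s : ℂ) • a - R a = 0 := by
          simpa [Algebra.algebraMap_eq_smul_one] using ha
        exact sub_eq_zero.1 this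
      have haN : a ∈ Nᗮ := by
        have := Submodule.smul_mem Nᗮ (s : ℂ)⁻¹ (hRN a)
        rwa [← ha', smul_smul, inv_mul_cancel₀ hsC, one_smul] at this
      have hag : (a, (s : ℂ)⁻¹ • a) ∈ A.graph := by
        have := A.graph.smul_mem (s : ℂ)⁻¹ (hRg a)
        rwa [Submodule.starProjection_eq_self_iff.2 haN, ← ha', Prod.smul_mk, smul_smul,
          inv_mul_cancel₀ hsC, one_smul] at this
      obtain ⟨u, hu, hu'⟩ := LinearPMap.mem_graph_iff _ |>.1 hag
      have := hQ2 u
      simp only at hu hu'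
      rw [hu', hu, Complex.ofReal_inv, sub_self, map_zero] at this
      exact this.symm
    · intro b
      set z := Nᗮ.starProjection b with hz
      have hzN : z ∈ Nᗮ := Submodule.starProjection_apply_mem _ _
      obtain ⟨u, hu, hu'⟩ := hQ1 z
      have hug : (Q z, z + (s : ℂ)⁻¹ • Q z) ∈ A.graph := by
        rw [LinearPMap.mem_graph_iff]
        refine ⟨u, hu, ?_⟩
        rw [sub_eq_iff_eq_add] at hu'
        rw [hu', ← hu, Complex.ofReal_inv]
      have hQN : z + (s : ℂ)⁻¹ • Q z ∈ Nᗮ := by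
        rw [← hrange]; exact mem_range_toFun_iff.2 ⟨_, hug⟩
      have hQN' : Q z ∈ Nᗮ := by
        have := Submodule.smul_mem _ (s : ℂ) (Submodule.sub_mem _ hQN hzN)
        rwa [add_sub_cancel_left, smul_smul, mul_inv_cancel₀ hsC, one_smul] at this
      have hRk : R (b - z) = 0 := by
        refine huniq _ _ 0 (hRN _) (Submodule.zero_mem _) ?_ A.graph.zero_mem
        have := hRg (b - z)
        rwa [map_sub Nᗮ.starProjection, ← hz, Submodule.starProjection_eq_self_iff.2 hzN,
          sub_self] at this
      have hRz : R (z + (s : ℂ)⁻¹ • Q z) = Q z := by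
        refine huniq _ _ _ (hRN _) hQN' ?_ hug
        have := hRg (z + (s : ℂ)⁻¹ • Q z)
        rwa [Submodule.starProjection_eq_self_iff.2 hQN] at this
      refine ⟨(s : ℂ)⁻¹ • ((b - z) + (z + (s : ℂ)⁻¹ • Q z)), ?_⟩
      have : (s : ℂ) • ((s : ℂ)⁻¹ • ((b - z) + (z + (s : ℂ)⁻¹ • Q z))) -
          R ((s : ℂ)⁻¹ • ((b - z) + (z + (s : ℂ)⁻¹ • Q z))) = b := by
        rw [map_smul, map_add, hRk, hRz, smul_smul, mul_inv_cancel₀ hsC, one_smul, zero_add]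
        abel
      simpa [Algebra.algebraMap_eq_smul_one] using this
  have h1 : ‖x‖ ≤ Λ⁻¹ * ‖y‖ := by
    rw [← hRx]
    exact (R.le_opNorm y).trans (mul_le_mul_of_nonneg_right hnorm (norm_nonneg _))
  calc Λ * ‖x‖ ≤ Λ * (Λ⁻¹ * ‖y‖) := mul_le_mul_of_nonneg_left h1 hΛ.le
    _ = ‖y‖ := by rw [← mul_assoc, mul_inv_cancel₀ hΛ.ne', one_mul]

end SelfAdjoint

/-! ### Index of a self-adjoint operator from an almost invariant finite-dimensional subspace -/

section AlmostKernel

variable {H : Type*} [NormedAddCommGroup H] [InnerProductSpace ℂ H] [CompleteSpace H]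

/-- A finite-dimensional subspace `V` of the domain of `A` that serves as an approximate kernel:
`A` is at most `ε` on `V` and at least `l > ε` on the orthogonal complement of `V`. -/
structure IsAlmostKernel (A : H →ₗ.[ℂ] H) (V : Submodule ℂ H) (ε l : ℝ) : Prop where
  finiteDimensional : FiniteDimensional ℂ V
  nonneg : 0 ≤ ε
  lt : ε < l
  exists_graph : ∀ v ∈ V, ∃ y, (v, y) ∈ A.graph ∧ ‖y‖ ≤ ε * ‖v‖
  lower : ∀ x y, (x, y) ∈ A.graph → x ∈ Vᗮ → l * ‖x‖ ≤ ‖y‖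

namespace IsAlmostKernel

variable {A : H →ₗ.[ℂ] H} {V : Submodule ℂ H} [FiniteDimensional ℂ V] {ε l : ℝ}

/-- By symmetry, the component of `A x` in `V` is controlled by `A` on `V`. -/
theorem norm_starProjection_le (hV : IsAlmostKernel A V ε l) (hA : IsSelfAdjoint A) {x y : H}
    (h : (x, y) ∈ A.graph) : ‖V.starProjection y‖ ≤ ε * ‖x‖ := by
  obtain ⟨z, hz, hzn⟩ := hV.exists_graph _ (Submodule.starProjection_apply_mem V y)
  have h1 : ‖V.starProjection y‖ ^ 2 ≤ ε * ‖V.starProjection y‖ * ‖x‖ := by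
    have e1 : inner ℂ (V.starProjection y) (V.starProjection y) = inner ℂ z x := by
      rw [inner_eq_of_mem_graph hA hz h, Submodule.inner_starProjection_left_eq_right,
        Submodule.starProjection_eq_self_iff.2 (Submodule.starProjection_apply_mem V y),
        ← Submodule.inner_starProjection_left_eq_right]
    have e2 : ‖V.starProjection y‖ ^ 2 = ‖inner ℂ z x‖ := by
      rw [← e1, inner_self_eq_norm_sq_to_K]
      simp
    rw [e2]
    exact (norm_inner_le_norm _ _).trans (mul_le_mul_of_nonneg_right hzn (norm_nonneg _))
  rcases (norm_nonneg (V.starProjection y)).eq_or_lt with h0 | h0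
  · rw [← h0]; exact mul_nonneg hV.nonneg (norm_nonneg _)
  · nlinarith

/-- The compression of `A` to `Vᗮ` is bounded below. -/
theorem norm_le_of_mem_orthogonal (hV : IsAlmostKernel A V ε l) (hA : IsSelfAdjoint A) {x y : H}
    (h : (x, y) ∈ A.graph) (hx : x ∈ Vᗮ) : (l - ε) * ‖x‖ ≤ ‖y - V.starProjection y‖ := by
  have h1 := hV.lower x y h hx
  have h2 := hV.norm_starProjection_le hA h
  have h3 : ‖y‖ ≤ ‖y - V.starProjection y‖ + ‖V.starProjection y‖ := by
    simpa using norm_add_le (y - V.starProjection y) (V.starProjection y)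
  linarith

theorem eq_zero_of_mem_orthogonal (hV : IsAlmostKernel A V ε l) (hA : IsSelfAdjoint A) {x y : H}
    (h : (x, y) ∈ A.graph) (hx : x ∈ Vᗮ) (hy : y ∈ V) : x = 0 := by
  have h1 := hV.norm_le_of_mem_orthogonal hA h hx
  rw [Submodule.starProjection_eq_self_iff.2 hy, sub_self, norm_zero] at h1
  have : ‖x‖ ≤ 0 := by
    by_contra! hc
    have := mul_pos (sub_pos.2 hV.lt) hc
    linarith
  exact norm_le_zero_iff.1 this

/-- The compression of `A` to `Vᗮ` is onto, because it is self-adjoint and bounded below. -/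
theorem exists_graph_sub_mem (hV : IsAlmostKernel A V ε l) (hA : IsSelfAdjoint A) {f : H} :
    ∃ x y, (x, y) ∈ A.graph ∧ x ∈ Vᗮ ∧ f - y ∈ V := by
  have hc : 0 < l - ε := sub_pos.2 hV.lt
  set g : Submodule ℂ (H × H) := A.graph ⊓ Vᗮ.comap (LinearMap.fst ℂ H H) with hg
  have hgc : IsClosed (g : Set (H × H)) :=
    (isClosed_graph hA).inter ((Submodule.isClosed_orthogonal V).preimage continuous_fst)
  let q : H × H →L[ℂ] H :=
    (ContinuousLinearMap.id ℂ H - V.starProjection).comp (ContinuousLinearMap.snd ℂ H H)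
  have hq : ∀ p : H × H, q p = p.2 - V.starProjection p.2 := fun p => rfl
  set R : Submodule ℂ H := g.map q.toLinearMap with hR
  have hRc : IsClosed (R : Set H) := by
    refine isClosed_map_of_graph_bound g hgc q (c := 1 + (1 + ε) * (l - ε)⁻¹) ?_
    rintro ⟨x, y⟩ ⟨hxy, hx⟩
    have h1 := hV.norm_le_of_mem_orthogonal hA hxy hx
    have h2 := hV.norm_starProjection_le hA hxy
    have h3 : ‖y‖ ≤ ‖y - V.starProjection y‖ + ‖V.starProjection y‖ := by
      simpa using norm_add_le (y - V.starProjection y) (V.starProjection y)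
    have h4 : ‖x‖ ≤ (l - ε)⁻¹ * ‖y - V.starProjection y‖ := by
      rw [← div_eq_inv_mul, le_div_iff₀ hc]; linarith
    have h5 := mul_le_mul_of_nonneg_left h4 hV.nonneg
    have h6 : 0 ≤ ε * ((l - ε)⁻¹ * ‖y - V.starProjection y‖) :=
      mul_nonneg hV.nonneg (mul_nonneg (inv_nonneg.2 hc.le) (norm_nonneg _))
    have h7 : 0 ≤ (l - ε)⁻¹ * ‖y - V.starProjection y‖ :=
      mul_nonneg (inv_nonneg.2 hc.le) (norm_nonneg _)
    have h8 := norm_nonneg (y - V.starProjection y)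
    rw [hq, Prod.norm_mk]
    apply max_le
    · linarith
    · linarith
  have : CompleteSpace R := hRc.completeSpace_coe
  have hRV : R ≤ Vᗮ := by
    rintro _ ⟨p, -, rfl⟩
    exact Submodule.sub_starProjection_mem_orthogonal _
  have hkey : Rᗮ ≤ V := by
    intro w₀ hw₀
    set w := w₀ - V.starProjection w₀ with hw
    have hwV : w ∈ Vᗮ := Submodule.sub_starProjection_mem_orthogonal _
    have hwR : w ∈ Rᗮ := by
      refine Submodule.sub_mem _ hw₀ ?_
      rw [Submodule.mem_orthogonal]
      intro r hr
      exact Submodule.inner_left_of_mem_orthogonal (Submodule.starProjection_apply_mem V w₀)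
        (hRV hr)
    -- `v ↦ ⟪w, A v⟫` is represented on `V` by a vector of `V`
    have hdom : V ≤ A.domain := fun v hv => by
      obtain ⟨y, hy, -⟩ := hV.exists_graph v hv
      exact LinearPMap.mem_domain_of_mem_graph hy
    let aV : V →L[ℂ] H := LinearMap.toContinuousLinearMap (A.toFun ∘ₗ Submodule.inclusion hdom)
    have haV : ∀ v : V, ((v : H), aV v) ∈ A.graph := fun v =>
      A.mem_graph (Submodule.inclusion hdom v)
    set z : V := (InnerProductSpace.toDual ℂ V).symm ((innerSL ℂ w).comp aV) with hz
    have hzv : ∀ v : V, inner ℂ (z : H) (v : H) = inner ℂ w (aV v) := fun v => by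
      have := InnerProductSpace.toDual_symm_apply (𝕜 := ℂ) (x := v) (y := (innerSL ℂ w).comp aV)
      rw [← hz] at this
      simpa using this
    have hwz : (w, (z : H)) ∈ A.graph := by
      refine mem_graph_of_forall_inner hA fun x y hxy => ?_
      set v : V := ⟨V.starProjection x, Submodule.starProjection_apply_mem V x⟩ with hv
      have h1 : (x - v, y - aV v) ∈ A.graph := A.graph.sub_mem hxy (haV v)
      have h2 : inner ℂ w (y - aV v) = 0 := by
        have h3 : q (x - v, y - aV v) ∈ R :=
          ⟨_, ⟨h1, Submodule.sub_starProjection_mem_orthogonal x⟩, rfl⟩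
        have h4 := Submodule.inner_left_of_mem_orthogonal h3 hwR
        rw [hq, inner_sub_right,
          Submodule.inner_left_of_mem_orthogonal (Submodule.starProjection_apply_mem V _) hwV,
          sub_zero] at h4
        exact h4
      rw [inner_sub_right, sub_eq_zero] at h2
      rw [← inner_conj_symm, h2, ← hzv, hv, ← inner_conj_symm x]
      congr 1
      rw [← Submodule.inner_starProjection_left_eq_right,
        Submodule.starProjection_eq_self_iff.2 z.2]
    have hw0 := hV.eq_zero_of_mem_orthogonal hA hwz hwV z.2
    rw [hw, sub_eq_zero] at hw0
    rw [hw0]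
    exact Submodule.starProjection_apply_mem V w₀
  have hfR : f - V.starProjection f ∈ R := by
    rw [← Submodule.orthogonal_orthogonal R]
    exact Submodule.orthogonal_le hkey (Submodule.sub_starProjection_mem_orthogonal f)
  obtain ⟨⟨x, y⟩, ⟨hxy, hx⟩, h⟩ := hfR
  refine ⟨x, y, hxy, hx, ?_⟩
  change q (x, y) = _ at h
  rw [hq] at h
  have : f - y = V.starProjection f - V.starProjection y := by
    simp only at h
    calc f - y = (f - V.starProjection f) - (y - V.starProjection y) +
          (V.starProjection f - V.starProjection y) := by abel
      _ = _ := by rw [h, sub_self, zero_add]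
  rw [this]
  exact Submodule.sub_mem _ (Submodule.starProjection_apply_mem V _)
    (Submodule.starProjection_apply_mem V _)

theorem finiteDimensional_kernel (hV : IsAlmostKernel A V ε l) (hA : IsSelfAdjoint A) :
    FiniteDimensional ℂ (kernel A) := by
  refine FiniteDimensional.of_injective
    (V.orthogonalProjectionOnto.toLinearMap ∘ₗ (kernel A).subtype) ?_
  rw [injective_iff_map_eq_zero]
  rintro ⟨x, hx⟩ h
  have hx' : x ∈ Vᗮ := by
    rw [← Submodule.starProjection_apply_eq_zero_iff]
    exact congrArg Subtype.val h
  have := hV.eq_zero_of_mem_orthogonal hA (mem_kernel_iff.1 hx) hx' V.zero_mem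
  exact Subtype.ext this

/-- The range of `A` is the sum of the closed space `A (Vᗮ)` and a finite-dimensional one, and the
cokernel is a quotient of `V`. -/
theorem isFredholm (hV : IsAlmostKernel A V ε l) (hA : IsSelfAdjoint A) : IsFredholm A where
  isClosed := hA.isClosed
  dense_domain := hA.dense_domain
  finite_kernel := hV.finiteDimensional_kernel hA
  isClosed_range := by
    have hdom : V ≤ A.domain := fun v hv => by
      obtain ⟨y, hy, -⟩ := hV.exists_graph v hv
      exact LinearPMap.mem_domain_of_mem_graph hy
    have hl : 0 < l := hV.nonneg.trans_lt hV.lt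
    set g : Submodule ℂ (H × H) := A.graph ⊓ Vᗮ.comap (LinearMap.fst ℂ H H) with hg
    have hgc : IsClosed (g : Set (H × H)) :=
      (isClosed_graph hA).inter ((Submodule.isClosed_orthogonal V).preimage continuous_fst)
    have hR : IsClosed ((g.map (ContinuousLinearMap.snd ℂ H H).toLinearMap : Submodule ℂ H) :
        Set H) := by
      refine isClosed_map_of_graph_bound g hgc _ (c := 1 + l⁻¹) ?_
      rintro ⟨x, y⟩ ⟨hxy, hx⟩
      have h1 := hV.lower x y hxy hx
      have h4 : ‖x‖ ≤ l⁻¹ * ‖y‖ := by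
        rw [← div_eq_inv_mul, le_div_iff₀ hl]; linarith
      have h5 : 0 ≤ l⁻¹ * ‖y‖ := mul_nonneg (inv_nonneg.2 hl.le) (norm_nonneg _)
      have := norm_nonneg y
      rw [Prod.norm_mk]
      change _ ≤ (1 + l⁻¹) * ‖y‖
      apply max_le <;> linarith
    -- the range is the sum of `A (Vᗮ)` and `A V`
    have hsup : LinearMap.range A.toFun =
        g.map (ContinuousLinearMap.snd ℂ H H).toLinearMap ⊔
          LinearMap.range (A.toFun ∘ₗ Submodule.inclusion hdom) := by
      apply le_antisymm
      · intro y hy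
        obtain ⟨x, hxy⟩ := mem_range_toFun_iff.1 hy
        set v : V := ⟨V.starProjection x, Submodule.starProjection_apply_mem V x⟩ with hv
        have h2 := A.mem_graph (Submodule.inclusion hdom v)
        rw [Submodule.mem_sup]
        refine ⟨y - A (Submodule.inclusion hdom v), ⟨_, ⟨A.graph.sub_mem hxy h2, ?_⟩, rfl⟩,
          _, ⟨v, rfl⟩, sub_add_cancel _ _⟩
        exact Submodule.sub_starProjection_mem_orthogonal x
      · rw [sup_le_iff]
        constructor
        · rintro _ ⟨⟨x, y⟩, ⟨hxy, -⟩, rfl⟩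
          exact mem_range_toFun_iff.2 ⟨x, hxy⟩
        · rintro _ ⟨v, rfl⟩
          exact ⟨_, rfl⟩
    rw [hsup]
    exact Submodule.isClosed_sup_finiteDimensional _ _ hR
  finite_cokernel := by
    refine Module.Finite.of_surjective
      ((LinearMap.range A.toFun).mkQ ∘ₗ V.subtype) fun y => ?_
    obtain ⟨f, rfl⟩ := Submodule.mkQ_surjective _ y
    obtain ⟨x, y, hxy, -, h⟩ := hV.exists_graph_sub_mem hA (f := f)
    refine ⟨⟨_, h⟩, ?_⟩
    have h1 : (LinearMap.range A.toFun).mkQ y = 0 := by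
      rw [Submodule.mkQ_apply, Submodule.Quotient.mk_eq_zero]
      exact mem_range_toFun_iff.2 ⟨x, hxy⟩
    rw [LinearMap.comp_apply, Submodule.subtype_apply, map_sub, h1, sub_zero]

/-- Every `v ∈ V` lifts uniquely to a pair `(x, A x)` with `A x ∈ V` and `x ≡ v` modulo `Vᗮ`. -/
theorem exists_lift (hV : IsAlmostKernel A V ε l) (hA : IsSelfAdjoint A) {v : H} (hv : v ∈ V) :
    ∃ x y, (x, y) ∈ A.graph ∧ y ∈ V ∧ x - v ∈ Vᗮ := by
  obtain ⟨z, hz, -⟩ := hV.exists_graph v hv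
  obtain ⟨x, y, hxy, hx, hy⟩ := hV.exists_graph_sub_mem hA (f := -z)
  refine ⟨v + x, z + y, A.graph.add_mem hz hxy, ?_, by simpa using hx⟩
  have := V.neg_mem hy
  rwa [neg_sub, sub_neg_eq_add, add_comm] at this

theorem lift_unique (hV : IsAlmostKernel A V ε l) (hA : IsSelfAdjoint A) {x y x' y' v : H}
    (h : (x, y) ∈ A.graph) (h' : (x', y') ∈ A.graph) (hy : y ∈ V) (hy' : y' ∈ V)
    (hx : x - v ∈ Vᗮ) (hx' : x' - v ∈ Vᗮ) : x = x' ∧ y = y' := by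
  have h1 := A.graph.sub_mem h h'
  have h2 : x - x' ∈ Vᗮ := by
    have := Submodule.sub_mem _ hx hx'
    rwa [sub_sub_sub_cancel_right] at this
  have h3 := hV.eq_zero_of_mem_orthogonal hA h1 h2 (V.sub_mem hy hy')
  refine ⟨sub_eq_zero.1 h3, sub_eq_zero.1 ?_⟩
  exact A.graph_fst_eq_zero_snd h1 h3

/-- The index of an odd operator is the graded dimension of an approximate kernel. For the lift
`x` of `v ∈ V`, the assignment `S v = A x` is an odd symmetric endomorphism of `V` whose kernel
is isomorphic to the kernel of `A`; so the claim is the rank-nullity theorem for the two halves of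
`S`, which are adjoint to each other. -/
theorem finrank_sub_finrank (hV : IsAlmostKernel A V ε l) (hA : IsSelfAdjoint A)
    {γ : H →L[ℂ] H} (hγs : ∀ x y, inner ℂ (γ x) y = inner ℂ x (γ y))
    (hγA : ∀ x y, (x, y) ∈ A.graph → (γ x, -γ y) ∈ A.graph) (hγV : ∀ v ∈ V, γ v ∈ V)
    (E : ℂ → Submodule ℂ H) (hE : ∀ s x, x ∈ E s ↔ γ x = s • x) :
    (Module.finrank ℂ ↥(kernel A ⊓ E 1) : ℤ) - Module.finrank ℂ ↥(kernel A ⊓ E (-1)) =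
      (Module.finrank ℂ ↥(V ⊓ E 1) : ℤ) - Module.finrank ℂ ↥(V ⊓ E (-1)) := by
  have hex : ∀ v : V, ∃ x y, (x, y) ∈ A.graph ∧ y ∈ V ∧ x - v ∈ Vᗮ := fun v =>
    hV.exists_lift hA v.2
  choose X Y hXY hY hX using hex
  have huniq : ∀ (v : V) (x y : H), (x, y) ∈ A.graph → y ∈ V → x - v ∈ Vᗮ → X v = x ∧ Y v = y :=
    fun v x y h hy hx => hV.lift_unique hA (hXY v) h (hY v) hy (hX v) hx
  have hadd : ∀ v w : V, X (v + w) = X v + X w ∧ Y (v + w) = Y v + Y w := fun v w => by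
    refine huniq _ _ _ (A.graph.add_mem (hXY v) (hXY w)) (V.add_mem (hY v) (hY w)) ?_
    have := Submodule.add_mem _ (hX v) (hX w)
    rwa [sub_add_sub_comm] at this
  have hsmul : ∀ (c : ℂ) (v : V), X (c • v) = c • X v ∧ Y (c • v) = c • Y v := fun c v => by
    refine huniq _ _ _ (A.graph.smul_mem c (hXY v)) (V.smul_mem c (hY v)) ?_
    have := Submodule.smul_mem _ c (hX v)
    rwa [smul_sub] at this
  let Xl : V →ₗ[ℂ] H := ⟨⟨X, fun v w => (hadd v w).1⟩, fun c v => (hsmul c v).1⟩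
  let S : V →ₗ[ℂ] V := ⟨⟨fun v => ⟨Y v, hY v⟩, fun v w => Subtype.ext (hadd v w).2⟩,
    fun c v => Subtype.ext (hsmul c v).2⟩
  have hSsymm : ∀ v w : V, inner ℂ (S v) w = inner ℂ v (S w) := by
    intro v w
    change inner ℂ (Y v) (w : H) = inner ℂ (v : H) (Y w)
    have h := inner_eq_of_mem_graph hA (hXY v) (hXY w)
    have h1 : inner ℂ (Y v) (X w - w) = 0 :=
      Submodule.inner_right_of_mem_orthogonal (hY v) (hX w)
    have h2 : inner ℂ (X v - v) (Y w) = 0 :=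
      Submodule.inner_left_of_mem_orthogonal (hY w) (hX v)
    rw [inner_sub_right, sub_eq_zero] at h1
    rw [inner_sub_left, sub_eq_zero] at h2
    rw [← h1, ← h2, h]
  let G : V →ₗ[ℂ] V := γ.toLinearMap.restrict hγV
  have hG : ∀ v : V, ((G v : V) : H) = γ v := fun v => rfl
  have hGorth : ∀ x ∈ Vᗮ, γ x ∈ Vᗮ := by
    intro x hx
    rw [Submodule.mem_orthogonal]
    intro u hu
    rw [← hγs]
    exact (Submodule.mem_orthogonal _ _).1 hx _ (hγV u hu)
  have hXG : ∀ v : V, X (G v) = γ (X v) ∧ Y (G v) = -γ (Y v) := fun v => by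
    refine huniq _ _ _ (hγA _ _ (hXY v)) (V.neg_mem (hγV _ (hY v))) ?_
    rw [hG, ← map_sub]
    exact hGorth _ (hX v)
  -- eigenspaces of the grading on `V`
  let W : ℂ → Submodule ℂ V := fun s => (E s).comap V.subtype
  have hW : ∀ (s : ℂ) (v : V), v ∈ W s ↔ γ v = s • (v : H) := fun s v => hE s v
  have hdimV : ∀ s, Module.finrank ℂ ↥(V ⊓ E s) = Module.finrank ℂ (W s) := by
    intro s
    have : V ⊓ E s = (W s).map V.subtype := by
      rw [Submodule.map_comap_subtype]
    rw [this]
    exact ((W s).equivMapOfInjective V.subtype V.injective_subtype).finrank_eq.symm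
  have hSW : ∀ s, ∀ v ∈ W s, S v ∈ W (-s) := by
    intro s v hv
    rw [hW] at hv ⊢
    have h1 : G v = s • v := Subtype.ext hv
    have h2 := (hXG v).2
    rw [h1, (hsmul s v).2] at h2
    change γ (Y v) = -s • Y v
    rw [neg_smul, h2, neg_neg]
  have hXinj : Function.Injective Xl := by
    rw [injective_iff_map_eq_zero]
    intro v hv
    have h1 := hX v
    have h2 : X v = 0 := hv
    rw [h2, zero_sub] at h1
    have h3 := Submodule.inner_right_of_mem_orthogonal v.2 h1
    rw [inner_neg_right, neg_eq_zero] at h3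
    exact Subtype.ext (inner_self_eq_zero.1 h3)
  have hdimK : ∀ s, Module.finrank ℂ ↥(kernel A ⊓ E s) =
      Module.finrank ℂ ↥(LinearMap.ker S ⊓ W s) := by
    intro s
    have : kernel A ⊓ E s = (LinearMap.ker S ⊓ W s).map Xl := by
      ext x
      constructor
      · rintro ⟨hx, hxE⟩
        rw [SetLike.mem_coe, mem_kernel_iff] at hx
        rw [SetLike.mem_coe, hE] at hxE
        set v : V := ⟨V.starProjection x, Submodule.starProjection_apply_mem V x⟩ with hv
        obtain ⟨h1, h2⟩ := huniq v x 0 hx V.zero_mem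
          (Submodule.sub_starProjection_mem_orthogonal x)
        refine ⟨v, ⟨Subtype.ext h2, ?_⟩, h1⟩
        rw [SetLike.mem_coe]
        rw [hW]
        refine sub_eq_zero.1 (inner_self_eq_zero (𝕜 := ℂ).1 ?_)
        have h3 : γ v - s • (v : H) ∈ V := V.sub_mem (hγV _ v.2) (V.smul_mem s v.2)
        have h4 : γ v - s • (v : H) ∈ Vᗮ := by
          have e : γ v - s • (v : H) = s • (x - v) - γ (x - v) := by
            rw [map_sub, hxE, smul_sub]; abel
          rw [e]
          have h5 := Submodule.sub_starProjection_mem_orthogonal (K := V) x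
          exact Submodule.sub_mem _ (Submodule.smul_mem _ _ h5) (hGorth _ h5)
        exact Submodule.inner_right_of_mem_orthogonal h3 h4
      · rintro ⟨v, ⟨hv, hvW⟩, rfl⟩
        have h0 : Y v = 0 := congrArg Subtype.val hv
        have h1 : G v = s • v := Subtype.ext ((hW s v).1 hvW)
        refine ⟨mem_kernel_iff.2 ?_, (hE _ _).2 ?_⟩
        · rw [← h0]; exact hXY v
        · have h2 := (hXG v).1
          rw [h1, (hsmul s v).1] at h2
          exact h2.symm
    rw [this]
    exact (Submodule.equivMapOfInjective Xl hXinj _).finrank_eq.symm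
  have hrank : ∀ U : Submodule ℂ V, Module.finrank ℂ (U.map S) +
      Module.finrank ℂ ↥(LinearMap.ker S ⊓ U) = Module.finrank ℂ U := by
    intro U
    have h := LinearMap.finrank_range_add_finrank_ker (S.domRestrict U)
    rw [LinearMap.range_domRestrict] at h
    rw [← h]
    congr 1
    have e : LinearMap.ker S ⊓ U = (LinearMap.ker (S.domRestrict U)).map U.subtype := by
      rw [LinearMap.ker_domRestrict, Submodule.map_comap_subtype, inf_comm]
    rw [e]
    exact (Submodule.equivMapOfInjective U.subtype U.injective_subtype _).finrank_eq.symm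
  have hle : (W 1).map S ≤ W (-1) := by
    rintro _ ⟨v, hv, rfl⟩
    exact hSW 1 v hv
  have hker : ((W 1).map S)ᗮ ⊓ W (-1) = LinearMap.ker S ⊓ W (-1) := by
    ext w
    simp only [Submodule.mem_inf, LinearMap.mem_ker]
    refine and_congr_left fun hw => ⟨fun h => ?_, fun h => ?_⟩
    · have h1 : S w ∈ W 1 := by simpa using hSW _ w hw
      have h2 := Submodule.inner_right_of_mem_orthogonal (Submodule.mem_map_of_mem (f := S) h1) h
      rw [hSsymm] at h2
      exact inner_self_eq_zero.1 h2
    · rw [Submodule.mem_orthogonal]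
      rintro _ ⟨v, -, rfl⟩
      rw [hSsymm, h, inner_zero_right]
  have h1 := hrank (W 1)
  have h2 := Submodule.finrank_add_inf_finrank_orthogonal hle
  rw [hker] at h2
  rw [hdimK, hdimK, hdimV, hdimV]
  omega

end IsAlmostKernel

end AlmostKernel

/-! ### Excision for a pair of self-adjoint operators -/

section HilbertExcision

variable {H : Type*} [NormedAddCommGroup H] [InnerProductSpace ℂ H] [CompleteSpace H]
  {H' : Type*} [NormedAddCommGroup H'] [InnerProductSpace ℂ H'] [CompleteSpace H']

/-- A transfer operator from `H` to `H'`, the abstract form of `φ ↦ τ_* (χ φ)` for a cutoff function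
`χ`. The number `(‖y‖ + K ‖x‖) / m`, where `y = A x`, bounds the norm of the part of `x` on the
region where the potential is coercive; up to that part, `W` preserves `‖x‖` and `‖A x‖`. -/
structure IsTransfer (A : H →ₗ.[ℂ] H) (A' : H' →ₗ.[ℂ] H') (K m : ℝ) (W : H →L[ℂ] H') : Prop where
  norm_ge : ∀ x y, (x, y) ∈ A.graph → ‖x‖ - (‖y‖ + K * ‖x‖) / m ≤ ‖W x‖
  exists_graph : ∀ x y, (x, y) ∈ A.graph →
    ∃ z, (W x, z) ∈ A'.graph ∧ ‖z‖ ≤ ‖y‖ + 2 * K * ((‖y‖ + K * ‖x‖) / m)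

/-- Transfer operators in opposite directions are adjoint to each other, up to the parts of the
vectors in the coercive regions. -/
def AlmostAdjoint (A : H →ₗ.[ℂ] H) (A' : H' →ₗ.[ℂ] H') (K m : ℝ) (W : H →L[ℂ] H')
    (W' : H' →L[ℂ] H) : Prop :=
  ∀ x y x' y', (x, y) ∈ A.graph → (x', y') ∈ A'.graph →
    ‖inner ℂ (W' x') x - inner ℂ x' (W x)‖ ≤
      ‖x'‖ * ((‖y‖ + K * ‖x‖) / m) + (‖y'‖ + K * ‖x'‖) / m * ‖x‖

variable {A : H →ₗ.[ℂ] H} {A' : H' →ₗ.[ℂ] H'} {K m Λ C : ℝ} {W : H →L[ℂ] H'} {W' : H' →L[ℂ] H}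

/-- The numerical content of the assumption on `m`. The bound on `K / m` follows from
`C² + Λ² ≥ 2 C Λ`, the other two from `C² + Λ² ≥ C²` and `C² + Λ² ≥ Λ²`. -/
theorem bounds_of_lt (hK : 0 ≤ K) (hC : 0 < C) (hKC : 4 * K ≤ C) (hΛ : 0 < Λ)
    (hm : 2 * (C ^ 2 + Λ ^ 2) / Λ < m) :
    0 < m ∧ K / m ≤ 1 / 16 ∧ K * (K / m) ≤ Λ / 32 ∧ Λ / m ≤ 1 / 2 := by
  rw [div_lt_iff₀ hΛ] at hm
  have hm0 : 0 < m := by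
    by_contra! h
    have := mul_nonpos_of_nonpos_of_nonneg h hΛ.le
    have : 0 < 2 * (C ^ 2 + Λ ^ 2) := by positivity
    linarith
  have h4 : 4 * C ≤ m := by
    by_contra! h
    have := mul_lt_mul_of_pos_right h hΛ
    nlinarith [sq_nonneg (C - Λ)]
  refine ⟨hm0, ?_, ?_, ?_⟩
  · rw [div_le_iff₀ hm0]; linarith
  · rw [← mul_div_assoc, div_le_iff₀ hm0]
    nlinarith [mul_nonneg hK hK, sq_nonneg Λ, sq_nonneg (C - 4 * K)]
  · rw [div_le_iff₀ hm0]
    by_contra! h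
    have := mul_lt_mul_of_pos_right h hΛ
    nlinarith [sq_nonneg C]

theorem norm_transfer_ge_of_mem_kernel (hW : IsTransfer A A' K m W)
    (hk : K / m ≤ 1 / 16) {x : H} (hx : x ∈ kernel A) : 15 / 16 * ‖x‖ ≤ ‖W x‖ := by
  have h := hW.norm_ge x 0 (mem_kernel_iff.1 hx)
  rw [norm_zero, zero_add, mul_div_right_comm] at h
  have := mul_le_mul_of_nonneg_right hk (norm_nonneg x)
  linarith

/-- The image of the kernel of `A` under the transfer operator is an approximate kernel of `A'`.
A vector orthogonal to that image on which `A'` is small would be transferred back to a vector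
almost orthogonal to the kernel of `A` on which `A` is small, against the spectral gap. -/
theorem isAlmostKernel_map (hK : 0 ≤ K) (hC : 0 < C)
    (hKC : 4 * K ≤ C) (hΛ : 0 < Λ) (hm : 2 * (C ^ 2 + Λ ^ 2) / Λ < m)
    (hfin : FiniteDimensional ℂ (kernel A))
    (hgap : ∀ x y, (x, y) ∈ A.graph → x ∈ (kernel A)ᗮ → Λ * ‖x‖ ≤ ‖y‖)
    (hW : IsTransfer A A' K m W) (hW' : IsTransfer A' A K m W')
    (hWW' : AlmostAdjoint A A' K m W W') :
    IsAlmostKernel A' ((kernel A).map W.toLinearMap) (Λ / 8) (Λ / 4) := by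
  obtain ⟨hm0, hk, hKk, hl⟩ := bounds_of_lt hK hC hKC hΛ hm
  refine ⟨inferInstance, by positivity, by linarith, ?_, ?_⟩
  · rintro _ ⟨x, hx, rfl⟩
    obtain ⟨z, hz, hzn⟩ := hW.exists_graph x 0 (mem_kernel_iff.1 hx)
    refine ⟨z, hz, hzn.trans ?_⟩
    have h1 := norm_transfer_ge_of_mem_kernel hW hk hx
    have h2 := mul_le_mul_of_nonneg_right hKk (norm_nonneg x)
    have h3 := mul_le_mul_of_nonneg_left h1 hΛ.le
    have h4 := mul_nonneg hΛ.le (norm_nonneg x)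
    have h5 : 2 * K * (K * ‖x‖ / m) = 2 * (K * (K / m) * ‖x‖) := by ring
    change _ ≤ Λ / 8 * ‖W x‖
    rw [norm_zero, zero_add, zero_add, h5]
    linarith
  · intro x' y' hxy hx'
    by_contra! hlt
    have hp : 0 < ‖x'‖ := by
      by_contra! h
      have h0 : ‖x'‖ = 0 := le_antisymm h (norm_nonneg _)
      rw [h0, mul_zero] at hlt
      exact absurd hlt (not_lt.2 (norm_nonneg _))
    -- the mass of `x'` in the coercive region
    set b := (‖y'‖ + K * ‖x'‖) / m with hb
    have hb0 : 0 ≤ b := by positivity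
    have hb1 : b ≤ (Λ / m / 4 + K / m) * ‖x'‖ := by
      have : (Λ / m / 4 + K / m) * ‖x'‖ = (Λ / 4 * ‖x'‖ + K * ‖x'‖) / m := by ring
      rw [hb, this]
      gcongr
    obtain ⟨z, hz, hzn⟩ := hW'.exists_graph x' y' hxy
    have hge := hW'.norm_ge x' y' hxy
    rw [← hb] at hzn hge
    -- `W' x'` is almost orthogonal to the kernel, because `x'` is orthogonal to `W (ker A)`
    set p := (kernel A).starProjection (W' x') with hp_def
    have hpk : p ∈ kernel A := Submodule.starProjection_apply_mem _ _
    have hp0 : (p, (0 : H)) ∈ A.graph := mem_kernel_iff.1 hpk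
    have hpn : ‖p‖ ≤ K / m * ‖x'‖ + b := by
      have h1 := hWW' p 0 x' y' hp0 hxy
      have h2 : inner ℂ x' (W p) = 0 :=
        Submodule.inner_left_of_mem_orthogonal (Submodule.mem_map_of_mem (f := W.toLinearMap) hpk)
          hx'
      have h3 : inner ℂ (W' x') p = inner ℂ p p := by
        conv_rhs => rw [hp_def, Submodule.inner_starProjection_left_eq_right,
          Submodule.starProjection_eq_self_iff.2 (Submodule.starProjection_apply_mem _ _)]
      rw [h2, sub_zero, h3, norm_zero, zero_add, ← hb, inner_self_eq_norm_sq_to_K] at h1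
      have h4 : ‖p‖ ^ 2 ≤ (K / m * ‖x'‖ + b) * ‖p‖ := by
        have : ‖((‖p‖ : ℂ)) ^ 2‖ = ‖p‖ ^ 2 := by simp
        calc ‖p‖ ^ 2 = ‖((‖p‖ : ℂ)) ^ 2‖ := this.symm
          _ ≤ _ := h1
          _ = _ := by ring
      rcases (norm_nonneg p).eq_or_lt with h0 | h0
      · rw [← h0]; positivity
      · rw [sq] at h4
        exact le_of_mul_le_mul_right h4 h0
    have h1 := hgap (W' x' - p) (z - 0) (A.graph.sub_mem hz hp0)
      (Submodule.sub_starProjection_mem_orthogonal _)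
    have h2 := norm_sub_norm_le (W' x') p
    rw [sub_zero] at h1
    have h3 : 2 * K * b ≤ (Λ / 32 + Λ / 16) * ‖x'‖ := by
      have e1 : K * b ≤ K * ((Λ / m / 4 + K / m) * ‖x'‖) := mul_le_mul_of_nonneg_left hb1 hK
      have e2 : K * ((Λ / m / 4 + K / m) * ‖x'‖) =
          (K / m * Λ / 4 + K * (K / m)) * ‖x'‖ := by ring
      have e3 : K / m * Λ ≤ 1 / 16 * Λ := mul_le_mul_of_nonneg_right hk hΛ.le
      have e4 : (K / m * Λ / 4 + K * (K / m)) * ‖x'‖ ≤ (Λ / 64 + Λ / 32) * ‖x'‖ :=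
        mul_le_mul_of_nonneg_right (by linarith) hp.le
      linarith
    have hb2 : b ≤ 3 / 16 * ‖x'‖ :=
      hb1.trans (mul_le_mul_of_nonneg_right (by linarith) hp.le)
    have hk2 := mul_le_mul_of_nonneg_right hk hp.le
    have h4 : 9 / 16 * ‖x'‖ ≤ ‖W' x' - p‖ := by linarith
    have h5 := mul_le_mul_of_nonneg_left h4 hΛ.le
    have h6 := mul_pos hΛ hp
    linarith

/-- Excision for self-adjoint operators on Hilbert spaces. The submodules `E s` and `E' s` are the
eigenspaces of the gradings `γ` and `γ'`; both indices are the graded dimension of `W (ker A)`. -/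
theorem index_eq_of_transfer (hA : IsSelfAdjoint A) (hA' : IsSelfAdjoint A') (hK : 0 ≤ K)
    (hC : 0 < C) (hKC : 4 * K ≤ C) (hΛ : 0 < Λ) (hm : 2 * (C ^ 2 + Λ ^ 2) / Λ < m)
    (hF : IsFredholm A)
    (hspec : ∀ t : ℝ, t ∈ Set.Icc (-Λ) Λ → (t : ℂ) ∈ Excision.spectrum A → t = 0)
    (hW : IsTransfer A A' K m W) (hW' : IsTransfer A' A K m W')
    (hWW' : AlmostAdjoint A A' K m W W')
    {γ : H →L[ℂ] H} (hγA : ∀ x y, (x, y) ∈ A.graph → (γ x, -γ y) ∈ A.graph)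
    {γ' : H' →L[ℂ] H'} (hγs' : ∀ x y, inner ℂ (γ' x) y = inner ℂ x (γ' y))
    (hγA' : ∀ x y, (x, y) ∈ A'.graph → (γ' x, -γ' y) ∈ A'.graph)
    (hWγ : ∀ x, W (γ x) = γ' (W x))
    (E : ℂ → Submodule ℂ H) (hE : ∀ s x, x ∈ E s ↔ γ x = s • x)
    (E' : ℂ → Submodule ℂ H') (hE' : ∀ s x, x ∈ E' s ↔ γ' x = s • x) :
    IsFredholm A' ∧
      (Module.finrank ℂ ↥(kernel A ⊓ E 1) : ℤ) - Module.finrank ℂ ↥(kernel A ⊓ E (-1)) =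
      (Module.finrank ℂ ↥(kernel A' ⊓ E' 1) : ℤ) - Module.finrank ℂ ↥(kernel A' ⊓ E' (-1)) := by
  obtain ⟨-, hk, -, -⟩ := bounds_of_lt hK hC hKC hΛ hm
  have hfin := hF.finite_kernel
  have hV := isAlmostKernel_map hK hC hKC hΛ hm hfin
    (fun x y h hx => norm_le_of_spectral_gap hA hF.isClosed_range hΛ hspec h hx) hW hW' hWW'
  have hγk : ∀ x ∈ kernel A, γ x ∈ kernel A := fun x hx => by
    have := hγA x 0 (mem_kernel_iff.1 hx)
    rw [map_zero, neg_zero] at this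
    exact mem_kernel_iff.2 this
  have hinj : ∀ x ∈ kernel A, W x = 0 → x = 0 := fun x hx h => by
    have := norm_transfer_ge_of_mem_kernel hW hk hx
    rw [h, norm_zero] at this
    exact norm_le_zero_iff.1 (by linarith)
  have hdim : ∀ s, Module.finrank ℂ ↥(kernel A ⊓ E s) =
      Module.finrank ℂ ↥((kernel A).map W.toLinearMap ⊓ E' s) := by
    intro s
    have e : (kernel A).map W.toLinearMap ⊓ E' s = (kernel A ⊓ E s).map W.toLinearMap := by
      ext v
      constructor
      · rintro ⟨⟨x, hx, rfl⟩, hv⟩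
        refine ⟨x, ⟨hx, ?_⟩, rfl⟩
        rw [SetLike.mem_coe, hE'] at hv
        rw [SetLike.mem_coe, hE]
        refine sub_eq_zero.1 (hinj _ (Submodule.sub_mem _ (hγk x hx)
          (Submodule.smul_mem _ s hx)) ?_)
        rw [map_sub, map_smul, hWγ, sub_eq_zero]
        exact hv
      · rintro ⟨x, ⟨hx, hxE⟩, rfl⟩
        refine ⟨⟨x, hx, rfl⟩, ?_⟩
        rw [SetLike.mem_coe, hE] at hxE
        rw [SetLike.mem_coe, hE']
        change γ' (W x) = s • W x
        rw [← hWγ, hxE, map_smul]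
    rw [e]
    refine LinearEquiv.finrank_eq (LinearEquiv.ofBijective
      (W.toLinearMap.submoduleMap (kernel A ⊓ E s)) ⟨?_, LinearMap.submoduleMap_surjective _ _⟩)
    rw [injective_iff_map_eq_zero]
    rintro ⟨x, hx⟩ h
    exact Subtype.ext (hinj x hx.1 (congrArg Subtype.val h))
  have hV' := hV.finiteDimensional
  refine ⟨hV.isFredholm hA', ?_⟩
  rw [hV.finrank_sub_finrank hA' hγs' hγA' ?_ E' hE', hdim, hdim]
  rintro _ ⟨x, hx, rfl⟩
  exact ⟨γ x, hγk x hx, hWγ x⟩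

end HilbertExcision

/-! ### The Riemannian volume measure under local isometries -/

section Volume

variable {n : ℕ} {Z : Type*} [TopologicalSpace Z] [ChartedSpace (EuclideanSpace ℝ (Fin n)) Z]
  [IsManifold (𝓡 n) ∞ Z] [RiemannianBundle (fun x : Z => TangentSpace (𝓡 n) x)]
  {Z' : Type*} [TopologicalSpace Z'] [ChartedSpace (EuclideanSpace ℝ (Fin n)) Z']
  [IsManifold (𝓡 n) ∞ Z'] [RiemannianBundle (fun x : Z' => TangentSpace (𝓡 n) x)]

local notation "𝔼" => EuclideanSpace ℝ (Fin n)

theorem mdifferentiableAt_chart_symm (c : Z) {u : 𝔼} (hu : u ∈ (chartAt 𝔼 c).target) :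
    MDifferentiableAt (𝓡 n) (𝓡 n) (chartAt 𝔼 c).symm u := by
  have : IsManifold (𝓡 n) 1 Z := IsManifold.of_le (n := ∞) (by simp)
  exact mdifferentiableAt_atlas_symm (chart_mem_atlas 𝔼 c) hu

theorem mdifferentiableAt_chart (c : Z) {x : Z} (hx : x ∈ (chartAt 𝔼 c).source) :
    MDifferentiableAt (𝓡 n) (𝓡 n) (chartAt 𝔼 c) x := by
  have : IsManifold (𝓡 n) 1 Z := IsManifold.of_le (n := ∞) (by simp)
  exact mdifferentiableAt_atlas (chart_mem_atlas 𝔼 c) hx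

theorem inner_tangentSpace_congr {x y : Z} (h : x = y) (v w : 𝔼) :
    (inner ℝ (show TangentSpace (𝓡 n) x from v) (show TangentSpace (𝓡 n) x from w) : ℝ) =
      inner ℝ (show TangentSpace (𝓡 n) y from v) (show TangentSpace (𝓡 n) y from w) := by
  subst h; rfl

variable (n) in
/-- The coordinate expression of `τ` in the preferred charts at `c` and `c'`. -/
def chartExpr (c : Z) (c' : Z') (τ : Z → Z') : 𝔼 → 𝔼 :=
  chartAt 𝔼 c' ∘ τ ∘ (chartAt 𝔼 c).symm

theorem differentiableAt_chartExpr {c : Z} {c' : Z'} {τ : Z → Z'} {u : 𝔼}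
    (hu : u ∈ (chartAt 𝔼 c).target)
    (hτ : MDifferentiableAt (𝓡 n) (𝓡 n) τ ((chartAt 𝔼 c).symm u))
    (hτu : τ ((chartAt 𝔼 c).symm u) ∈ (chartAt 𝔼 c').source) :
    DifferentiableAt ℝ (chartExpr n c c' τ) u := by
  rw [← mdifferentiableAt_iff_differentiableAt]
  exact (mdifferentiableAt_chart c' hτu).comp u
    (hτ.comp u (mdifferentiableAt_chart_symm c hu))

theorem mfderiv_coordVector {c : Z} {c' : Z'} {τ : Z → Z'} {u : 𝔼}
    (hu : u ∈ (chartAt 𝔼 c).target)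
    (hτ : MDifferentiableAt (𝓡 n) (𝓡 n) τ ((chartAt 𝔼 c).symm u))
    (hτu : τ ((chartAt 𝔼 c).symm u) ∈ (chartAt 𝔼 c').source) (i : Fin n) :
    (mfderiv (𝓡 n) (𝓡 n) τ ((chartAt 𝔼 c).symm u) (coordVector n c u i) : 𝔼) =
      ∑ k, (fderiv ℝ (chartExpr n c c' τ) u (EuclideanSpace.single i (1 : ℝ))) k •
        (coordVector n c' (chartExpr n c c' τ u) k : 𝔼) := by
  set ψ := chartExpr n c c' τ with hψ
  have hψu : ψ u ∈ (chartAt 𝔼 c').target := (chartAt 𝔼 c').map_source hτu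
  have hs := mdifferentiableAt_chart_symm c hu
  have h1 : mfderiv (𝓡 n) (𝓡 n) (τ ∘ (chartAt 𝔼 c).symm) u =
      (mfderiv (𝓡 n) (𝓡 n) τ ((chartAt 𝔼 c).symm u)).comp
        (mfderiv (𝓡 n) (𝓡 n) (chartAt 𝔼 c).symm u) := mfderiv_comp u hτ hs
  have h2 : mfderiv (𝓡 n) (𝓡 n) ((chartAt 𝔼 c').symm ∘ ψ) u =
      (mfderiv (𝓡 n) (𝓡 n) (chartAt 𝔼 c').symm (ψ u)).comp (mfderiv (𝓡 n) (𝓡 n) ψ u) :=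
    mfderiv_comp u (mdifferentiableAt_chart_symm c' hψu)
      (differentiableAt_chartExpr hu hτ hτu).mdifferentiableAt
  have h3 : (chartAt 𝔼 c').symm ∘ ψ =ᶠ[nhds u] τ ∘ (chartAt 𝔼 c).symm := by
    have hc : ContinuousAt (τ ∘ (chartAt 𝔼 c).symm) u :=
      hτ.continuousAt.comp hs.continuousAt
    filter_upwards [hc.preimage_mem_nhds ((chartAt 𝔼 c').open_source.mem_nhds hτu)] with z hz
    exact (chartAt 𝔼 c').left_inv hz
  have h4 : (mfderiv (𝓡 n) (𝓡 n) ((chartAt 𝔼 c').symm ∘ ψ) u : 𝔼 →L[ℝ] 𝔼) =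
      mfderiv (𝓡 n) (𝓡 n) (τ ∘ (chartAt 𝔼 c).symm) u := h3.mfderiv_eq
  set e : 𝔼 := EuclideanSpace.single i (1 : ℝ) with he
  have h5 : (mfderiv (𝓡 n) (𝓡 n) τ ((chartAt 𝔼 c).symm u) (coordVector n c u i) : 𝔼) =
      (mfderiv (𝓡 n) (𝓡 n) (chartAt 𝔼 c').symm (ψ u) : 𝔼 →L[ℝ] 𝔼) (fderiv ℝ ψ u e) := by
    have e1 := congrArg (fun f : 𝔼 →L[ℝ] 𝔼 => f e) h1
    have e2 := congrArg (fun f : 𝔼 →L[ℝ] 𝔼 => f e) h2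
    have e4 := congrArg (fun f : 𝔼 →L[ℝ] 𝔼 => f e) h4
    rw [← mfderiv_eq_fderiv]
    exact e1.symm.trans (e4.symm.trans e2)
  have h6 : ∀ (D : 𝔼 →L[ℝ] 𝔼) (v : 𝔼),
      D v = ∑ k, v k • D (EuclideanSpace.single k (1 : ℝ)) := fun D v => by
    have h7 : ∑ k, v k • (EuclideanSpace.single k (1 : ℝ) : 𝔼) = v := by
      simpa using (EuclideanSpace.basisFun (Fin n) ℝ).sum_repr v
    conv_lhs => rw [← h7, map_sum]
    simp only [map_smul]
  exact h5.trans (h6 _ _)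

/-- Transformation rule of the Gram determinant under a map whose derivative is isometric. -/
theorem gramDet_eq_of_isometric {c : Z} {c' : Z'} {τ : Z → Z'} {u : 𝔼}
    (hu : u ∈ (chartAt 𝔼 c).target)
    (hτ : MDifferentiableAt (𝓡 n) (𝓡 n) τ ((chartAt 𝔼 c).symm u))
    (hτu : τ ((chartAt 𝔼 c).symm u) ∈ (chartAt 𝔼 c').source)
    (hiso : ∀ v : TangentSpace (𝓡 n) ((chartAt 𝔼 c).symm u),
      ‖mfderiv (𝓡 n) (𝓡 n) τ ((chartAt 𝔼 c).symm u) v‖ = ‖v‖) :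
    gramDet n c u = (fderiv ℝ (chartExpr n c c' τ) u).det ^ 2 *
      gramDet n c' (chartExpr n c c' τ u) := by
  set ψ := chartExpr n c c' τ with hψ
  have hx : (chartAt 𝔼 c').symm (ψ u) = τ ((chartAt 𝔼 c).symm u) :=
    (chartAt 𝔼 c').left_inv hτu
  let T : TangentSpace (𝓡 n) ((chartAt 𝔼 c).symm u) →ₗᵢ[ℝ]
      TangentSpace (𝓡 n) (τ ((chartAt 𝔼 c).symm u)) :=
    ⟨(mfderiv (𝓡 n) (𝓡 n) τ ((chartAt 𝔼 c).symm u)).toLinearMap, hiso⟩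
  set M : Matrix (Fin n) (Fin n) ℝ :=
    Matrix.of fun k i => (fderiv ℝ ψ u (EuclideanSpace.single i (1 : ℝ))) k with hM
  have hdet : (fderiv ℝ ψ u).det = M.det := by
    rw [ContinuousLinearMap.det,
      ← LinearMap.det_toMatrix (EuclideanSpace.basisFun (Fin n) ℝ).toBasis]
    congr 1
  set G' : Matrix (Fin n) (Fin n) ℝ := Matrix.of fun i j : Fin n =>
    inner ℝ (coordVector n c' (ψ u) i) (coordVector n c' (ψ u) j) with hG'
  have hmat : (Matrix.of fun i j : Fin n => inner ℝ (coordVector n c u i) (coordVector n c u j)) =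
      M.transpose * G' * M := by
    ext i j
    have h1 : inner ℝ (coordVector n c u i) (coordVector n c u j) =
        inner ℝ (T (coordVector n c u i)) (T (coordVector n c u j)) := (T.inner_map_map _ _).symm
    have h2 : ∀ i, (T (coordVector n c u i) : 𝔼) =
        ∑ k, M k i • (coordVector n c' (ψ u) k : 𝔼) := fun i => mfderiv_coordVector hu hτ hτu i
    have h3 : (inner ℝ (T (coordVector n c u i)) (T (coordVector n c u j)) : ℝ) =
        inner ℝ (∑ k, M k i • coordVector n c' (ψ u) k) (∑ k, M k j • coordVector n c' (ψ u) k) := by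
      have := inner_tangentSpace_congr hx (T (coordVector n c u i) : 𝔼) (T (coordVector n c u j) : 𝔼)
      refine this.symm.trans ?_
      rw [h2 i, h2 j]
    rw [Matrix.of_apply, h1, h3, Matrix.mul_apply, inner_sum]
    refine Finset.sum_congr rfl fun l _ => ?_
    rw [sum_inner, Matrix.mul_apply, Finset.sum_mul]
    refine Finset.sum_congr rfl fun k _ => ?_
    rw [inner_smul_left, inner_smul_right, Matrix.transpose_apply, hG', Matrix.of_apply]
    simp only [conj_trivial]
    ring
  rw [gramDet, hmat, Matrix.det_mul, Matrix.det_mul, Matrix.det_transpose, hdet, gramDet]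
  ring

theorem gramDet_pos (c : Z) {u : 𝔼} (hu : u ∈ (chartAt 𝔼 c).target) : 0 < gramDet n c u := by
  have : IsManifold (𝓡 n) 1 Z := IsManifold.of_le (n := ∞) (by simp)
  have hinj : Function.Injective (mfderiv (𝓡 n) (𝓡 n) (chartAt 𝔼 c).symm u) :=
    (mdifferentiable_of_mem_atlas (I := 𝓡 n) (chart_mem_atlas 𝔼 c)).symm.mfderiv_injective hu
  have hli : LinearIndependent ℝ (coordVector n c u) := by
    have h0 : LinearIndependent ℝ (fun i : Fin n => (EuclideanSpace.single i (1 : ℝ) : 𝔼)) := by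
      have hb : (fun i : Fin n => (EuclideanSpace.single i (1 : ℝ) : 𝔼)) =
          (EuclideanSpace.basisFun (Fin n) ℝ).toBasis := by
        ext i
        simp
      rw [hb]
      exact (EuclideanSpace.basisFun (Fin n) ℝ).toBasis.linearIndependent
    exact h0.map' (mfderiv (𝓡 n) (𝓡 n) (chartAt 𝔼 c).symm u).toLinearMap
      (LinearMap.ker_eq_bot.2 hinj)
  exact (Matrix.posDef_gram_of_linearIndependent hli).det_pos

theorem continuousOn_gramDet
    [IsContMDiffRiemannianBundle (𝓡 n) ∞ 𝔼 (fun x : Z => TangentSpace (𝓡 n) x)] (c : Z) :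
    ContinuousOn (gramDet n c) (chartAt 𝔼 c).target := by
  have hm : IsManifold (𝓡 n) 1 Z := IsManifold.of_le (n := ∞) (by simp)
  have : IsContinuousRiemannianBundle 𝔼 (fun x : Z => TangentSpace (𝓡 n) x) := by
    obtain ⟨g, hg, h⟩ := IsContMDiffRiemannianBundle.exists_contMDiff
      (IB := 𝓡 n) (n := ∞) (F := 𝔼) (E := fun x : Z => TangentSpace (𝓡 n) x)
    exact ⟨g, hg.continuous, h⟩
  set e := trivializationAt 𝔼 (fun x : Z => TangentSpace (𝓡 n) x) c with he
  have hc : ∀ i, ContinuousOn (fun u => (⟨(chartAt 𝔼 c).symm u, coordVector n c u i⟩ :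
      TotalSpace 𝔼 (fun x : Z => TangentSpace (𝓡 n) x))) (chartAt 𝔼 c).target := by
    intro i
    have h1 : ContinuousOn (fun x => (⟨x, e.symm x (EuclideanSpace.single i (1 : ℝ))⟩ :
        TotalSpace 𝔼 (fun x : Z => TangentSpace (𝓡 n) x))) e.baseSet := by
      refine (e.continuousOn_symm_prodMk_left (v := EuclideanSpace.single i (1 : ℝ))).congr
        fun x hx => ?_
      exact e.mk_symm hx _
    refine (h1.comp (chartAt 𝔼 c).continuousOn_symm ?_).congr fun u hu => ?_
    · exact fun u hu => (chartAt 𝔼 c).map_target hu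
    · have h2 := TangentBundle.symmL_trivializationAt (I := 𝓡 n) (𝕜 := ℝ)
        ((chartAt 𝔼 c).map_target hu)
      have h3 := congrArg (fun f : 𝔼 →L[ℝ] 𝔼 => f (EuclideanSpace.single i (1 : ℝ))) h2
      have h4 : (chartAt 𝔼 c) ((chartAt 𝔼 c).symm u) = u := (chartAt 𝔼 c).right_inv hu
      have h5 : ∀ w, w = u →
          (mfderiv (𝓡 n) (𝓡 n) (chartAt 𝔼 c).symm w : 𝔼 →L[ℝ] 𝔼) (EuclideanSpace.single i 1) =
            coordVector n c u i := by
        rintro _ rfl; rfl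
      simp only [mfld_simps, mfderivWithin_univ] at h3
      simp only [Function.comp_apply]
      congr 1
      exact (h5 _ h4).symm.trans (h3.symm.trans (e.symmL_apply ((chartAt 𝔼 c).map_target hu) _))
  refine Continuous.comp_continuousOn (g := fun M : Matrix (Fin n) (Fin n) ℝ => M.det)
    continuous_id.matrix_det ?_
  refine continuousOn_pi.2 fun i => continuousOn_pi.2 fun j => ?_
  exact (hc i).inner_bundle (hc j)

end Volume

section VolumeMeasure

variable {n : ℕ} {Z : Type*} [TopologicalSpace Z] [ChartedSpace (EuclideanSpace ℝ (Fin n)) Z]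
  [IsManifold (𝓡 n) ∞ Z] [RiemannianBundle (fun x : Z => TangentSpace (𝓡 n) x)]
  [MeasurableSpace Z] [BorelSpace Z]
  {Z' : Type*} [TopologicalSpace Z'] [ChartedSpace (EuclideanSpace ℝ (Fin n)) Z']
  [IsManifold (𝓡 n) ∞ Z'] [RiemannianBundle (fun x : Z' => TangentSpace (𝓡 n) x)]
  [MeasurableSpace Z'] [BorelSpace Z']

local notation "𝔼" => EuclideanSpace ℝ (Fin n)

theorem measurableSet_target_inter_preimage {X Y : Type*} [TopologicalSpace X] [MeasurableSpace X]
    [OpensMeasurableSpace X] [TopologicalSpace Y] [MeasurableSpace Y] [BorelSpace Y]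
    (e : OpenPartialHomeomorph X Y) {A : Set Y} (hA : MeasurableSet A) :
    MeasurableSet (e.source ∩ e ⁻¹' A) := by
  have h := (continuousOn_iff_continuous_domRestrict.1 e.continuousOn).measurable hA
  have := e.open_source.measurableSet.subtype_image h
  convert this using 1
  ext x
  simp [and_comm]

theorem chartVolume_apply (c : Z) {A : Set Z} (hA : MeasurableSet A) :
    chartVolume n c A = ∫⁻ u in (chartAt 𝔼 c).target ∩ (chartAt 𝔼 c).symm ⁻¹' A,
      ENNReal.ofReal (Real.sqrt (gramDet n c u)) := by
  have hB : MeasurableSet ((chartAt 𝔼 c).target ∩ (chartAt 𝔼 c).symm ⁻¹' A) :=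
    measurableSet_target_inter_preimage (chartAt 𝔼 c).symm hA
  have ht : MeasurableSet (chartAt 𝔼 c).target := (chartAt 𝔼 c).open_target.measurableSet
  have hm : AEMeasurable (chartAt 𝔼 c).symm
      ((volume.restrict (chartAt 𝔼 c).target).withDensity
        (fun u => ENNReal.ofReal (Real.sqrt (gramDet n c u)))) :=
    ((chartAt 𝔼 c).continuousOn_symm.aemeasurable ht).mono_ac
      (withDensity_absolutelyContinuous _ _)
  rw [chartVolume, Measure.map_apply_of_aemeasurable hm hA]
  have h0 : ((volume.restrict (chartAt 𝔼 c).target).withDensity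
        (fun u => ENNReal.ofReal (Real.sqrt (gramDet n c u)))) (chartAt 𝔼 c).targetᶜ = 0 := by
    refine withDensity_absolutelyContinuous _ _ ?_
    rw [Measure.restrict_apply ht.compl, Set.compl_inter_self, measure_empty]
  rw [← measure_inter_add_sdiff₀ _ ht.nullMeasurableSet,
    measure_mono_null (Set.sdiff_subset_compl _ _) h0, add_zero, Set.inter_comm,
    withDensity_apply _ hB, Measure.restrict_restrict hB, Set.inter_right_comm, Set.inter_self]

theorem chartVolume_inter_source (c : Z) {A : Set Z} (hA : MeasurableSet A) :
    chartVolume n c (A ∩ (chartAt 𝔼 c).source) = chartVolume n c A := by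
  rw [chartVolume_apply c hA,
    chartVolume_apply c (hA.inter (chartAt 𝔼 c).open_source.measurableSet)]
  congr 2
  ext u
  simp only [Set.mem_inter_iff, Set.mem_preimage, and_congr_right_iff, and_iff_left_iff_imp]
  exact fun hu _ => (chartAt 𝔼 c).map_target hu

/-- A local isometry of Riemannian manifolds: a diffeomorphism between open subsets whose derivative
is isometric. -/
structure IsLocalIsometry (τ : OpenPartialHomeomorph Z Z') : Prop where
  mdifferentiableAt : ∀ x ∈ τ.source, MDifferentiableAt (𝓡 n) (𝓡 n) τ x
  norm_mfderiv : ∀ x ∈ τ.source, ∀ v : TangentSpace (𝓡 n) x,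
    ‖mfderiv (𝓡 n) (𝓡 n) τ x v‖ = ‖v‖

/-- The change of variables formula: the measures `√det (g_ij) du` correspond to each other under
a local isometry. -/
theorem chartVolume_image {τ : OpenPartialHomeomorph Z Z'} (hτ : IsLocalIsometry (n := n) τ)
    (c : Z) (c' : Z') {A : Set Z} (hA : MeasurableSet A) (hAτ : A ⊆ τ.source)
    (hAc : A ⊆ (chartAt 𝔼 c).source) (hAc' : Set.MapsTo τ A (chartAt 𝔼 c').source) :
    chartVolume n c' (τ.target ∩ τ.symm ⁻¹' A) = chartVolume n c A := by
  have hA' : MeasurableSet (τ.target ∩ τ.symm ⁻¹' A) :=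
    measurableSet_target_inter_preimage τ.symm hA
  have hB : MeasurableSet ((chartAt 𝔼 c).target ∩ (chartAt 𝔼 c).symm ⁻¹' A) :=
    measurableSet_target_inter_preimage (chartAt 𝔼 c).symm hA
  rw [chartVolume_apply c hA, chartVolume_apply c' hA']
  have himg : (chartAt 𝔼 c').target ∩ (chartAt 𝔼 c').symm ⁻¹' (τ.target ∩ τ.symm ⁻¹' A) =
      chartExpr n c c' τ '' ((chartAt 𝔼 c).target ∩ (chartAt 𝔼 c).symm ⁻¹' A) := by
    ext w
    constructor
    · rintro ⟨hw, hw1, hw2⟩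
      refine ⟨chartAt 𝔼 c (τ.symm ((chartAt 𝔼 c').symm w)),
        ⟨(chartAt 𝔼 c).map_source (hAc hw2), ?_⟩, ?_⟩
      · rw [Set.mem_preimage, (chartAt 𝔼 c).left_inv (hAc hw2)]
        exact hw2
      · simp only [chartExpr, Function.comp_apply]
        rw [(chartAt 𝔼 c).left_inv (hAc hw2), τ.right_inv hw1, (chartAt 𝔼 c').right_inv hw]
    · rintro ⟨u, ⟨hu, huA⟩, rfl⟩
      have h1 := hAc' huA
      simp only [chartExpr, Function.comp_apply, Set.mem_inter_iff, Set.mem_preimage]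
      refine ⟨(chartAt 𝔼 c').map_source h1, ?_⟩
      rw [(chartAt 𝔼 c').left_inv h1, τ.left_inv (hAτ huA)]
      exact ⟨τ.map_source (hAτ huA), huA⟩
  have hinj : Set.InjOn (chartExpr n c c' τ)
      ((chartAt 𝔼 c).target ∩ (chartAt 𝔼 c).symm ⁻¹' A) := by
    rintro u ⟨hu, huA⟩ v ⟨hv, hvA⟩ h
    have h1 := (chartAt 𝔼 c').injOn (hAc' huA) (hAc' hvA) h
    have h2 := τ.injOn (hAτ huA) (hAτ hvA) h1
    exact (chartAt 𝔼 c).symm.injOn hu hv h2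
  rw [himg, lintegral_image_eq_lintegral_abs_det_fderiv_mul volume hB
    (f' := fun u => fderiv ℝ (chartExpr n c c' τ) u) ?_ hinj]
  · refine setLIntegral_congr_fun hB ?_
    rintro u ⟨hu, huA⟩
    simp only
    rw [gramDet_eq_of_isometric hu (hτ.mdifferentiableAt _ (hAτ huA)) (hAc' huA)
      (hτ.norm_mfderiv _ (hAτ huA)), Real.sqrt_mul (sq_nonneg _), Real.sqrt_sq_eq_abs,
      ENNReal.ofReal_mul (abs_nonneg _)]
  · rintro u ⟨hu, huA⟩
    exact (differentiableAt_chartExpr hu (hτ.mdifferentiableAt _ (hAτ huA))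
      (hAc' huA)).hasFDerivAt.hasFDerivWithinAt

theorem isLocalIsometry_refl : IsLocalIsometry (n := n) (OpenPartialHomeomorph.refl Z) where
  mdifferentiableAt _ _ := mdifferentiableAt_id
  norm_mfderiv x _ v := by
    have : mfderiv (𝓡 n) (𝓡 n) (OpenPartialHomeomorph.refl Z) x =
      ContinuousLinearMap.id ℝ _ := mfderiv_id
    rw [this]
    rfl

/-- The measures of two charts agree on their overlap, as the identity is a local isometry. -/
theorem chartVolume_congr (c c' : Z) {A : Set Z} (hA : MeasurableSet A)
    (hAc : A ⊆ (chartAt 𝔼 c).source) (hAc' : A ⊆ (chartAt 𝔼 c').source) :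
    chartVolume n c' A = chartVolume n c A := by
  have := chartVolume_image isLocalIsometry_refl c c' hA (Set.subset_univ _) hAc hAc'
  simpa using this

/-- The measures of the charts agree on overlaps, so their supremum restricts to each of them. -/
theorem riemannianVolume_apply (c : Z) {A : Set Z} (hA : MeasurableSet A)
    (hAc : A ⊆ (chartAt 𝔼 c).source) : riemannianVolume n Z A = chartVolume n c A := by
  have hs : MeasurableSet (chartAt 𝔼 c).source := (chartAt 𝔼 c).open_source.measurableSet
  apply le_antisymm
  · -- a measure that dominates all the `chartVolume n c'` and agrees with `chartVolume n c` on `A`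
    have hle : riemannianVolume n Z ≤
        chartVolume n c + (⊤ : Measure Z).restrict (chartAt 𝔼 c).sourceᶜ := by
      refine iSup_le fun c' => Measure.le_iff.2 fun B hB => ?_
      rw [Measure.add_apply, Measure.restrict_apply hB,
        ← measure_inter_add_sdiff B hs, Set.sdiff_eq]
      refine add_le_add ?_ ?_
      · have hs' : MeasurableSet (chartAt 𝔼 c').source := (chartAt 𝔼 c').open_source.measurableSet
        rw [← chartVolume_inter_source c' (hB.inter hs), chartVolume_congr c c'
          ((hB.inter hs).inter hs') (Set.inter_subset_left.trans Set.inter_subset_right)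
          Set.inter_subset_right]
        exact measure_mono (Set.inter_subset_left.trans Set.inter_subset_left)
      · exact Measure.le_iff.1 le_top _ (hB.inter hs.compl)
    refine (hle A).trans_eq ?_
    rw [Measure.add_apply, Measure.restrict_apply hA, ← Set.sdiff_eq,
      Set.sdiff_eq_empty.2 hAc, measure_empty, add_zero]
  · exact (le_iSup (fun c : Z => chartVolume n c) c) A

/-- Local isometries preserve the Riemannian volume measure. The claim is local, so that it reduces
to countably many pairs of charts. -/
theorem map_riemannianVolume [SecondCountableTopology Z] {τ : OpenPartialHomeomorph Z Z'}
    (hτ : IsLocalIsometry (n := n) τ) :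
    ((riemannianVolume n Z').restrict τ.target).map τ.symm =
      (riemannianVolume n Z).restrict τ.source := by
  have hm : AEMeasurable τ.symm ((riemannianVolume n Z').restrict τ.target) :=
    τ.continuousOn_symm.aemeasurable τ.open_target.measurableSet
  let U : τ.source → Set Z := fun x =>
    (chartAt 𝔼 x.1).source ∩ (τ.source ∩ τ ⁻¹' (chartAt 𝔼 (τ x)).source)
  have hU : ∀ x, IsOpen (U x) := fun x =>
    (chartAt 𝔼 x.1).open_source.inter (τ.isOpen_inter_preimage (chartAt 𝔼 (τ x)).open_source)
  obtain ⟨s, hs, hsU⟩ := TopologicalSpace.isOpen_iUnion_countable U hU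
  have hcov : ⋃ x ∈ s, U x = τ.source := by
    rw [hsU]
    apply Set.Subset.antisymm
    · exact Set.iUnion_subset fun x => Set.inter_subset_right.trans Set.inter_subset_left
    · exact fun x hx => Set.mem_iUnion.2 ⟨⟨x, hx⟩, mem_chart_source _ _, hx, mem_chart_source _ _⟩
  have hrestr : (((riemannianVolume n Z').restrict τ.target).map τ.symm).restrict τ.source =
      (riemannianVolume n Z).restrict τ.source := by
    rw [← hcov, Measure.restrict_biUnion_congr hs]
    intro x _
    ext B hB
    rw [Measure.restrict_apply hB, Measure.restrict_apply hB]
    set A := B ∩ U x with hA_def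
    have hA : MeasurableSet A := hB.inter (hU x).measurableSet
    have hAc : A ⊆ (chartAt 𝔼 x.1).source := Set.inter_subset_right.trans Set.inter_subset_left
    have hAτ : A ⊆ τ.source := fun y hy => hy.2.2.1
    have hAc' : Set.MapsTo τ A (chartAt 𝔼 (τ x)).source := fun y hy => hy.2.2.2
    have hA' : MeasurableSet (τ.target ∩ τ.symm ⁻¹' A) :=
      measurableSet_target_inter_preimage τ.symm hA
    rw [Measure.map_apply_of_aemeasurable hm hA,
      Measure.restrict_apply₀' τ.open_target.measurableSet.nullMeasurableSet, Set.inter_comm,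
      riemannianVolume_apply x.1 hA hAc, riemannianVolume_apply (τ x) hA' ?_,
      chartVolume_image hτ x.1 (τ x) hA hAτ hAc hAc']
    rintro y ⟨hy, hyA⟩
    have := hAc' hyA
    rwa [τ.right_inv hy] at this
  rw [← hrestr]
  refine (Measure.restrict_eq_self_of_ae_mem ?_).symm
  refine (ae_map_iff hm τ.open_source.measurableSet).2 ?_
  exact ae_restrict_of_forall_mem τ.open_target.measurableSet fun y hy => τ.map_target hy

theorem riemannianVolume_pos
    [IsContMDiffRiemannianBundle (𝓡 n) ∞ 𝔼 (fun x : Z => TangentSpace (𝓡 n) x)] {U : Set Z}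
    (hU : IsOpen U) (hne : U.Nonempty) : 0 < riemannianVolume n Z U := by
  obtain ⟨c, hc⟩ := hne
  set A := U ∩ (chartAt 𝔼 c).source with hA_def
  have hAo : IsOpen A := hU.inter (chartAt 𝔼 c).open_source
  refine lt_of_lt_of_le ?_ (measure_mono (Set.inter_subset_left : A ⊆ U))
  rw [riemannianVolume_apply c hAo.measurableSet Set.inter_subset_right,
    chartVolume_apply c hAo.measurableSet]
  set B := (chartAt 𝔼 c).target ∩ (chartAt 𝔼 c).symm ⁻¹' A with hB
  have hBo : IsOpen B := (chartAt 𝔼 c).symm.isOpen_inter_preimage hAo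
  have hBne : B.Nonempty := ⟨chartAt 𝔼 c c, mem_chart_target _ _, by
    rw [Set.mem_preimage, (chartAt 𝔼 c).left_inv (mem_chart_source _ _)]
    exact ⟨hc, mem_chart_source _ _⟩⟩
  have hcont : ContinuousOn (fun u => ENNReal.ofReal (Real.sqrt (gramDet n c u))) B :=
    ENNReal.continuous_ofReal.comp_continuousOn (Real.continuous_sqrt.comp_continuousOn
      ((continuousOn_gramDet c).mono Set.inter_subset_left))
  rw [pos_iff_ne_zero]
  intro h0
  rw [lintegral_eq_zero_iff' (hcont.aemeasurable hBo.measurableSet)] at h0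
  have h1 : ∀ᵐ u ∂(volume.restrict B), False := by
    filter_upwards [h0, ae_restrict_mem hBo.measurableSet] with u hu huB
    rw [Pi.zero_apply, ENNReal.ofReal_eq_zero] at hu
    exact absurd (Real.sqrt_pos.2 (gramDet_pos c huB.1)) (not_lt.2 hu)
  have h2 : volume B = 0 := by
    rw [ae_iff] at h1
    simpa using h1
  exact (hBo.measure_pos volume hBne).ne' h2

end VolumeMeasure

/-! ### Test sections and differential operators -/

section TestSections

variable {n : ℕ} {Z : Type*} [TopologicalSpace Z] [ChartedSpace (EuclideanSpace ℝ (Fin n)) Z]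
  {F : Type*} [NormedAddCommGroup F] [NormedSpace ℂ F]
  {S : Z → Type*} [TopologicalSpace (TotalSpace F S)]
  [∀ x, NormedAddCommGroup (S x)] [∀ x, InnerProductSpace ℂ (S x)]
  [FiberBundle F S] [VectorBundle ℂ F S] [VectorBundle ℝ F S]

/-- The product of a smooth real function and a test section. -/
def smulTest (f : Z → ℝ) (hf : ContMDiff (𝓡 n) 𝓘(ℝ, ℝ) ∞ f) (Φ : TestSections n F S) :
    TestSections n F S :=
  ⟨fun x => (f x : ℂ) • Φ.1 x, by
    obtain ⟨hΦ, K, hK, hΦK⟩ := Φ.2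
    refine ⟨?_, K, hK, fun x hx => by simp [hΦK x hx]⟩
    have h : (fun x => (f x : ℂ) • Φ.1 x) = f • Φ.1 := by
      funext x
      exact RCLike.real_smul_eq_coe_smul (K := ℂ) (f x) (Φ.1 x) |>.symm
    rw [h]
    exact hf.smul_section hΦ⟩

@[simp]
theorem smulTest_apply (f : Z → ℝ) (hf : ContMDiff (𝓡 n) 𝓘(ℝ, ℝ) ∞ f) (Φ : TestSections n F S)
    (x : Z) : (smulTest f hf Φ).1 x = (f x : ℂ) • Φ.1 x := rfl

/-- Smooth sections over an open set with compact support in that set extend by zero. -/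
theorem mem_testSections_of_smoothOn [T2Space Z] {s : ∀ x, S x} {U K : Set Z} (hU : IsOpen U)
    (hs : SmoothOn n F s U) (hK : IsCompact K) (hKU : K ⊆ U) (hsK : ∀ x ∉ K, s x = 0) :
    s ∈ TestSections n F S := by
  refine ⟨fun x => ?_, K, hK, hsK⟩
  by_cases hx : x ∈ U
  · exact (hs x hx).contMDiffAt (hU.mem_nhds hx)
  · refine (contMDiff_zeroSection ℝ S x).congr_of_eventuallyEq ?_
    filter_upwards [hK.isClosed.isOpen_compl.mem_nhds fun h => hx (hKU h)] with y hy
    rw [hsK y hy]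
    rfl

theorem SupportedIn.univ (Φ : TestSections n F S) : SupportedIn Φ Set.univ := by
  obtain ⟨-, K, hK, h⟩ := Φ.2
  exact ⟨K, hK, Set.subset_univ _, h⟩

theorem SupportedIn.smulTest {f : Z → ℝ} (hf : ContMDiff (𝓡 n) 𝓘(ℝ, ℝ) ∞ f) {U : Set Z}
    (hfU : tsupport f ⊆ U) (Φ : TestSections n F S) : SupportedIn (smulTest f hf Φ) U := by
  obtain ⟨-, K, hK, h⟩ := Φ.2
  refine ⟨K ∩ tsupport f, hK.inter_right (isClosed_tsupport f),
    Set.inter_subset_right.trans hfU, fun x hx => ?_⟩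
  rw [smulTest_apply]
  by_cases hxK : x ∈ K
  · have : f x = 0 := image_eq_zero_of_notMem_tsupport fun h => hx ⟨hxK, h⟩
    rw [this, Complex.ofReal_zero, zero_smul]
  · rw [h x hxK, smul_zero]

variable {σ : SymbolField n S} {L : TestSections n F S →ₗ[ℂ] TestSections n F S}

theorem HasSymbol.apply_smulTest (hL : HasSymbol L σ) {f : Z → ℝ}
    (hf : ContMDiff (𝓡 n) 𝓘(ℝ, ℝ) ∞ f) (Φ : TestSections n F S) (x : Z) :
    (L (smulTest f hf Φ)).1 x = (f x : ℂ) • (L Φ).1 x + σ x (mvfderiv (𝓡 n) f x) (Φ.1 x) :=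
  hL f hf Φ _ (fun _ => rfl) x

/-- Operators of first order are local. -/
theorem HasSymbol.apply_eq_zero [T2Space Z] [IsManifold (𝓡 n) ∞ Z] (hL : HasSymbol L σ)
    {Φ : TestSections n F S} {x : Z} (hx : ∀ᶠ y in nhds x, Φ.1 y = 0) : (L Φ).1 x = 0 := by
  obtain ⟨f, hf⟩ : ∃ f : SmoothBumpFunction (𝓡 n) x, Function.support f ⊆ {y | Φ.1 y = 0} := by
    obtain ⟨f, -, hf⟩ := (SmoothBumpFunction.nhds_basis_support (I := 𝓡 n) hx).mem_iff.1 hx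
    exact ⟨f, hf⟩
  have h := hL.apply_smulTest f.contMDiff Φ x
  have h0 : smulTest f f.contMDiff Φ = 0 := by
    ext y
    rw [smulTest_apply]
    by_cases hy : f y = 0
    · rw [hy, Complex.ofReal_zero, zero_smul]; rfl
    · rw [show Φ.1 y = 0 from hf hy, smul_zero]; rfl
  rw [h0, map_zero, f.eq_one, hx.self_of_nhds, map_zero, add_zero, Complex.ofReal_one,
    one_smul] at h
  exact h.symm

theorem HasSymbol.apply_eq_zero_of_notMem [T2Space Z] [IsManifold (𝓡 n) ∞ Z] (hL : HasSymbol L σ)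
    {Φ : TestSections n F S} {K : Set Z} (hK : IsCompact K) (hΦ : ∀ x ∉ K, Φ.1 x = 0) {x : Z}
    (hx : x ∉ K) : (L Φ).1 x = 0 :=
  hL.apply_eq_zero (by filter_upwards [hK.isClosed.isOpen_compl.mem_nhds hx] with y hy
                       exact hΦ y hy)

theorem withPotential_apply (h : ∀ x, Module.End ℂ (S x)) (m : ℝ) (Φ : TestSections n F S) (x : Z) :
    withPotential L h m Φ x = (L Φ).1 x + (m : ℂ) • h x (Φ.1 x) := rfl

theorem withPotential_apply_eq_zero_of_notMem [T2Space Z] [IsManifold (𝓡 n) ∞ Z]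
    (hL : HasSymbol L σ) (h : ∀ x, Module.End ℂ (S x)) (m : ℝ)
    {Φ : TestSections n F S} {K : Set Z} (hK : IsCompact K) (hΦ : ∀ x ∉ K, Φ.1 x = 0) {x : Z}
    (hx : x ∉ K) : withPotential L h m Φ x = 0 := by
  rw [withPotential_apply, hL.apply_eq_zero_of_notMem hK hΦ hx, hΦ x hx, map_zero, smul_zero,
    add_zero]

/-- The section `ΓΦ` for a smooth field `Γ` of endomorphisms. -/
def endTest {Γ : ∀ x, Module.End ℂ (S x)} (hΓ : SmoothEndOn n F Γ Set.univ)
    (Φ : TestSections n F S) : TestSections n F S :=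
  ⟨fun x => Γ x (Φ.1 x), contMDiffOn_univ.1 (hΓ Φ), by
    obtain ⟨-, K, hK, h⟩ := Φ.2
    exact ⟨K, hK, fun x hx => by simp [h x hx]⟩⟩

@[simp]
theorem endTest_apply {Γ : ∀ x, Module.End ℂ (S x)} (hΓ : SmoothEndOn n F Γ Set.univ)
    (Φ : TestSections n F S) (x : Z) : (endTest hΓ Φ).1 x = Γ x (Φ.1 x) := rfl

theorem mvfderiv_eq_zero_of_eventually_const {f : Z → ℝ} {x : Z} {a : ℝ}
    (hf : ∀ᶠ y in nhds x, f y = a) : mvfderiv (𝓡 n) f x = 0 := by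
  have h1 : f =ᶠ[nhds x] fun _ => a := hf
  have h2 : (mfderiv (𝓡 n) 𝓘(ℝ, ℝ) f x : EuclideanSpace ℝ (Fin n) →L[ℝ] ℝ) = 0 :=
    h1.mfderiv_eq.trans mfderiv_const
  ext v
  exact congrArg (fun D : EuclideanSpace ℝ (Fin n) →L[ℝ] ℝ => D v) h2

/-- The bound on `σ(dη)` on `U₀ ∩ U₁` holds everywhere, since `η` is locally constant elsewhere. -/
theorem norm_symbol_le {U₀ U₁ : Set Z} {η : Z → ℝ} (hη : IsPartition n U₀ U₁ η) {K : ℝ}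
    (hK : ∀ x ∈ U₀ ∩ U₁, ∀ v, ‖σ x (mvfderiv (𝓡 n) η x) v‖ ≤ K * ‖v‖) (x : Z) (v : S x) :
    ‖σ x (mvfderiv (𝓡 n) η x) v‖ ≤ max K 0 * ‖v‖ := by
  by_cases h0 : x ∈ U₀
  · by_cases h1 : x ∈ U₁
    · exact (hK x ⟨h0, h1⟩ v).trans (mul_le_mul_of_nonneg_right (le_max_left _ _) (norm_nonneg _))
    · have : mvfderiv (𝓡 n) η x = 0 := by
        apply mvfderiv_eq_zero_of_eventually_const (a := 1)
        filter_upwards [(isClosed_tsupport (fun x => 1 - η x)).isOpen_compl.mem_nhds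
          fun h => h1 (hη.tsupport₁ h)] with y hy
        have := image_eq_zero_of_notMem_tsupport hy
        linarith
      rw [this, map_zero, LinearMap.zero_apply, norm_zero]
      positivity
  · have : mvfderiv (𝓡 n) η x = 0 := by
      apply mvfderiv_eq_zero_of_eventually_const (a := 0)
      filter_upwards [(isClosed_tsupport η).isOpen_compl.mem_nhds
        fun h => h0 (hη.tsupport₀ h)] with y hy
      exact image_eq_zero_of_notMem_tsupport hy
    rw [this, map_zero, LinearMap.zero_apply, norm_zero]
    positivity

end TestSections

/-! ### Fibrewise linear algebra of the potential -/

section Fibre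

variable {E : Type*} [NormedAddCommGroup E] [InnerProductSpace ℂ E] [FiniteDimensional ℂ E]
  {h : Module.End ℂ E}

/-- A symmetric endomorphism with spectrum in `[-B, B]` has norm at most `B`. -/
theorem norm_apply_le_of_eigenvalues (hs : h.IsSymmetric) {B : ℝ}
    (hB : ∀ μ : ℝ, Module.End.HasEigenvalue h (μ : ℂ) → |μ| ≤ B) (v : E) :
    ‖h v‖ ≤ max B 0 * ‖v‖ := by
  set b := hs.eigenvectorBasis rfl with hb
  have h1 : ‖h v‖ ^ 2 ≤ (max B 0 * ‖v‖) ^ 2 := by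
    rw [← b.sum_sq_norm_inner_right, mul_pow, ← b.sum_sq_norm_inner_right v, Finset.mul_sum]
    refine Finset.sum_le_sum fun i _ => ?_
    have h2 : inner ℂ (b i) (h v) = (hs.eigenvalues rfl i : ℂ) * inner ℂ (b i) v := by
      rw [← hs (b i) v, hb, hs.apply_eigenvectorBasis, inner_smul_left]
      simp
    rw [h2, norm_mul, mul_pow]
    refine mul_le_mul_of_nonneg_right ?_ (sq_nonneg _)
    have h3 := hB _ (hs.hasEigenvalue_eigenvalues rfl i)
    rw [Complex.norm_real, Real.norm_eq_abs]
    exact pow_le_pow_left₀ (abs_nonneg _) (h3.trans (le_max_left _ _)) 2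
  exact le_of_sq_le_sq h1 (by positivity)

/-- If the eigenvalues of `h²` are at least `1`, then `h` does not decrease the norm. -/
theorem norm_le_norm_apply_of_sq_eigenvalues (hs : h.IsSymmetric)
    (h1 : ∀ μ : ℝ, Module.End.HasEigenvalue (h * h) (μ : ℂ) → 1 ≤ μ) (v : E) :
    ‖v‖ ≤ ‖h v‖ := by
  set b := hs.eigenvectorBasis rfl with hb
  have h2 : ‖v‖ ^ 2 ≤ ‖h v‖ ^ 2 := by
    rw [← b.sum_sq_norm_inner_right, ← b.sum_sq_norm_inner_right (h v)]
    refine Finset.sum_le_sum fun i _ => ?_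
    have h3 : inner ℂ (b i) (h v) = (hs.eigenvalues rfl i : ℂ) * inner ℂ (b i) v := by
      rw [← hs (b i) v, hb, hs.apply_eigenvectorBasis, inner_smul_left]
      simp
    have h4 : Module.End.HasEigenvalue (h * h) ((hs.eigenvalues rfl i ^ 2 : ℝ) : ℂ) := by
      refine Module.End.hasEigenvalue_of_hasEigenvector (x := b i) ⟨?_, b.toBasis.ne_zero i ∘ ?_⟩
      · rw [Module.End.mem_eigenspace_iff, Module.End.mul_apply, hb, hs.apply_eigenvectorBasis,
          map_smul, hs.apply_eigenvectorBasis, smul_smul, sq]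
        simp
      · intro h0; simpa using h0
    rw [h3, norm_mul, mul_pow, Complex.norm_real, Real.norm_eq_abs, sq_abs]
    exact le_mul_of_one_le_left (sq_nonneg _) (h1 _ h4)
  exact le_of_sq_le_sq h2 (norm_nonneg _)

end Fibre

/-! ### Transplantation of sections along a bundle isometry -/

section Transplantation

variable {n : ℕ} {Z : Type*} [TopologicalSpace Z] [ChartedSpace (EuclideanSpace ℝ (Fin n)) Z]
  [RiemannianBundle (fun x : Z => TangentSpace (𝓡 n) x)]
  {F : Type*} [NormedAddCommGroup F] [NormedSpace ℂ F]
  {S : Z → Type*} [TopologicalSpace (TotalSpace F S)]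
  [∀ x, NormedAddCommGroup (S x)] [∀ x, InnerProductSpace ℂ (S x)]
  [FiberBundle F S] [VectorBundle ℂ F S] [VectorBundle ℝ F S]
  {n' : ℕ} {Z' : Type*} [TopologicalSpace Z'] [ChartedSpace (EuclideanSpace ℝ (Fin n')) Z']
  [RiemannianBundle (fun x : Z' => TangentSpace (𝓡 n') x)]
  {F' : Type*} [NormedAddCommGroup F'] [NormedSpace ℂ F']
  {S' : Z' → Type*} [TopologicalSpace (TotalSpace F' S')]
  [∀ x, NormedAddCommGroup (S' x)] [∀ x, InnerProductSpace ℂ (S' x)]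
  [FiberBundle F' S'] [VectorBundle ℂ F' S'] [VectorBundle ℝ F' S']
  {U : Set Z} {U' : Set Z'}

/-- Compactly supported test sections over `U` and `U'` that correspond to each other under the
bundle isometry. -/
structure Corresponds (T : BundleIsometry n F S n' F' S' U U') (Φ : TestSections n F S)
    (Φ' : TestSections n' F' S') : Prop where
  supportedIn : SupportedIn Φ U
  supportedIn' : SupportedIn Φ' U'
  apply_eq : ∀ x ∈ U, Φ'.1 (T.τ x) = T.lift x (Φ.1 x)

namespace BundleIsometry

theorem isOpen (T : BundleIsometry n F S n' F' S' U U') : IsOpen U := by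
  rw [← T.source_eq]
  exact T.τ.open_source

theorem isOpen' (T : BundleIsometry n F S n' F' S' U U') : IsOpen U' := by
  rw [← T.target_eq]
  exact T.τ.open_target

variable (T : BundleIsometry n F S n' F' S' U U')

theorem map_mem {x : Z} (hx : x ∈ U) : T.τ x ∈ U' :=
  T.target_eq.subset (T.τ.map_source (T.source_eq.superset hx))

theorem symm_mem {y : Z'} (hy : y ∈ U') : T.τ.symm y ∈ U :=
  T.source_eq.subset (T.τ.map_target (T.target_eq.superset hy))

theorem left_inv {x : Z} (hx : x ∈ U) : T.τ.symm (T.τ x) = x :=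
  T.τ.left_inv (by rwa [T.source_eq])

theorem right_inv {y : Z'} (hy : y ∈ U') : T.τ (T.τ.symm y) = y :=
  T.τ.right_inv (by rwa [T.target_eq])

theorem injective_lift {x : Z} (hx : x ∈ U) : Function.Injective (T.lift x) := by
  rw [injective_iff_map_eq_zero]
  intro v hv
  rw [← norm_eq_zero, ← T.norm_lift x hx, hv, norm_zero]

theorem inner_lift {x : Z} (hx : x ∈ U) (v w : S x) :
    inner ℂ (T.lift x v) (T.lift x w) = inner ℂ v w :=
  (LinearIsometry.mk (T.lift x) (T.norm_lift x hx)).inner_map_map v w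

theorem isCompact_image {K : Set Z} (hK : IsCompact K) (hKU : K ⊆ U) : IsCompact (T.τ '' K) :=
  hK.image_of_continuousOn (T.contMDiffOn.continuousOn.mono hKU)

theorem isCompact_image_symm {K : Set Z'} (hK : IsCompact K) (hKU : K ⊆ U') :
    IsCompact (T.τ.symm '' K) :=
  hK.image_of_continuousOn (T.contMDiffOn_symm.continuousOn.mono hKU)

/-- The push-forward of a test section over `U`. -/
theorem exists_push [T2Space Z'] (Φ : TestSections n F S) (hΦ : SupportedIn Φ U) :
    ∃ Φ' : TestSections n' F' S', Corresponds T Φ Φ' := by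
  have hex : ∀ y : Z', ∃ v : S' y,
      (∀ x ∈ U, ∀ h : T.τ x = y, v = h ▸ T.lift x (Φ.1 x)) ∧ (y ∉ U' → v = 0) := by
    intro y
    by_cases hy : y ∈ U'
    · obtain ⟨x, hx, rfl⟩ : ∃ x ∈ U, T.τ x = y := ⟨_, T.symm_mem hy, T.right_inv hy⟩
      refine ⟨T.lift x (Φ.1 x), fun x' hx' h => ?_, fun h => absurd hy h⟩
      obtain rfl : x' = x := by rw [← T.left_inv hx', h, T.left_inv hx]
      rfl
    · refine ⟨0, fun x hx h => ?_, fun _ => rfl⟩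
      exact absurd (h ▸ T.map_mem hx) hy
  choose s hs hs0 using hex
  have hsτ : ∀ x ∈ U, s (T.τ x) = T.lift x (Φ.1 x) := fun x hx => hs _ x hx rfl
  obtain ⟨K, hK, hKU, hΦK⟩ := hΦ
  have hsK : ∀ y ∉ T.τ '' K, s y = 0 := by
    intro y hy
    by_cases hyU : y ∈ U'
    · obtain ⟨x, hx, rfl⟩ : ∃ x ∈ U, T.τ x = y := ⟨_, T.symm_mem hyU, T.right_inv hyU⟩
      rw [hsτ x hx, hΦK x fun h => hy ⟨x, h, rfl⟩, map_zero]
    · exact hs0 y hyU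
  have hKU' : T.τ '' K ⊆ U' := by
    rintro _ ⟨x, hx, rfl⟩
    exact T.map_mem (hKU hx)
  have hsmooth : SmoothOn n' F' s U' := by
    have h1 : ContMDiffOn (𝓡 n') ((𝓡 n).prod 𝓘(ℝ, F)) ∞
        (fun y => TotalSpace.mk' F (T.τ.symm y) (Φ.1 (T.τ.symm y))) U' :=
      Φ.2.1.comp_contMDiffOn T.contMDiffOn_symm
    refine (T.contMDiffOn_lift.comp h1 fun y hy => T.symm_mem hy).congr fun y hy => ?_
    obtain ⟨x, hx, rfl⟩ : ∃ x ∈ U, T.τ x = y := ⟨_, T.symm_mem hy, T.right_inv hy⟩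
    simp only [Function.comp_apply]
    rw [hsτ x hx, T.left_inv hx]
  exact ⟨⟨s, mem_testSections_of_smoothOn T.isOpen' hsmooth (T.isCompact_image hK hKU) hKU' hsK⟩,
    ⟨K, hK, hKU, hΦK⟩, ⟨_, T.isCompact_image hK hKU, hKU', hsK⟩, hsτ⟩

variable [FiniteDimensional ℂ F]
  [ContMDiffVectorBundle ∞ F S (𝓡 n)] [ContMDiffVectorBundle ∞ F' S' (𝓡 n')]

/-- In local trivialisations, the fibre maps of a bundle isometry form a smooth family of
invertible linear maps. -/
theorem exists_local_coordinates {x₀ : Z} (hx₀ : x₀ ∈ U) :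
    ∃ A : Z → F →L[ℝ] F', ContMDiffAt (𝓡 n) 𝓘(ℝ, F →L[ℝ] F') ∞ A x₀ ∧
      (A x₀).IsInvertible ∧ ∀ᶠ x in nhds x₀, ∀ v : S x,
        A x (trivializationAt F S x₀ ⟨x, v⟩).2 =
          (trivializationAt F' S' (T.τ x₀) ⟨T.τ x, T.lift x v⟩).2 := by
  set e := trivializationAt F S x₀ with he
  set e' := trivializationAt F' S' (T.τ x₀) with he'
  let b := Module.finBasis ℝ F
  have hτc : ContinuousAt T.τ x₀ :=
    T.contMDiffOn.continuousOn.continuousAt (T.isOpen.mem_nhds hx₀)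
  have hbase : ∀ᶠ x in nhds x₀, x ∈ U ∧ x ∈ e.baseSet ∧ T.τ x ∈ e'.baseSet := by
    filter_upwards [T.isOpen.mem_nhds hx₀,
      e.open_baseSet.mem_nhds (FiberBundle.mem_baseSet_trivializationAt' x₀),
      hτc.preimage_mem_nhds (e'.open_baseSet.mem_nhds
        (FiberBundle.mem_baseSet_trivializationAt' (T.τ x₀)))] with x h1 h2 h3
    exact ⟨h1, h2, h3⟩
  let w : Fin (Module.finrank ℝ F) → Z → F' := fun i x =>
    (e' ⟨T.τ x, T.lift x (e.symm x (b i))⟩).2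
  have hw : ∀ i, ContMDiffAt (𝓡 n) 𝓘(ℝ, F') ∞ (w i) x₀ := by
    intro i
    have h1 : ContMDiffAt (𝓡 n) ((𝓡 n).prod 𝓘(ℝ, F)) ∞
        (fun x => TotalSpace.mk' F x (e.symm x (b i))) x₀ := by
      rw [contMDiffAt_section]
      refine (contMDiffAt_const (c := b i)).congr_of_eventuallyEq ?_
      filter_upwards [hbase] with x hx
      rw [← he, e.apply_mk_symm hx.2.1]
    have h2 := (T.contMDiffOn_lift.contMDiffAt (x := TotalSpace.mk' F x₀ (e.symm x₀ (b i)))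
      ((T.isOpen.preimage (FiberBundle.continuous_proj F S)).mem_nhds hx₀)).comp x₀ h1
    exact (contMDiffAt_totalSpace.1 h2).2
  let A : Z → F →L[ℝ] F' := fun x =>
    ∑ i, ContinuousLinearMap.smulRightL ℝ F F' (LinearMap.toContinuousLinearMap (b.coord i)) (w i x)
  have hA : ∀ x v, A x v = ∑ i, b.coord i v • w i x := by
    intro x v
    simp [A]
  have hAv : ∀ x ∈ U, x ∈ e.baseSet → T.τ x ∈ e'.baseSet → ∀ v : S x,
      A x (e ⟨x, v⟩).2 = (e' ⟨T.τ x, T.lift x v⟩).2 := by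
    intro x _ hxe hxe' v
    have hv : v = ∑ i, b.coord i (e ⟨x, v⟩).2 • e.symm x (b i) := by
      conv_lhs => rw [← e.symm_apply_apply_mk hxe v, ← b.sum_repr (e ⟨x, v⟩).2]
      simp only [← e.symmₗ_apply (R := ℝ) hxe, map_sum, map_smul]
      rfl
    have hl : ∀ u : S x, (e' ⟨T.τ x, T.lift x u⟩).2 =
        (e'.linearEquivAt ℝ (T.τ x) hxe').toLinearMap (((T.lift x).restrictScalars ℝ) u) :=
      fun u => rfl
    conv_rhs => rw [hv]
    rw [hA, hl, map_sum, map_sum]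
    refine Finset.sum_congr rfl fun i _ => ?_
    rw [map_smul, map_smul]
    rfl
  refine ⟨A, ?_, ?_, ?_⟩
  · refine ContMDiffAt.sum fun i _ => ?_
    exact (ContinuousLinearMap.contMDiff _).contMDiffAt.comp x₀ (hw i)
  · obtain ⟨h1, h2, h3⟩ := hbase.self_of_nhds
    let E : F ≃ₗ[ℝ] F' := (e.linearEquivAt ℝ x₀ h2).symm.trans
      ((LinearEquiv.ofBijective ((T.lift x₀).restrictScalars ℝ)
        ⟨T.injective_lift h1, T.surjective_lift x₀ h1⟩).trans (e'.linearEquivAt ℝ (T.τ x₀) h3))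
    refine ⟨E.toContinuousLinearEquiv, ?_⟩
    ext v
    have := hAv x₀ h1 h2 h3 (e.symm x₀ v)
    rw [e.apply_mk_symm h2] at this
    rw [this]
    rfl
  · filter_upwards [hbase] with x hx
    exact hAv x hx.1 hx.2.1 hx.2.2

/-- The pull-back of a test section over `U'`. -/
theorem exists_pull [T2Space Z] (Φ' : TestSections n' F' S') (hΦ' : SupportedIn Φ' U') :
    ∃ Φ : TestSections n F S, Corresponds T Φ Φ' := by
  have hex : ∀ x : Z, ∃ v : S x, (x ∈ U → T.lift x v = Φ'.1 (T.τ x)) ∧ (x ∉ U → v = 0) := by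
    intro x
    by_cases hx : x ∈ U
    · obtain ⟨v, hv⟩ := T.surjective_lift x hx (Φ'.1 (T.τ x))
      exact ⟨v, fun _ => hv, fun h => absurd hx h⟩
    · exact ⟨0, fun h => absurd h hx, fun _ => rfl⟩
  choose s hs hs0 using hex
  obtain ⟨K, hK, hKU, hΦK⟩ := hΦ'
  have hsK : ∀ x ∉ T.τ.symm '' K, s x = 0 := by
    intro x hx
    by_cases hxU : x ∈ U
    · apply T.injective_lift hxU
      rw [hs x hxU, map_zero]
      exact hΦK _ fun h => hx ⟨_, h, T.left_inv hxU⟩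
    · exact hs0 x hxU
  have hKU' : T.τ.symm '' K ⊆ U := by
    rintro _ ⟨x, hx, rfl⟩
    exact T.symm_mem (hKU hx)
  have hsmooth : SmoothOn n F s U := by
    intro x₀ hx₀
    apply ContMDiffAt.contMDiffWithinAt
    rw [contMDiffAt_section]
    obtain ⟨A, hA, hAinv, hAe⟩ := T.exists_local_coordinates hx₀
    have hΦτ : ContMDiffAt (𝓡 n) 𝓘(ℝ, F') ∞
        (fun x => (trivializationAt F' S' (T.τ x₀) ⟨T.τ x, Φ'.1 (T.τ x)⟩).2) x₀ :=
      ((contMDiffAt_section (T.τ x₀)).1 (Φ'.2.1 (T.τ x₀))).comp x₀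
        (T.contMDiffOn.contMDiffAt (T.isOpen.mem_nhds hx₀))
    have hinv : ContMDiffAt (𝓡 n) 𝓘(ℝ, F' →L[ℝ] F) ∞ (fun x => (A x).inverse) x₀ := by
      have : CompleteSpace F := FiniteDimensional.complete ℂ F
      exact (hAinv.contDiffAt_map_inverse (n := ∞)).contMDiffAt.comp x₀ hA
    refine (hinv.clm_apply hΦτ).congr_of_eventuallyEq ?_
    have hAx : ∀ᶠ x in nhds x₀, (A x).IsInvertible := by
      have : CompleteSpace F := FiniteDimensional.complete ℂ F
      obtain ⟨E, hE⟩ := hAinv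
      filter_upwards [hA.continuousAt.preimage_mem_nhds (hE ▸ E.nhds)] with x hx
      obtain ⟨E', hE'⟩ := hx
      exact ⟨E', hE'⟩
    filter_upwards [hAe, hAx, T.isOpen.mem_nhds hx₀] with x h1 h2 h3
    rw [← hs x h3, ← h1, h2.inverse_apply_self]
  exact ⟨⟨s, mem_testSections_of_smoothOn T.isOpen hsmooth (T.isCompact_image_symm hK hKU) hKU'
    hsK⟩, ⟨_, T.isCompact_image_symm hK hKU, hKU', hsK⟩, ⟨K, hK, hKU, hΦK⟩,
    fun x hx => (hs x hx).symm⟩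

end BundleIsometry

end Transplantation

/-! ### Square-integrable sections -/

section SquareIntegrable

variable {n : ℕ} {Z : Type*} [TopologicalSpace Z] [ChartedSpace (EuclideanSpace ℝ (Fin n)) Z]
  [RiemannianBundle (fun x : Z => TangentSpace (𝓡 n) x)] [MeasurableSpace Z]
  {F : Type*} [NormedAddCommGroup F] [NormedSpace ℂ F]
  {S : Z → Type*} [TopologicalSpace (TotalSpace F S)]
  [∀ x, NormedAddCommGroup (S x)] [∀ x, InnerProductSpace ℂ (S x)]
  [FiberBundle F S] [VectorBundle ℂ F S] [VectorBundle ℝ F S]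
  [OpensMeasurableSpace Z] [FiniteDimensional ℂ F]

theorem measurableSection_testSection (Φ : TestSections n F S) : MeasurableSection n F Φ.1 := by
  intro c
  have : ProperSpace F := FiniteDimensional.proper ℂ F
  refine ContinuousOn.aestronglyMeasurable ?_ (trivializationAt F S c).open_baseSet.measurableSet
  refine continuous_snd.comp_continuousOn
    ((trivializationAt F S c).continuousOn.comp Φ.2.1.continuous.continuousOn fun x hx => ?_)
  rw [Trivialization.mem_source]
  exact hx

theorem isOpen_setOf_testSection_ne_zero (Φ : TestSections n F S) : IsOpen {x | Φ.1 x ≠ 0} := by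
  rw [isOpen_iff_mem_nhds]
  intro x₀ hx₀
  set e := trivializationAt F S x₀
  have hx₀e : x₀ ∈ e.baseSet := FiberBundle.mem_baseSet_trivializationAt' x₀
  have hc : ContinuousAt (fun x => (e ⟨x, Φ.1 x⟩).2) x₀ :=
    ((contMDiffAt_section x₀).1 (Φ.2.1 x₀)).continuousAt
  have h0 : (e ⟨x₀, Φ.1 x₀⟩).2 ≠ 0 := fun h =>
    hx₀ ((e.linearEquivAt ℂ x₀ hx₀e).map_eq_zero_iff.1 h)
  filter_upwards [hc.preimage_mem_nhds (isOpen_ne.mem_nhds h0),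
    e.open_baseSet.mem_nhds hx₀e] with x hx hxe h
  apply hx
  change (e ⟨x, Φ.1 x⟩).2 = 0
  rw [h]
  exact (e.linearEquivAt ℂ x hxe).map_zero

variable [IsContMDiffRiemannianBundle (𝓡 n) ∞ F S] [SecondCountableTopology Z]

theorem mem_squareIntegrable_of_le {s : ∀ x, S x} (hs : MeasurableSection n F s) {c : ℝ}
    (u : PreL2 n F S) (h : ∀ x, ‖s x‖ ≤ c * ‖u.toSection x‖) : s ∈ squareIntegrable n F S := by
  refine ⟨hs, (u.2.2.const_mul c).mono (hs.aestronglyMeasurable_norm S)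
    (Filter.Eventually.of_forall fun x => ?_)⟩
  rw [norm_norm]
  exact (h x).trans (le_abs_self _)

namespace PreL2

/-- The element of `PreL2` given by a square-integrable section. -/
def mk (s : ∀ x, S x) (hs : s ∈ squareIntegrable n F S) : PreL2 n F S := ⟨s, hs⟩

@[simp]
theorem toSection_mk (s : ∀ x, S x) (hs : s ∈ squareIntegrable n F S) :
    (mk s hs).toSection = s := rfl

theorem toSection_mem (u : PreL2 n F S) : u.toSection ∈ squareIntegrable n F S := u.2

theorem toSection_injective : Function.Injective (toSection : PreL2 n F S →ₗ[ℂ] ∀ x, S x) :=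
  Subtype.val_injective

theorem inner_def (u v : PreL2 n F S) :
    inner ℂ u v = ∫ x, inner ℂ (u.toSection x) (v.toSection x) ∂(riemannianVolume n Z) := rfl

theorem integrable_norm_sq (u : PreL2 n F S) :
    Integrable (fun x => ‖u.toSection x‖ ^ 2) (riemannianVolume n Z) :=
  u.2.2.integrable_sq

theorem norm_sq_eq (u : PreL2 n F S) :
    ‖u‖ ^ 2 = ∫ x, ‖u.toSection x‖ ^ 2 ∂(riemannianVolume n Z) := by
  rw [← inner_self_eq_norm_sq (𝕜 := ℂ), inner_def, ← integral_re (integrable_inner u u)]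
  simp only [inner_self_eq_norm_sq]

theorem norm_le_of_forall_le {u : PreL2 n F S} {v : PreL2 n F S} {c : ℝ} (hc : 0 ≤ c)
    (h : ∀ x, ‖u.toSection x‖ ≤ c * ‖v.toSection x‖) : ‖u‖ ≤ c * ‖v‖ := by
  refine le_of_sq_le_sq ?_ (by positivity)
  rw [mul_pow, norm_sq_eq, norm_sq_eq, ← integral_const_mul]
  refine integral_mono u.integrable_norm_sq (v.integrable_norm_sq.const_mul _) fun x => ?_
  beta_reduce
  rw [← mul_pow]
  exact pow_le_pow_left₀ (norm_nonneg _) (h x) 2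

end PreL2

end SquareIntegrable

/-! ### Transplantation preserves the `L²` inner product -/

section Transfer

variable {n : ℕ} {Z : Type*} [TopologicalSpace Z] [ChartedSpace (EuclideanSpace ℝ (Fin n)) Z]
  [IsManifold (𝓡 n) ∞ Z] [SecondCountableTopology Z]
  [RiemannianBundle (fun x : Z => TangentSpace (𝓡 n) x)] [MeasurableSpace Z] [BorelSpace Z]
  {F : Type*} [NormedAddCommGroup F] [NormedSpace ℂ F]
  {S : Z → Type*} [TopologicalSpace (TotalSpace F S)]
  [∀ x, NormedAddCommGroup (S x)] [∀ x, InnerProductSpace ℂ (S x)] [FiberBundle F S]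
  [VectorBundle ℂ F S] [VectorBundle ℝ F S]
  {n' : ℕ} {Z' : Type*} [TopologicalSpace Z'] [ChartedSpace (EuclideanSpace ℝ (Fin n')) Z']
  [IsManifold (𝓡 n') ∞ Z'] [SecondCountableTopology Z']
  [RiemannianBundle (fun x : Z' => TangentSpace (𝓡 n') x)] [MeasurableSpace Z'] [BorelSpace Z']
  {F' : Type*} [NormedAddCommGroup F'] [NormedSpace ℂ F']
  {S' : Z' → Type*} [TopologicalSpace (TotalSpace F' S')]
  [∀ x, NormedAddCommGroup (S' x)] [∀ x, InnerProductSpace ℂ (S' x)] [FiberBundle F' S']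
  [VectorBundle ℂ F' S'] [VectorBundle ℝ F' S']
  {U : Set Z} {U' : Set Z'}

namespace BundleIsometry

theorem mdifferentiable (T : BundleIsometry n F S n' F' S' U U') :
    T.τ.MDifferentiable (𝓡 n) (𝓡 n') :=
  ⟨(T.contMDiffOn.mono T.source_eq.subset).mdifferentiableOn (by simp),
    (T.contMDiffOn_symm.mono T.target_eq.subset).mdifferentiableOn (by simp)⟩

/-- The dimensions are independent parameters of a bundle isometry, and differ only if `U` is empty. -/
theorem dim_eq (T : BundleIsometry n F S n' F' S' U U') {x : Z} (hx : x ∈ U) : n = n' := by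
  have e : EuclideanSpace ℝ (Fin n) ≃L[ℝ] EuclideanSpace ℝ (Fin n') :=
    T.mdifferentiable.mfderiv (T.source_eq.superset hx)
  simpa using e.toLinearEquiv.finrank_eq

variable (T : BundleIsometry n F S n' F' S' U U')

theorem map_riemannianVolume :
    ((riemannianVolume n' Z').restrict U').map T.τ.symm = (riemannianVolume n Z).restrict U := by
  -- if `U` is empty, the dimensions may differ and both measures vanish
  rcases U.eq_empty_or_nonempty with hU | ⟨x, hx⟩
  · have hU' : U' = ∅ := Set.eq_empty_of_forall_notMem fun y hy => by
      simpa [hU] using T.symm_mem hy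
    have h1 : (riemannianVolume n Z).restrict U = 0 := by rw [hU, Measure.restrict_empty]
    have h2 : (riemannianVolume n' Z').restrict U' = 0 := by rw [hU', Measure.restrict_empty]
    rw [h1, h2, Measure.map_zero]
  · obtain rfl := T.dim_eq hx
    have hτ : IsLocalIsometry (n := n) T.τ :=
      ⟨fun x hx => T.mdifferentiable.mdifferentiableAt hx,
        fun x hx v => T.norm_mfderiv x (T.source_eq.subset hx) v⟩
    have h := Excision.map_riemannianVolume hτ
    rwa [T.source_eq, T.target_eq] at h

variable {E : Type*} [NormedAddCommGroup E] {f : Z → E} {f' : Z' → E}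

theorem ae_eq_comp_symm (h : ∀ᵐ x ∂(riemannianVolume n Z), x ∈ U → f' (T.τ x) = f x) :
    f' =ᵐ[(riemannianVolume n' Z').restrict U'] f ∘ T.τ.symm := by
  have hm : AEMeasurable T.τ.symm ((riemannianVolume n' Z').restrict U') :=
    T.contMDiffOn_symm.continuousOn.aemeasurable T.isOpen'.measurableSet
  have h1 : ∀ᵐ x ∂(((riemannianVolume n' Z').restrict U').map T.τ.symm), f' (T.τ x) = f x := by
    rw [T.map_riemannianVolume]
    exact (ae_restrict_iff' T.isOpen.measurableSet).2 h
  filter_upwards [ae_of_ae_map hm h1, ae_restrict_mem T.isOpen'.measurableSet] with y hy hyU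
  rwa [T.right_inv hyU] at hy

theorem integral_eq [NormedSpace ℝ E] (hf : AEStronglyMeasurable f (riemannianVolume n Z))
    (hU : ∀ x ∉ U, f x = 0) (hU' : ∀ y ∉ U', f' y = 0)
    (h : ∀ᵐ x ∂(riemannianVolume n Z), x ∈ U → f' (T.τ x) = f x) :
    ∫ y, f' y ∂(riemannianVolume n' Z') = ∫ x, f x ∂(riemannianVolume n Z) := by
  have hm : AEMeasurable T.τ.symm ((riemannianVolume n' Z').restrict U') :=
    T.contMDiffOn_symm.continuousOn.aemeasurable T.isOpen'.measurableSet
  rw [← setIntegral_eq_integral_of_forall_compl_eq_zero hU',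
    ← setIntegral_eq_integral_of_forall_compl_eq_zero hU,
    integral_congr_ae (T.ae_eq_comp_symm h), ← T.map_riemannianVolume]
  refine (integral_map hm ?_).symm
  rw [T.map_riemannianVolume]
  exact hf.restrict

theorem memLp_iff {p : ℝ≥0∞} (hf : AEStronglyMeasurable f (riemannianVolume n Z))
    (hU : ∀ x ∉ U, f x = 0) (hU' : ∀ y ∉ U', f' y = 0)
    (h : ∀ᵐ x ∂(riemannianVolume n Z), x ∈ U → f' (T.τ x) = f x) :
    MemLp f' p (riemannianVolume n' Z') ↔ MemLp f p (riemannianVolume n Z) := by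
  have hm : AEMeasurable T.τ.symm ((riemannianVolume n' Z').restrict U') :=
    T.contMDiffOn_symm.continuousOn.aemeasurable T.isOpen'.measurableSet
  have h1 : U.indicator f = f := Set.indicator_eq_self.2 fun x hx => by
    by_contra hxU
    exact hx (hU x hxU)
  have h2 : U'.indicator f' = f' := Set.indicator_eq_self.2 fun x hx => by
    by_contra hxU
    exact hx (hU' x hxU)
  rw [← h1, ← h2, memLp_indicator_iff_restrict T.isOpen.measurableSet,
    memLp_indicator_iff_restrict T.isOpen'.measurableSet, memLp_congr_ae (T.ae_eq_comp_symm h),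
    ← T.map_riemannianVolume]
  refine (memLp_map_measure_iff ?_ hm).symm
  rw [T.map_riemannianVolume]
  exact hf.restrict

/-- Measurable sections over `U` and `U'`, extended by zero, that correspond to each other under
the bundle isometry almost everywhere. -/
structure CorrespondsAE (s : ∀ x, S x) (s' : ∀ x, S' x) : Prop where
  eq_zero : ∀ x ∉ U, s x = 0
  eq_zero' : ∀ y ∉ U', s' y = 0
  apply_eq : ∀ᵐ x ∂(riemannianVolume n Z), x ∈ U → s' (T.τ x) = T.lift x (s x)

variable [FiniteDimensional ℂ F] [IsContMDiffRiemannianBundle (𝓡 n) ∞ F S]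
  [FiniteDimensional ℂ F']
  [IsContMDiffRiemannianBundle (𝓡 n') ∞ F' S'] {T}

theorem CorrespondsAE.mem_squareIntegrable_iff {s : ∀ x, S x} {s' : ∀ x, S' x}
    (h : T.CorrespondsAE s s') (hs : MeasurableSection n F s) (hs' : MeasurableSection n' F' s') :
    s' ∈ squareIntegrable n' F' S' ↔ s ∈ squareIntegrable n F S := by
  have : MemLp (fun y => ‖s' y‖) 2 (riemannianVolume n' Z') ↔
      MemLp (fun x => ‖s x‖) 2 (riemannianVolume n Z) := by
    refine T.memLp_iff (hs.aestronglyMeasurable_norm S) (fun x hx => ?_) (fun y hy => ?_) ?_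
    · rw [h.eq_zero x hx, norm_zero]
    · rw [h.eq_zero' y hy, norm_zero]
    · filter_upwards [h.apply_eq] with x hx hxU
      rw [hx hxU, T.norm_lift x hxU]
  exact ⟨fun h => ⟨hs, this.1 h.2⟩, fun h => ⟨hs', this.2 h.2⟩⟩

theorem CorrespondsAE.inner_eq {u v : PreL2 n F S} {u' v' : PreL2 n' F' S'}
    (hu : T.CorrespondsAE u.toSection u'.toSection) (hv : T.CorrespondsAE v.toSection v'.toSection) :
    inner ℂ u' v' = inner ℂ u v := by
  rw [PreL2.inner_def, PreL2.inner_def]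
  refine T.integral_eq (MeasurableSection.aestronglyMeasurable_inner S u.toSection_mem.1
    v.toSection_mem.1) (fun x hx => ?_) (fun y hy => ?_) ?_
  · rw [hu.eq_zero x hx, inner_zero_left]
  · rw [hu.eq_zero' y hy, inner_zero_left]
  · filter_upwards [hu.apply_eq, hv.apply_eq] with x hux hvx hxU
    rw [hux hxU, hvx hxU, T.inner_lift hxU]

theorem CorrespondsAE.norm_eq {u : PreL2 n F S} {u' : PreL2 n' F' S'}
    (hu : T.CorrespondsAE u.toSection u'.toSection) : ‖u'‖ = ‖u‖ := by
  rw [← sq_eq_sq₀ (norm_nonneg _) (norm_nonneg _)]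
  have h := congrArg RCLike.re (hu.inner_eq hu)
  rwa [inner_self_eq_norm_sq, inner_self_eq_norm_sq] at h

theorem _root_.Excision.Corresponds.correspondsAE {Φ : TestSections n F S}
    {Φ' : TestSections n' F' S'} (h : Corresponds T Φ Φ') : T.CorrespondsAE Φ.1 Φ'.1 where
  eq_zero x hx := by
    obtain ⟨K, -, hKU, hK⟩ := h.supportedIn
    exact hK x fun hxK => hx (hKU hxK)
  eq_zero' y hy := by
    obtain ⟨K, -, hKU, hK⟩ := h.supportedIn'
    exact hK y fun hyK => hy (hKU hyK)
  apply_eq := Filter.Eventually.of_forall h.apply_eq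

end BundleIsometry

end Transfer

/-! ### Test sections as elements of `L²` -/

section NullSections

variable {n : ℕ} {Z : Type*} [TopologicalSpace Z] [ChartedSpace (EuclideanSpace ℝ (Fin n)) Z]
  [IsManifold (𝓡 n) ∞ Z] [SecondCountableTopology Z]
  [RiemannianBundle (fun x : Z => TangentSpace (𝓡 n) x)] [MeasurableSpace Z] [BorelSpace Z]
  [IsContMDiffRiemannianBundle (𝓡 n) ∞ (EuclideanSpace ℝ (Fin n))
      (fun x : Z => TangentSpace (𝓡 n) x)]
  {F : Type*} [NormedAddCommGroup F] [NormedSpace ℂ F] [FiniteDimensional ℂ F]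
  {S : Z → Type*} [TopologicalSpace (TotalSpace F S)]
  [∀ x, NormedAddCommGroup (S x)] [∀ x, InnerProductSpace ℂ (S x)] [FiberBundle F S]
  [VectorBundle ℂ F S] [VectorBundle ℝ F S] [IsContMDiffRiemannianBundle (𝓡 n) ∞ F S]

/-- A test section is determined by its class in `L²`, since it is continuous and nonempty open sets
have positive volume. -/
theorem testSection_eq_zero_of_norm {Φ : TestSections n F S} {u : PreL2 n F S}
    (hu : u.toSection = Φ.1) (h0 : ‖u‖ = 0) : Φ = 0 := by
  have h1 : ∫ x, ‖Φ.1 x‖ ^ 2 ∂(riemannianVolume n Z) = 0 := by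
    rw [← hu, ← PreL2.norm_sq_eq, h0, sq, zero_mul]
  rw [integral_eq_zero_iff_of_nonneg (fun x => sq_nonneg _) (hu ▸ u.integrable_norm_sq)] at h1
  by_contra hΦ
  have hne : {x | Φ.1 x ≠ 0}.Nonempty := by
    by_contra hne
    rw [Set.not_nonempty_iff_eq_empty, Set.eq_empty_iff_forall_notMem] at hne
    exact hΦ (Subtype.ext (funext fun x => not_not.1 (hne x)))
  refine (riemannianVolume_pos (n := n) (isOpen_setOf_testSection_ne_zero Φ) hne).ne' ?_
  rw [Filter.EventuallyEq, ae_iff] at h1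
  simpa using h1

end NullSections

/-! ### Closures of operators and extension of relations by density -/

section Closures

variable {H : Type*} [NormedAddCommGroup H] [InnerProductSpace ℂ H] [CompleteSpace H]

theorem isClosable_of_isSelfAdjoint_closure {A : H →ₗ.[ℂ] H} (hA : IsSelfAdjoint A.closure) :
    A.IsClosable :=
  hA.isClosed.isClosable.leIsClosable A.le_closure

/-- Bounded symmetric perturbations of self-adjoint operators are self-adjoint. -/
theorem isSelfAdjoint_add_bounded {A A₁ : H →ₗ.[ℂ] H} (hA : IsSelfAdjoint A) {B : H →L[ℂ] H}
    (hB : ∀ x y, inner ℂ (B x) y = inner ℂ x (B y))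
    (h : ∀ x y, (x, y) ∈ A₁.graph ↔ (x, y - B x) ∈ A.graph) : IsSelfAdjoint A₁ := by
  have hdom : A₁.domain = A.domain := by
    ext x
    rw [LinearPMap.mem_domain_iff, LinearPMap.mem_domain_iff]
    exact ⟨fun ⟨y, hy⟩ => ⟨_, (h x y).1 hy⟩,
      fun ⟨y, hy⟩ => ⟨y + B x, (h x _).2 (by rwa [add_sub_cancel_right])⟩⟩
  refine isSelfAdjoint_of_graph (hdom ▸ hA.dense_domain) (fun x y x' y' hxy hxy' => ?_)
    fun w z hwz => ?_
  · have := inner_eq_of_mem_graph hA ((h _ _).1 hxy) ((h _ _).1 hxy')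
    rw [inner_sub_left, inner_sub_right, hB] at this
    exact sub_left_injective this
  · refine (h w z).2 (mem_graph_of_forall_inner hA fun x y hxy => ?_)
    have := hwz x (y + B x) ((h _ _).2 (by rwa [add_sub_cancel_right]))
    rw [inner_add_left, hB] at this
    rw [inner_sub_right, ← this, add_sub_cancel_right]

/-- A bounded linear relation with dense domain extends to a bounded operator. -/
theorem exists_clm_of_relation {E E' : Type*} [NormedAddCommGroup E] [NormedSpace ℂ E]
    [NormedAddCommGroup E'] [NormedSpace ℂ E'] [CompleteSpace E'] (R : Submodule ℂ (E × E')) (c : ℝ)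
    (hd : ∀ x, x ∈ closure (Prod.fst '' (R : Set (E × E'))))
    (hc : ∀ p ∈ R, ‖p.2‖ ≤ c * ‖p.1‖) : ∃ W : E →L[ℂ] E', ∀ p ∈ R, W p.1 = p.2 := by
  let e : R →ₗ[ℂ] E := LinearMap.fst ℂ E E' ∘ₗ R.subtype
  let f : R →ₗ[ℂ] E' := LinearMap.snd ℂ E E' ∘ₗ R.subtype
  have he : DenseRange e := by
    intro x
    refine closure_mono ?_ (hd x)
    rintro _ ⟨p, hp, rfl⟩
    exact ⟨⟨p, hp⟩, rfl⟩
  exact ⟨f.extendOfNorm e, fun p hp =>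
    LinearMap.extendOfNorm_eq (f := f) (e := e) he ⟨c, fun p => hc p p.2⟩ ⟨p, hp⟩⟩

end Closures

/-! ### Operators on `L²` defined by relations between sections -/

section SectionRelations

variable {n : ℕ} {Z : Type*} [TopologicalSpace Z] [ChartedSpace (EuclideanSpace ℝ (Fin n)) Z]
  [SecondCountableTopology Z]
  [RiemannianBundle (fun x : Z => TangentSpace (𝓡 n) x)] [MeasurableSpace Z] [BorelSpace Z]
  {F : Type*} [NormedAddCommGroup F] [NormedSpace ℂ F] [FiniteDimensional ℂ F]
  {S : Z → Type*} [TopologicalSpace (TotalSpace F S)]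
  [∀ x, NormedAddCommGroup (S x)] [∀ x, InnerProductSpace ℂ (S x)] [FiberBundle F S]
  [VectorBundle ℂ F S] [VectorBundle ℝ F S] [IsContMDiffRiemannianBundle (𝓡 n) ∞ F S]
  {n' : ℕ} {Z' : Type*} [TopologicalSpace Z'] [ChartedSpace (EuclideanSpace ℝ (Fin n')) Z']
  [SecondCountableTopology Z']
  [RiemannianBundle (fun x : Z' => TangentSpace (𝓡 n') x)] [MeasurableSpace Z'] [BorelSpace Z']
  {F' : Type*} [NormedAddCommGroup F'] [NormedSpace ℂ F'] [FiniteDimensional ℂ F']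
  {S' : Z' → Type*} [TopologicalSpace (TotalSpace F' S')]
  [∀ x, NormedAddCommGroup (S' x)] [∀ x, InnerProductSpace ℂ (S' x)] [FiberBundle F' S']
  [VectorBundle ℂ F' S'] [VectorBundle ℝ F' S'] [IsContMDiffRiemannianBundle (𝓡 n') ∞ F' S']

variable (n F n' F') in
/-- The relation between square-integrable sections defined by a linear relation between
sections. -/
def l2Relation (ρ : Submodule ℂ ((∀ x, S x) × (∀ x, S' x))) :
    Submodule ℂ (L2 n F S × L2 n' F' S') :=
  (ρ.comap (PreL2.toSection.prodMap PreL2.toSection)).map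
    ((UniformSpace.Completion.toComplₗᵢ (𝕜 := ℂ) (E := PreL2 n F S)).toLinearMap.prodMap
      (UniformSpace.Completion.toComplₗᵢ (𝕜 := ℂ) (E := PreL2 n' F' S')).toLinearMap)

theorem mem_l2Relation {ρ : Submodule ℂ ((∀ x, S x) × (∀ x, S' x))}
    {p : L2 n F S × L2 n' F' S'} :
    p ∈ l2Relation n F n' F' ρ ↔ ∃ (u : PreL2 n F S) (v : PreL2 n' F' S'),
      (u.toSection, v.toSection) ∈ ρ ∧ p = ((u : L2 n F S), (v : L2 n' F' S')) := by
  constructor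
  · rintro ⟨⟨u, v⟩, h, rfl⟩
    exact ⟨u, v, h, rfl⟩
  · rintro ⟨u, v, h, rfl⟩
    exact ⟨⟨u, v⟩, h, rfl⟩

/-- A linear relation between sections that is bounded in `L²` and densely defined extends to a
bounded operator. -/
theorem exists_clm_of_l2Relation (ρ : Submodule ℂ ((∀ x, S x) × (∀ x, S' x))) (c : ℝ)
    (hd : ∀ x : L2 n F S, x ∈ closure {x : L2 n F S | ∃ (u : PreL2 n F S) (v : PreL2 n' F' S'),
      (u.toSection, v.toSection) ∈ ρ ∧ x = u})
    (hc : ∀ (u : PreL2 n F S) (v : PreL2 n' F' S'), (u.toSection, v.toSection) ∈ ρ →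
      ‖v‖ ≤ c * ‖u‖) :
    ∃ W : L2 n F S →L[ℂ] L2 n' F' S', ∀ (u : PreL2 n F S) (v : PreL2 n' F' S'),
      (u.toSection, v.toSection) ∈ ρ → W u = v := by
  have hd' : ∀ x, x ∈ closure (Prod.fst '' (l2Relation n F n' F' ρ : Set (L2 n F S × L2 n' F' S'))) := by
    refine fun x => closure_mono ?_ (hd x)
    rintro _ ⟨u, v, h, rfl⟩
    exact ⟨_, mem_l2Relation.2 ⟨u, v, h, rfl⟩, rfl⟩
  have hc' : ∀ p ∈ l2Relation n F n' F' ρ, ‖p.2‖ ≤ c * ‖p.1‖ := by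
    intro p hp
    obtain ⟨u, v, h, rfl⟩ := mem_l2Relation.1 hp
    simpa only [UniformSpace.Completion.norm_coe] using hc u v h
  obtain ⟨W, hW⟩ := exists_clm_of_relation _ c hd' hc'
  exact ⟨W, fun u v h => hW _ (mem_l2Relation.2 ⟨u, v, h, rfl⟩)⟩

variable [IsManifold (𝓡 n) ∞ Z] [IsContMDiffRiemannianBundle (𝓡 n) ∞ (EuclideanSpace ℝ (Fin n))
      (fun x : Z => TangentSpace (𝓡 n) x)]

/-- The graph of an operator on test sections is indeed a graph in `L² × L²`. -/
theorem graph_toLinearPMap_opGraph (T : TestSections n F S →ₗ[ℂ] (∀ x, S x)) :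
    (opGraph T).toLinearPMap.graph = opGraph T := by
  refine Submodule.toLinearPMap_graph_eq _ ?_
  rintro _ ⟨Φ, u, v, hu, hv, rfl⟩ h0
  have hu0 : ‖u‖ = 0 := by
    rw [← UniformSpace.Completion.norm_coe]
    exact norm_eq_zero.2 h0
  have hΦ := testSection_eq_zero_of_norm hu hu0
  rw [hΦ, map_zero, ← map_zero (PreL2.toSection (n := n) (F := F) (S := S))] at hv
  rw [PreL2.toSection_injective hv]
  exact UniformSpace.Completion.coe_zero

theorem graph_closureOp {T : TestSections n F S →ₗ[ℂ] (∀ x, S x)}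
    (hT : (opGraph T).toLinearPMap.IsClosable) :
    (closureOp T).graph = (opGraph T).topologicalClosure := by
  rw [closureOp, ← hT.graph_closure_eq_closure_graph, graph_toLinearPMap_opGraph]

variable {L : TestSections n F S →ₗ[ℂ] TestSections n F S} {h : ∀ x, Module.End ℂ (S x)}

theorem IsPotential.exists_bound (hh : IsPotential n F h) :
    ∃ c : ℝ, 0 ≤ c ∧ ∀ x v, ‖h x v‖ ≤ c * ‖v‖ := by
  obtain ⟨b, hb⟩ := hh.bounded
  refine ⟨max b 0, le_max_right _ _, fun x v => ?_⟩
  have : FiniteDimensional ℂ (S x) :=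
    ((trivializationAt F S x).linearEquivAt ℂ x
      (FiberBundle.mem_baseSet_trivializationAt' x)).symm.finiteDimensional
  exact norm_apply_le_of_eigenvalues (hh.symmetric x) (hb x) v

theorem IsPotential.exists_apply (hh : IsPotential n F h) (u : PreL2 n F S) :
    ∃ v : PreL2 n F S, v.toSection = fun x => h x (u.toSection x) := by
  obtain ⟨c, -, hc⟩ := hh.exists_bound
  exact ⟨.mk _ (mem_squareIntegrable_of_le (hh.measurable _ u.toSection_mem.1) u
    fun x => hc x _), rfl⟩

/-- A potential acts on `L²` as a bounded self-adjoint operator. -/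
theorem IsPotential.exists_clm (hh : IsPotential n F h) :
    ∃ B : L2 n F S →L[ℂ] L2 n F S, (∀ x y, inner ℂ (B x) y = inner ℂ x (B y)) ∧
      ∀ u v : PreL2 n F S, v.toSection = (fun x => h x (u.toSection x)) → B u = v := by
  obtain ⟨c, hc0, hc⟩ := hh.exists_bound
  let f : (∀ x, S x) →ₗ[ℂ] (∀ x, S x) := LinearMap.pi fun x => h x ∘ₗ LinearMap.proj x
  have hf : ∀ u v : PreL2 n F S, (u.toSection, v.toSection) ∈ f.graph ↔
      v.toSection = fun x => h x (u.toSection x) := fun u v => LinearMap.mem_graph_iff _ _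
  obtain ⟨B, hB⟩ : ∃ B : L2 n F S →L[ℂ] L2 n F S, ∀ u v : PreL2 n F S,
      (u.toSection, v.toSection) ∈ f.graph → B u = v := by
    refine exists_clm_of_l2Relation f.graph c (fun x => ?_) fun u v huv => ?_
    · refine closure_mono ?_ (UniformSpace.Completion.denseRange_coe (α := PreL2 n F S) x)
      rintro _ ⟨u, rfl⟩
      obtain ⟨v, hv⟩ := hh.exists_apply u
      exact ⟨u, v, (hf u v).2 hv, rfl⟩
    · refine PreL2.norm_le_of_forall_le hc0 fun x => ?_
      rw [(hf u v).1 huv]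
      exact hc x _
  have hB' : ∀ u v : PreL2 n F S, v.toSection = (fun x => h x (u.toSection x)) → B u = v :=
    fun u v huv => hB u v ((hf u v).2 huv)
  refine ⟨B, fun x y => ?_, hB'⟩
  induction x, y using UniformSpace.Completion.induction_on₂ with
  | hp => exact isClosed_eq (by fun_prop) (by fun_prop)
  | ih u w =>
    obtain ⟨v, hv⟩ := hh.exists_apply u
    obtain ⟨z, hz⟩ := hh.exists_apply w
    rw [hB' u v hv, hB' w z hz, UniformSpace.Completion.inner_coe,
      UniformSpace.Completion.inner_coe, PreL2.inner_def, PreL2.inner_def, hv, hz]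
    exact integral_congr_ae (Filter.Eventually.of_forall fun x => hh.symmetric x _ _)

/-- Adding the potential shears the graph of the closure. -/
theorem mem_closure_opGraph_withPotential_iff {m : ℝ} (hh : IsPotential n F h)
    {B : L2 n F S →L[ℂ] L2 n F S}
    (hB : ∀ u v : PreL2 n F S, v.toSection = (fun x => h x (u.toSection x)) → B u = v)
    {x y : L2 n F S} :
    (x, y) ∈ (opGraph (withPotential L h m)).topologicalClosure ↔
      (x, y - ((m : ℂ) • B) x) ∈
        (opGraph ((TestSections n F S).subtype ∘ₗ L)).topologicalClosure := by
  have h1 : ∀ Φ : TestSections n F S,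
      withPotential L h m Φ = (L Φ).1 + (m : ℂ) • fun x => h x (Φ.1 x) := fun _ => rfl
  rw [← SetLike.mem_coe, ← SetLike.mem_coe, Submodule.topologicalClosure_coe,
    Submodule.topologicalClosure_coe]
  constructor
  · intro hxy
    have hc : Continuous fun p : L2 n F S × L2 n F S => (p.1, p.2 - ((m : ℂ) • B) p.1) :=
      continuous_fst.prodMk
        (continuous_snd.sub (((m : ℂ) • B).continuous.comp continuous_fst))
    suffices hst : Set.MapsTo (fun p : L2 n F S × L2 n F S => (p.1, p.2 - ((m : ℂ) • B) p.1))
        (opGraph (withPotential L h m)) (opGraph ((TestSections n F S).subtype ∘ₗ L)) by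
      have := map_mem_closure hc hxy hst
      exact this
    intro p hp
    obtain ⟨Φ, u, v, hu, hv, rfl⟩ := hp
    obtain ⟨w, hw⟩ := hh.exists_apply u
    refine ⟨Φ, u, v - (m : ℂ) • w, hu, ?_, ?_⟩
    · rw [map_sub, map_smul, hv, hw, hu, h1]
      exact add_sub_cancel_right (G := ∀ x, S x) _ _
    · beta_reduce
      rw [_root_.smul_apply, hB u w hw, UniformSpace.Completion.coe_sub,
        UniformSpace.Completion.coe_smul]
  · intro hxy
    have hc : Continuous fun p : L2 n F S × L2 n F S => (p.1, p.2 + ((m : ℂ) • B) p.1) :=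
      continuous_fst.prodMk
        (continuous_snd.add (((m : ℂ) • B).continuous.comp continuous_fst))
    suffices hst : Set.MapsTo (fun p : L2 n F S × L2 n F S => (p.1, p.2 + ((m : ℂ) • B) p.1))
        (opGraph ((TestSections n F S).subtype ∘ₗ L)) (opGraph (withPotential L h m)) by
      simpa only [sub_add_cancel] using map_mem_closure hc hxy hst
    intro p hp
    obtain ⟨Φ, u, v, hu, hv, rfl⟩ := hp
    obtain ⟨w, hw⟩ := hh.exists_apply u
    refine ⟨Φ, u, v + (m : ℂ) • w, hu, ?_, ?_⟩
    · rw [map_add, map_smul, hv, hw, hu, h1]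
      rfl
    · beta_reduce
      rw [_root_.smul_apply, hB u w hw, UniformSpace.Completion.coe_add,
        UniformSpace.Completion.coe_smul]

theorem graph_closureOp_of_isEssentiallySelfAdjoint (hL : IsEssentiallySelfAdjoint L) :
    (closureOp ((TestSections n F S).subtype ∘ₗ L)).graph =
      (opGraph ((TestSections n F S).subtype ∘ₗ L)).topologicalClosure :=
  graph_closureOp (isClosable_of_isSelfAdjoint_closure hL)

theorem graph_closureOp_withPotential (hL : IsEssentiallySelfAdjoint L) (hh : IsPotential n F h)
    (m : ℝ) : (closureOp (withPotential L h m)).graph =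
      (opGraph (withPotential L h m)).topologicalClosure := by
  obtain ⟨B, -, hB⟩ := hh.exists_clm
  refine graph_closureOp ?_
  refine ⟨(opGraph (withPotential L h m)).topologicalClosure.toLinearPMap, ?_⟩
  rw [graph_toLinearPMap_opGraph, Submodule.toLinearPMap_graph_eq]
  rintro ⟨x, y⟩ hxy (rfl : x = 0)
  rw [mem_closure_opGraph_withPotential_iff hh hB, map_zero, sub_zero,
    ← graph_closureOp_of_isEssentiallySelfAdjoint hL] at hxy
  exact LinearPMap.graph_fst_eq_zero_snd _ hxy rfl

/-- The operators `L + m h` are essentially self-adjoint. -/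
theorem isSelfAdjoint_closureOp_withPotential (hL : IsEssentiallySelfAdjoint L)
    (hh : IsPotential n F h) (m : ℝ) : IsSelfAdjoint (closureOp (withPotential L h m)) := by
  obtain ⟨B, hBs, hB⟩ := hh.exists_clm
  refine isSelfAdjoint_add_bounded (B := (m : ℂ) • B) hL (fun x y => ?_) fun x y => ?_
  · simp only [_root_.smul_apply, inner_smul_left, inner_smul_right, hBs,
      Complex.conj_ofReal]
  · rw [graph_closureOp_withPotential hL hh, mem_closure_opGraph_withPotential_iff hh hB,
      graph_closureOp_of_isEssentiallySelfAdjoint hL]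

end SectionRelations

/-! ### Coercivity of the potential -/

section Callias

variable {n : ℕ} {Z : Type*} [TopologicalSpace Z] [ChartedSpace (EuclideanSpace ℝ (Fin n)) Z]
  [SecondCountableTopology Z]
  [RiemannianBundle (fun x : Z => TangentSpace (𝓡 n) x)] [MeasurableSpace Z] [BorelSpace Z]
  {F : Type*} [NormedAddCommGroup F] [NormedSpace ℂ F] [FiniteDimensional ℂ F]
  {S : Z → Type*} [TopologicalSpace (TotalSpace F S)]
  [∀ x, NormedAddCommGroup (S x)] [∀ x, InnerProductSpace ℂ (S x)] [FiberBundle F S]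
  [VectorBundle ℂ F S] [VectorBundle ℝ F S] [IsContMDiffRiemannianBundle (𝓡 n) ∞ F S]

/-- The hypotheses on one of the two manifolds: a partition of unity, an essentially self-adjoint
operator `L` of first order for which `|σ(dη)| ≤ K`, and a potential `h` that over `U₁` is smooth,
anticommutes with `L` and satisfies `h² ≥ 1`. -/
structure CalliasData (U₀ U₁ : Set Z) (η : Z → ℝ) (σ : SymbolField n S) (K : ℝ)
    (L : TestSections n F S →ₗ[ℂ] TestSections n F S) (h : ∀ x, Module.End ℂ (S x)) : Prop where
  partition : IsPartition n U₀ U₁ η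
  nonneg : 0 ≤ K
  symbol_le : ∀ x v, ‖σ x (mvfderiv (𝓡 n) η x) v‖ ≤ K * ‖v‖
  hasSymbol : HasSymbol L σ
  selfAdjoint : IsEssentiallySelfAdjoint L
  potential : IsPotential n F h
  smooth : SmoothEndOn n F h U₁
  anticommutes : AnticommutesOn L h U₁
  sq_eigenvalues : SqEigenvaluesGeOneOn h U₁

namespace CalliasData

variable {U₀ U₁ : Set Z} {η : Z → ℝ} {σ : SymbolField n S} {K : ℝ}
  {L : TestSections n F S →ₗ[ℂ] TestSections n F S} {h : ∀ x, Module.End ℂ (S x)}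
  (D : CalliasData U₀ U₁ η σ K L h)

/-- The section `(1 - η) Φ`, which is supported in the coercive region `U₁`. -/
def outer (Φ : TestSections n F S) : TestSections n F S := Φ - smulTest η D.partition.smooth Φ

/-- The section `χ Φ` with `χ = 1 - (1 - η)²`, which is supported in `U₀`. The derivative
`dχ = 2 (1 - η) dη` carries a factor `1 - η`, so that the commutator of `L` with `χ` is controlled
by the coercive region. -/
def inner₀ (Φ : TestSections n F S) : TestSections n F S :=
  (2 : ℂ) • smulTest η D.partition.smooth Φ -
    smulTest η D.partition.smooth (smulTest η D.partition.smooth Φ)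

/-- The section `σ(dη) Φ`, as the commutator of `L` and `η`. -/
def symbolTest (Φ : TestSections n F S) : TestSections n F S :=
  L (smulTest η D.partition.smooth Φ) - smulTest η D.partition.smooth (L Φ)

theorem outer_apply (Φ : TestSections n F S) (x : Z) :
    (D.outer Φ).1 x = ((1 - η x : ℝ) : ℂ) • Φ.1 x := by
  change Φ.1 x - (η x : ℂ) • Φ.1 x = _
  push_cast
  module

theorem inner₀_apply (Φ : TestSections n F S) (x : Z) :
    (D.inner₀ Φ).1 x = ((1 - (1 - η x) ^ 2 : ℝ) : ℂ) • Φ.1 x := by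
  change (2 : ℂ) • (η x : ℂ) • Φ.1 x - (η x : ℂ) • (η x : ℂ) • Φ.1 x = _
  push_cast
  module

theorem symbolTest_apply (Φ : TestSections n F S) (x : Z) :
    (D.symbolTest Φ).1 x = σ x (mvfderiv (𝓡 n) η x) (Φ.1 x) := by
  change (L (smulTest η D.partition.smooth Φ)).1 x - (η x : ℂ) • (L Φ).1 x = _
  rw [D.hasSymbol.apply_smulTest, add_sub_cancel_left]

theorem withPotential_outer (m : ℝ) (Φ : TestSections n F S) (x : Z) :
    withPotential L h m (D.outer Φ) x =
      ((1 - η x : ℝ) : ℂ) • withPotential L h m Φ x - (D.symbolTest Φ).1 x := by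
  rw [withPotential_apply, withPotential_apply, outer_apply, symbolTest_apply, map_smul, outer,
    map_sub]
  change (L Φ).1 x - (L (smulTest η D.partition.smooth Φ)).1 x + _ = _
  rw [D.hasSymbol.apply_smulTest]
  push_cast
  module

theorem withPotential_inner₀ (m : ℝ) (Φ : TestSections n F S) (x : Z) :
    withPotential L h m (D.inner₀ Φ) x =
      ((1 - (1 - η x) ^ 2 : ℝ) : ℂ) • withPotential L h m Φ x +
        (2 : ℂ) • (D.symbolTest (D.outer Φ)).1 x := by
  rw [withPotential_apply, withPotential_apply, inner₀_apply, symbolTest_apply, outer_apply,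
    map_smul, map_smul, inner₀, map_sub, map_smul]
  change (2 : ℂ) • (L (smulTest η D.partition.smooth Φ)).1 x -
    (L (smulTest η D.partition.smooth (smulTest η D.partition.smooth Φ))).1 x + _ = _
  rw [D.hasSymbol.apply_smulTest, D.hasSymbol.apply_smulTest, D.hasSymbol.apply_smulTest,
    smulTest_apply, map_smul]
  push_cast
  module

include D in
theorem measurableSection_withPotential (m : ℝ) (Φ : TestSections n F S) :
    MeasurableSection n F (withPotential L h m Φ) :=
  (measurableSection_testSection (L Φ)).add S
    ((D.potential.measurable _ (measurableSection_testSection Φ)).smul S (m : ℂ))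

include D in
theorem one_sub_mem_Icc (x : Z) : 0 ≤ 1 - η x ∧ 1 - η x ≤ 1 := by
  have := D.partition.mem_Icc x
  exact ⟨by linarith [this.2], by linarith [this.1]⟩

theorem supportedIn_outer (Φ : TestSections n F S) : SupportedIn (D.outer Φ) U₁ := by
  obtain ⟨-, K, hK, h⟩ := Φ.2
  refine ⟨K ∩ tsupport fun x => 1 - η x, hK.inter_right (isClosed_tsupport _),
    Set.inter_subset_right.trans D.partition.tsupport₁, fun x hx => ?_⟩
  rw [outer_apply]
  by_cases hxK : x ∈ K
  · have : 1 - η x = 0 :=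
      image_eq_zero_of_notMem_tsupport (f := fun x => 1 - η x) fun h => hx ⟨hxK, h⟩
    rw [this, Complex.ofReal_zero, zero_smul]
  · rw [h x hxK, smul_zero]

theorem supportedIn_inner₀ (Φ : TestSections n F S) : SupportedIn (D.inner₀ Φ) U₀ := by
  obtain ⟨-, K, hK, h⟩ := Φ.2
  refine ⟨K ∩ tsupport η, hK.inter_right (isClosed_tsupport _),
    Set.inter_subset_right.trans D.partition.tsupport₀, fun x hx => ?_⟩
  rw [inner₀_apply]
  by_cases hxK : x ∈ K
  · have : η x = 0 := image_eq_zero_of_notMem_tsupport fun h => hx ⟨hxK, h⟩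
    rw [this]
    simp
  · rw [h x hxK, smul_zero]

/-- The element `σ(dη) Φ` of `L²`. -/
theorem exists_symbolTest {Φ : TestSections n F S} {u : PreL2 n F S} (hu : u.toSection = Φ.1) :
    ∃ w : PreL2 n F S, w.toSection = (D.symbolTest Φ).1 ∧ ‖w‖ ≤ K * ‖u‖ := by
  have hle : ∀ x, ‖(D.symbolTest Φ).1 x‖ ≤ K * ‖u.toSection x‖ := fun x => by
    rw [symbolTest_apply, hu]
    exact D.symbol_le x _
  exact ⟨.mk _ (mem_squareIntegrable_of_le (measurableSection_testSection _) u hle), rfl,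
    PreL2.norm_le_of_forall_le D.nonneg hle⟩

/-- The outer part `(1 - η) Φ` in `L²`, where `L_m ((1 - η) Φ) = (1 - η) L_m Φ - σ(dη) Φ`. -/
theorem exists_outer {Φ : TestSections n F S} {m : ℝ} {u v : PreL2 n F S} (hu : u.toSection = Φ.1)
    (hv : v.toSection = withPotential L h m Φ) :
    ∃ w z : PreL2 n F S, w.toSection = (D.outer Φ).1 ∧
      z.toSection = withPotential L h m (D.outer Φ) ∧ ‖z‖ ≤ ‖v‖ + K * ‖u‖ := by
  obtain ⟨s, hs, hsu⟩ := D.exists_symbolTest hu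
  have h1 : ∀ x, ‖((1 - η x : ℝ) : ℂ)‖ ≤ 1 := fun x => by
    rw [Complex.norm_real, Real.norm_of_nonneg (D.one_sub_mem_Icc x).1]
    exact (D.one_sub_mem_Icc x).2
  have hw : ∀ x, ‖(D.outer Φ).1 x‖ ≤ 1 * ‖u.toSection x‖ := fun x => by
    rw [outer_apply, norm_smul, hu]
    exact mul_le_mul_of_nonneg_right (h1 x) (norm_nonneg _)
  have hz : ∀ x, ‖(withPotential L h m (D.outer Φ) + (D.symbolTest Φ).1) x‖ ≤
      1 * ‖v.toSection x‖ := fun x => by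
    rw [Pi.add_apply, withPotential_outer, sub_add_cancel, norm_smul, hv]
    exact mul_le_mul_of_nonneg_right (h1 x) (norm_nonneg _)
  set z₀ : PreL2 n F S := .mk _ (mem_squareIntegrable_of_le ((D.measurableSection_withPotential m
    (D.outer Φ)).add S (measurableSection_testSection _)) v hz) with hz₀
  refine ⟨.mk _ (mem_squareIntegrable_of_le (measurableSection_testSection _) u hw), z₀ - s, rfl,
    ?_, ?_⟩
  · rw [map_sub, hs, hz₀, PreL2.toSection_mk, add_sub_cancel_right]
  · have h2 : ‖z₀‖ ≤ 1 * ‖v‖ := PreL2.norm_le_of_forall_le zero_le_one hz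
    rw [one_mul] at h2
    exact (norm_sub_le _ _).trans (add_le_add h2 hsu)

/-- The inner part `χ Φ` in `L²`, where `L_m (χ Φ) = χ L_m Φ + 2 σ(dη) (1 - η) Φ`, so that the error
is bounded by the norm of the outer part `w`. -/
theorem exists_inner₀ {Φ : TestSections n F S} {m : ℝ} {u v w : PreL2 n F S}
    (hu : u.toSection = Φ.1) (hv : v.toSection = withPotential L h m Φ)
    (hw : w.toSection = (D.outer Φ).1) :
    ∃ u₀ v₀ : PreL2 n F S, u₀.toSection = (D.inner₀ Φ).1 ∧
      v₀.toSection = withPotential L h m (D.inner₀ Φ) ∧ ‖u₀‖ ≤ ‖u‖ ∧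
      ‖u - u₀‖ ≤ ‖w‖ ∧ ‖v₀‖ ≤ ‖v‖ + 2 * K * ‖w‖ := by
  obtain ⟨s, hs, hsw⟩ := D.exists_symbolTest hw
  have h1 : ∀ x, ‖((1 - (1 - η x) ^ 2 : ℝ) : ℂ)‖ ≤ 1 := fun x => by
    have := D.one_sub_mem_Icc x
    rw [Complex.norm_real, Real.norm_of_nonneg (by nlinarith)]
    nlinarith
  have hu₀ : ∀ x, ‖(D.inner₀ Φ).1 x‖ ≤ 1 * ‖u.toSection x‖ := fun x => by
    rw [inner₀_apply, norm_smul, hu]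
    exact mul_le_mul_of_nonneg_right (h1 x) (norm_nonneg _)
  have hz : ∀ x, ‖(withPotential L h m (D.inner₀ Φ) -
      (2 : ℂ) • (D.symbolTest (D.outer Φ)).1) x‖ ≤ 1 * ‖v.toSection x‖ := fun x => by
    rw [Pi.sub_apply, withPotential_inner₀, Pi.smul_apply, add_sub_cancel_right, norm_smul, hv]
    exact mul_le_mul_of_nonneg_right (h1 x) (norm_nonneg _)
  have hm : MeasurableSection n F (withPotential L h m (D.inner₀ Φ) -
      (2 : ℂ) • (D.symbolTest (D.outer Φ)).1) := by
    rw [sub_eq_add_neg, ← neg_smul]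
    exact (D.measurableSection_withPotential m _).add S
      ((measurableSection_testSection _).smul S _)
  set z₀ : PreL2 n F S := .mk _ (mem_squareIntegrable_of_le hm v hz) with hz₀
  refine ⟨.mk _ (mem_squareIntegrable_of_le (measurableSection_testSection _) u hu₀),
    z₀ + (2 : ℂ) • s, rfl, ?_, ?_, ?_, ?_⟩
  · rw [map_add, map_smul, hs, hz₀, PreL2.toSection_mk, sub_add_cancel]
  · rw [← one_mul ‖u‖]
    exact PreL2.norm_le_of_forall_le zero_le_one hu₀
  · rw [← one_mul ‖w‖]
    refine PreL2.norm_le_of_forall_le zero_le_one fun x => ?_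
    rw [map_sub, PreL2.toSection_mk, hu, hw, Pi.sub_apply, inner₀_apply, outer_apply,
      norm_smul, one_mul]
    have h2 : Φ.1 x - ((1 - (1 - η x) ^ 2 : ℝ) : ℂ) • Φ.1 x =
        (((1 - η x) ^ 2 : ℝ) : ℂ) • Φ.1 x := by
      push_cast
      module
    rw [h2, norm_smul, Complex.norm_real, Complex.norm_real]
    have h3 := D.one_sub_mem_Icc x
    refine mul_le_mul_of_nonneg_right ?_ (norm_nonneg _)
    rw [Real.norm_of_nonneg h3.1, Real.norm_of_nonneg (sq_nonneg _)]
    nlinarith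
  · have h2 : ‖z₀‖ ≤ 1 * ‖v‖ := PreL2.norm_le_of_forall_le zero_le_one hz
    refine (norm_add_le _ _).trans (add_le_add (by rwa [one_mul] at h2) ?_)
    rw [norm_smul, mul_assoc]
    simpa using hsw

variable [IsManifold (𝓡 n) ∞ Z] [IsContMDiffRiemannianBundle (𝓡 n) ∞ (EuclideanSpace ℝ (Fin n))
      (fun x : Z => TangentSpace (𝓡 n) x)] [T2Space Z]

include D in
/-- The operator `L` is symmetric. -/
theorem inner_eq {Φ Ψ : TestSections n F S} {u v w z : PreL2 n F S} (hu : u.toSection = Φ.1)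
    (hv : v.toSection = (L Φ).1) (hw : w.toSection = Ψ.1) (hz : z.toSection = (L Ψ).1) :
    inner ℂ v w = inner ℂ u z := by
  have hg : ∀ {Φ : TestSections n F S} {u v : PreL2 n F S}, u.toSection = Φ.1 →
      v.toSection = (L Φ).1 → ((u : L2 n F S), (v : L2 n F S)) ∈
        (closureOp ((TestSections n F S).subtype ∘ₗ L)).graph := by
    intro Φ u v hu hv
    rw [graph_closureOp_of_isEssentiallySelfAdjoint D.selfAdjoint]
    exact Submodule.le_topologicalClosure _ ⟨Φ, u, v, hu, hv, rfl⟩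
  have := inner_eq_of_mem_graph D.selfAdjoint (hg hu hv) (hg hw hz)
  rwa [UniformSpace.Completion.inner_coe, UniformSpace.Completion.inner_coe] at this

include D in
/-- Coercivity over `U₁`: since `L` is symmetric and anticommutes with `h`, the cross term in
`‖L Φ + m h Φ‖² = ‖L Φ‖² + m² ‖h Φ‖²` vanishes. -/
theorem mul_norm_le {m : ℝ} {Φ : TestSections n F S} (hΦ : SupportedIn Φ U₁)
    {u v : PreL2 n F S} (hu : u.toSection = Φ.1) (hv : v.toSection = withPotential L h m Φ) :
    m * ‖u‖ ≤ ‖v‖ := by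
  obtain ⟨c, hc0, hc⟩ := D.potential.exists_bound
  obtain ⟨C, hC, hCU, hΦC⟩ := hΦ
  obtain ⟨p, hp⟩ := D.potential.exists_apply u
  rw [hu] at hp
  have hΨ : (fun x => h x (Φ.1 x)) ∈ TestSections n F S :=
    mem_testSections_of_smoothOn D.partition.isOpen₁ (D.smooth Φ) hC hCU fun x hx => by
      rw [hΦC x hx, map_zero]
  set Ψ : TestSections n F S := ⟨_, hΨ⟩ with hΨ_def
  set l : PreL2 n F S := v - (m : ℂ) • p with hl_def
  have hl : l.toSection = (L Φ).1 := by
    have h1 : withPotential L h m Φ = (L Φ).1 + (m : ℂ) • fun x => h x (Φ.1 x) := rfl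
    rw [hl_def, map_sub, map_smul, hv, hp, h1]
    exact add_sub_cancel_right (G := ∀ x, S x) _ _
  have hLΨ : ∀ x, (L Ψ).1 x = -h x ((L Φ).1 x) :=
    D.anticommutes Φ Ψ ⟨C, hC, hCU, hΦC⟩ fun _ => rfl
  have hq : (L Ψ).1 ∈ squareIntegrable n F S :=
    mem_squareIntegrable_of_le (c := c) (measurableSection_testSection _) l fun x => by
      rw [hLΨ, norm_neg, hl]
      exact hc x _
  -- the cross term is imaginary
  have h1 : inner ℂ l p = -inner ℂ p l := by
    rw [D.inner_eq hu hl (w := p) (z := .mk _ hq) (Ψ := Ψ) hp rfl, PreL2.inner_def,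
      PreL2.inner_def, ← integral_neg]
    refine integral_congr_ae (Filter.Eventually.of_forall fun x => ?_)
    beta_reduce
    rw [PreL2.toSection_mk, hLΨ, hu, hp, hl, inner_neg_right, D.potential.symmetric x]
  have h2 : RCLike.re (inner ℂ l p) = 0 := by
    have h3 := congrArg RCLike.re h1
    rw [map_neg, inner_re_symm p l] at h3
    linarith
  have h4 : ‖v‖ ^ 2 = ‖l‖ ^ 2 + m ^ 2 * ‖p‖ ^ 2 := by
    have : v = l + (m : ℂ) • p := (sub_add_cancel _ _).symm
    rw [this, norm_add_sq (𝕜 := ℂ), norm_smul, mul_pow, Complex.norm_real, Real.norm_eq_abs,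
      sq_abs, inner_smul_right, RCLike.re_eq_complex_re, Complex.re_ofReal_mul]
    rw [RCLike.re_eq_complex_re] at h2
    rw [h2]
    ring
  have h5 : ‖u‖ ≤ ‖p‖ := by
    rw [← one_mul ‖p‖]
    refine PreL2.norm_le_of_forall_le zero_le_one fun x => ?_
    rw [hu, hp, one_mul]
    by_cases hx : x ∈ U₁
    · have : FiniteDimensional ℂ (S x) :=
        ((trivializationAt F S x).linearEquivAt ℂ x
          (FiberBundle.mem_baseSet_trivializationAt' x)).symm.finiteDimensional
      exact norm_le_norm_apply_of_sq_eigenvalues (D.potential.symmetric x)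
        (D.sq_eigenvalues x hx) _
    · rw [hΦC x fun h => hx (hCU h), norm_zero]
      exact norm_nonneg _
  refine le_of_sq_le_sq ?_ (norm_nonneg _)
  rw [h4, mul_pow]
  nlinarith [sq_nonneg ‖l‖, pow_le_pow_left₀ (norm_nonneg u) h5 2, sq_nonneg m]

end CalliasData

end Callias

/-! ### The grading operator on `L²` -/

section Grading

variable {n : ℕ} {Z : Type*} [TopologicalSpace Z] [ChartedSpace (EuclideanSpace ℝ (Fin n)) Z]
  [SecondCountableTopology Z]
  [RiemannianBundle (fun x : Z => TangentSpace (𝓡 n) x)] [MeasurableSpace Z] [BorelSpace Z]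
  [IsManifold (𝓡 n) ∞ Z] [IsContMDiffRiemannianBundle (𝓡 n) ∞ (EuclideanSpace ℝ (Fin n))
      (fun x : Z => TangentSpace (𝓡 n) x)] [T2Space Z]
  {F : Type*} [NormedAddCommGroup F] [NormedSpace ℂ F] [FiniteDimensional ℂ F]
  {S : Z → Type*} [TopologicalSpace (TotalSpace F S)]
  [∀ x, NormedAddCommGroup (S x)] [∀ x, InnerProductSpace ℂ (S x)] [FiberBundle F S]
  [VectorBundle ℂ F S] [VectorBundle ℝ F S] [IsContMDiffRiemannianBundle (𝓡 n) ∞ F S]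

variable {L : TestSections n F S →ₗ[ℂ] TestSections n F S} {h Γ : ∀ x, Module.End ℂ (S x)}

/-- Test sections `Φ` such that `Φ` and `L_m Φ` are square-integrable are dense in `L²`. -/
theorem mem_closure_testSections (hL : IsEssentiallySelfAdjoint L) (hh : IsPotential n F h) (m : ℝ)
    (x : L2 n F S) : x ∈ closure {x : L2 n F S | ∃ (Φ : TestSections n F S) (u v : PreL2 n F S),
      u.toSection = Φ.1 ∧ v.toSection = withPotential L h m Φ ∧ x = u} := by
  refine closure_minimal ?_ isClosed_closure
    ((isSelfAdjoint_closureOp_withPotential hL hh m).dense_domain x)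
  intro y hy
  obtain ⟨z, hz⟩ := LinearPMap.mem_domain_iff.1 hy
  rw [graph_closureOp_withPotential hL hh] at hz
  refine map_mem_closure continuous_fst hz ?_
  rintro _ ⟨Φ, u, v, hu, hv, rfl⟩
  exact ⟨Φ, u, v, hu, hv, rfl⟩

theorem IsGrading.apply_apply (hΓ : IsGrading n F Γ) (x : Z) (v : S x) : Γ x (Γ x v) = v := by
  rw [← Module.End.mul_apply, hΓ.sq, Module.End.one_apply]

theorem IsGrading.norm_apply (hΓ : IsGrading n F Γ) (x : Z) (v : S x) : ‖Γ x v‖ = ‖v‖ := by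
  rw [← sq_eq_sq₀ (norm_nonneg _) (norm_nonneg _), ← inner_self_eq_norm_sq (𝕜 := ℂ),
    hΓ.symmetric x, hΓ.apply_apply, inner_self_eq_norm_sq]

theorem withPotential_endTest (hΓ : IsGrading n F Γ) (hL : IsOddOp L Γ) (hh : IsOddEnd h Γ) (m : ℝ)
    (Φ : TestSections n F S) (x : Z) :
    withPotential L h m (endTest hΓ.smooth Φ) x = -Γ x (withPotential L h m Φ x) := by
  have h1 : h x (Γ x (Φ.1 x)) = -Γ x (h x (Φ.1 x)) := by
    have := congrArg (fun f => f (Φ.1 x)) (hh x)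
    simpa only [Module.End.mul_apply, LinearMap.neg_apply] using this
  rw [withPotential_apply, withPotential_apply,
    hL Φ (endTest hΓ.smooth Φ) (SupportedIn.univ Φ) (fun _ => rfl) x, endTest_apply, h1, map_add,
    map_smul, smul_neg, neg_add]

theorem IsGrading.exists_endTest (hΓ : IsGrading n F Γ) {Φ : TestSections n F S}
    {u : PreL2 n F S} (hu : u.toSection = Φ.1) :
    ∃ w : PreL2 n F S, w.toSection = (endTest hΓ.smooth Φ).1 ∧ ‖w‖ ≤ 1 * ‖u‖ := by
  have hle : ∀ x, ‖(endTest hΓ.smooth Φ).1 x‖ ≤ 1 * ‖u.toSection x‖ := fun x => by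
    rw [endTest_apply, hΓ.norm_apply, hu, one_mul]
  exact ⟨.mk _ (mem_squareIntegrable_of_le (measurableSection_testSection _) u hle), rfl,
    PreL2.norm_le_of_forall_le zero_le_one hle⟩

/-- The grading acts on `L²` as a self-adjoint involution. No measurability of `Γ` beyond its
smoothness on test sections enters: the operator is obtained by extension from test sections, and
symmetry identifies its values on all square-integrable sections `u` for which `Γ u` is
square-integrable. -/
theorem IsGrading.exists_clm (hΓ : IsGrading n F Γ) (hL : IsEssentiallySelfAdjoint L)
    (hh : IsPotential n F h) :
    ∃ γ : L2 n F S →L[ℂ] L2 n F S, (∀ x y, inner ℂ (γ x) y = inner ℂ x (γ y)) ∧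
      (∀ x, γ (γ x) = x) ∧
      ∀ u v : PreL2 n F S, v.toSection = (fun x => Γ x (u.toSection x)) → γ u = v := by
  let f : (∀ x, S x) →ₗ[ℂ] (∀ x, S x) := LinearMap.pi fun x => Γ x ∘ₗ LinearMap.proj x
  let ρ := f.graph ⊓ (TestSections n F S).comap (LinearMap.fst ℂ (∀ x, S x) (∀ x, S x))
  have hρ : ∀ u v : PreL2 n F S, (u.toSection, v.toSection) ∈ ρ ↔
      v.toSection = (fun x => Γ x (u.toSection x)) ∧ u.toSection ∈ TestSections n F S :=
    fun u v => and_congr (LinearMap.mem_graph_iff _ _) Iff.rfl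
  have hdense := mem_closure_testSections hL hh 0
  obtain ⟨γ, hγ⟩ : ∃ γ : L2 n F S →L[ℂ] L2 n F S, ∀ u v : PreL2 n F S,
      (u.toSection, v.toSection) ∈ ρ → γ u = v := by
    refine exists_clm_of_l2Relation ρ 1 (fun x => closure_mono ?_ (hdense x)) fun u v huv => ?_
    · rintro _ ⟨Φ, u, -, hu, -, rfl⟩
      obtain ⟨w, hw, -⟩ := hΓ.exists_endTest hu
      exact ⟨u, w, (hρ _ _).2 ⟨by rw [hw, hu]; rfl, hu ▸ Φ.2⟩, rfl⟩
    · refine PreL2.norm_le_of_forall_le zero_le_one fun x => ?_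
      rw [((hρ u v).1 huv).1, hΓ.norm_apply, one_mul]
  -- the values of `γ` on test sections
  have hγt : ∀ (Φ : TestSections n F S) (u : PreL2 n F S), u.toSection = Φ.1 →
      ∃ w : PreL2 n F S, w.toSection = (fun x => Γ x (u.toSection x)) ∧ γ u = w ∧ γ w = u := by
    intro Φ u hu
    obtain ⟨w, hw, -⟩ := hΓ.exists_endTest hu
    refine ⟨w, by rw [hw, hu]; rfl, hγ u w ((hρ _ _).2 ⟨by rw [hw, hu]; rfl, hu ▸ Φ.2⟩),
      hγ w u ((hρ _ _).2 ⟨?_, hw ▸ (endTest hΓ.smooth Φ).2⟩)⟩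
    rw [hw, hu]
    funext x
    exact (hΓ.apply_apply x _).symm
  have hsq : ∀ x, γ (γ x) = x := by
    intro x
    refine closure_minimal (t := {x | γ (γ x) = x}) ?_
      (isClosed_eq (γ.continuous.comp γ.continuous) continuous_id) (hdense x)
    rintro _ ⟨Φ, u, -, hu, -, rfl⟩
    obtain ⟨w, -, hw, hw'⟩ := hγt Φ u hu
    change γ (γ u) = u
    rw [hw, hw']
  -- `Γ` is symmetric, tested against test sections on the right
  have hsymm : ∀ (u v : PreL2 n F S), v.toSection = (fun x => Γ x (u.toSection x)) →
      ∀ y, inner ℂ (v : L2 n F S) y = inner ℂ (u : L2 n F S) (γ y) := by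
    intro u v huv y
    refine closure_minimal
      (t := {y | inner ℂ (v : L2 n F S) y = inner ℂ (u : L2 n F S) (γ y)}) ?_
      (isClosed_eq (continuous_const.inner continuous_id)
        (continuous_const.inner γ.continuous)) (hdense y)
    rintro _ ⟨Φ, z, -, hz, -, rfl⟩
    obtain ⟨w, hw, hw', -⟩ := hγt Φ z hz
    change inner ℂ (v : L2 n F S) z = inner ℂ (u : L2 n F S) (γ z)
    rw [hw', UniformSpace.Completion.inner_coe, UniformSpace.Completion.inner_coe,
      PreL2.inner_def, PreL2.inner_def, huv, hw]
    exact integral_congr_ae (Filter.Eventually.of_forall fun x => hΓ.symmetric x _ _)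
  have hγs : ∀ x y, inner ℂ (γ x) y = inner ℂ x (γ y) := by
    intro x y
    refine closure_minimal (t := {x | inner ℂ (γ x) y = inner ℂ x (γ y)}) ?_
      (isClosed_eq (γ.continuous.inner continuous_const)
        (continuous_id.inner continuous_const)) (hdense x)
    rintro _ ⟨Φ, u, -, hu, -, rfl⟩
    obtain ⟨w, hw, hw', -⟩ := hγt Φ u hu
    change inner ℂ (γ u) y = inner ℂ (u : L2 n F S) (γ y)
    rw [hw', hsymm u w hw]
  refine ⟨γ, hγs, hsq, fun u v huv => ?_⟩
  refine ext_inner_right ℂ fun y => ?_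
  rw [hγs, hsymm u v huv]

/-- The summands `L²(Z; S_±)` are the eigenspaces of the grading operator. -/
theorem mem_gradedPart_iff (hΓ : IsGrading n F Γ) (hL : IsEssentiallySelfAdjoint L)
    (hh : IsPotential n F h) {γ : L2 n F S →L[ℂ] L2 n F S} (hsq : ∀ x, γ (γ x) = x)
    (hγ : ∀ u v : PreL2 n F S, v.toSection = (fun x => Γ x (u.toSection x)) → γ u = v)
    (s : ℂ) (x : L2 n F S) : x ∈ gradedPart n F Γ s ↔ γ x = s • x := by
  have hmem : ∀ u : PreL2 n F S, u ∈ ((LinearMap.pi fun x => (Γ x - s • 1) ∘ₗ LinearMap.proj x ∘ₗ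
      PreL2.toSection (n := n) (F := F) (S := S)).ker) ↔
        ∀ x, Γ x (u.toSection x) = s • u.toSection x := by
    intro u
    rw [LinearMap.mem_ker, funext_iff]
    refine forall_congr' fun x => ?_
    rw [← sub_eq_zero (a := Γ x _)]
    exact Iff.rfl
  constructor
  · intro hx
    refine closure_minimal (t := {x | γ x = s • x}) ?_
      (isClosed_eq γ.continuous (continuous_const_smul s)) hx
    rintro _ ⟨u, hu, rfl⟩
    have hu' : γ u = ((s • u : PreL2 n F S) : L2 n F S) := by
      refine hγ u _ ?_
      rw [map_smul]
      exact (funext ((hmem u).1 hu)).symm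
    rw [UniformSpace.Completion.coe_smul] at hu'
    exact hu'
  · intro hx
    have h1 : x = s • s • x := by
      conv_lhs => rw [← hsq x, hx, map_smul, hx]
    by_cases hs : s * s = 1
    · -- `x` is a fixed point of the projection `(1 + s γ) / 2`, which maps test sections to
      -- sections of the eigenbundle
      have hx' : (2⁻¹ : ℂ) • (x + s • γ x) = x := by
        rw [hx, ← h1]
        module
      rw [← hx']
      have hc : Continuous fun x : L2 n F S => (2⁻¹ : ℂ) • (x + s • γ x) :=
        (continuous_id.add (γ.continuous.const_smul s)).const_smul (2⁻¹ : ℂ)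
      refine map_mem_closure (f := fun x : L2 n F S => (2⁻¹ : ℂ) • (x + s • γ x)) hc
        (mem_closure_testSections hL hh 0 x) ?_
      rintro _ ⟨Φ, u, -, hu, -, rfl⟩
      obtain ⟨w, hw, -⟩ := hΓ.exists_endTest hu
      have hγu : γ u = w := hγ u w (by rw [hw, hu]; rfl)
      refine ⟨(2⁻¹ : ℂ) • (u + s • w), (hmem _).2 fun x => ?_, ?_⟩
      · rw [map_smul, map_add, map_smul, hu, hw]
        change Γ x ((2⁻¹ : ℂ) • (Φ.1 x + s • Γ x (Φ.1 x))) =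
          s • (2⁻¹ : ℂ) • (Φ.1 x + s • Γ x (Φ.1 x))
        rw [map_smul, map_add, map_smul, hΓ.apply_apply, smul_comm s, smul_add s, smul_smul s s, hs,
          one_smul, add_comm]
      · change (((2⁻¹ : ℂ) • (u + s • w) : PreL2 n F S) : L2 n F S) = _
        beta_reduce
        rw [hγu, UniformSpace.Completion.coe_smul, UniformSpace.Completion.coe_add,
          UniformSpace.Completion.coe_smul]
    · have hx0 : x = 0 := by
        rw [smul_smul] at h1
        have h2 : (1 - s * s) • x = 0 := by rw [sub_smul, one_smul, ← h1, sub_self]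
        exact (smul_eq_zero.1 h2).resolve_left fun h => hs (sub_eq_zero.1 h).symm
      rw [hx0]
      exact Submodule.zero_mem _

/-- The closure of an odd operator anticommutes with the grading. -/
theorem mem_graph_closureOp_of_isOdd (hΓ : IsGrading n F Γ) (hL : IsEssentiallySelfAdjoint L)
    (hh : IsPotential n F h) (hLo : IsOddOp L Γ) (hho : IsOddEnd h Γ) (m : ℝ)
    (hmeas : ∀ Φ, MeasurableSection n F (withPotential L h m Φ))
    {γ : L2 n F S →L[ℂ] L2 n F S}
    (hγ : ∀ u v : PreL2 n F S, v.toSection = (fun x => Γ x (u.toSection x)) → γ u = v)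
    {x y : L2 n F S} (hxy : (x, y) ∈ (closureOp (withPotential L h m)).graph) :
    (γ x, -γ y) ∈ (closureOp (withPotential L h m)).graph := by
  rw [graph_closureOp_withPotential hL hh] at hxy ⊢
  have hc : Continuous fun p : L2 n F S × L2 n F S => (γ p.1, -γ p.2) :=
    (γ.continuous.comp continuous_fst).prodMk (γ.continuous.comp continuous_snd).neg
  suffices hst : Set.MapsTo (fun p : L2 n F S × L2 n F S => (γ p.1, -γ p.2))
      (opGraph (withPotential L h m)) (opGraph (withPotential L h m)) by
    have := map_mem_closure hc hxy hst
    exact this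
  rintro _ ⟨Φ, u, v, hu, hv, rfl⟩
  obtain ⟨w, hw, -⟩ := hΓ.exists_endTest hu
  have hz : withPotential L h m (endTest hΓ.smooth Φ) ∈ squareIntegrable n F S :=
    mem_squareIntegrable_of_le (c := 1) (hmeas _) v fun x => by
      rw [withPotential_endTest hΓ hLo hho, norm_neg, hΓ.norm_apply, hv, one_mul]
  refine ⟨endTest hΓ.smooth Φ, w, .mk _ hz, hw, rfl, ?_⟩
  have h1 : γ u = w := hγ u w (by rw [hw, hu]; rfl)
  have h2 : γ v = ((-PreL2.mk _ hz : PreL2 n F S) : L2 n F S) := by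
    refine hγ v _ ?_
    rw [map_neg, PreL2.toSection_mk, hv]
    funext x
    rw [Pi.neg_apply, withPotential_endTest hΓ hLo hho, neg_neg]
  beta_reduce
  rw [h1, h2, UniformSpace.Completion.coe_neg, neg_neg]

end Grading

/-! ### Transfer operators -/

section ClosedGraph

variable {H : Type*} [NormedAddCommGroup H] [InnerProductSpace ℂ H]
  {H' : Type*} [NormedAddCommGroup H'] [InnerProductSpace ℂ H'] [CompleteSpace H']

/-- A graph-norm bound for `A' ∘ W` extends from a core to the closure. -/
theorem exists_graph_of_mem_closure {A' : H' →ₗ.[ℂ] H'} (hA' : A'.IsClosed) (W : H →L[ℂ] H')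
    (g : Submodule ℂ (H × H)) {a b : ℝ}
    (hg : ∀ p ∈ g, ∃ z, (W p.1, z) ∈ A'.graph ∧ ‖z‖ ≤ a * ‖p.2‖ + b * ‖p.1‖) {p : H × H}
    (hp : p ∈ g.topologicalClosure) :
    ∃ z, (W p.1, z) ∈ A'.graph ∧ ‖z‖ ≤ a * ‖p.2‖ + b * ‖p.1‖ := by
  obtain ⟨q, hq, hqp⟩ := mem_closure_iff_seq_limit.1 hp
  choose z hz hzb using fun k => hg (q k) (hq k)
  have hdiff : ∀ k l, ‖z k - z l‖ ≤ a * ‖(q k - q l).2‖ + b * ‖(q k - q l).1‖ := by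
    intro k l
    obtain ⟨y, hy, hyb⟩ := hg _ (g.sub_mem (hq k) (hq l))
    have h1 : (W (q k - q l).1, z k - z l) ∈ A'.graph := by
      have := A'.graph.sub_mem (hz k) (hz l)
      rwa [Prod.mk_sub_mk, ← map_sub] at this
    rwa [A'.mem_graph_snd_inj h1 hy rfl]
  have hcq : CauchySeq q := hqp.cauchySeq
  have hcz : CauchySeq z := by
    rw [cauchySeq_iff_tendsto_dist_atTop_0] at hcq ⊢
    refine squeeze_zero (g := fun n : ℕ × ℕ => (|a| + |b|) * dist (q n.1) (q n.2))
      (fun _ => dist_nonneg) (fun n => ?_) (by simpa using hcq.const_mul (|a| + |b|))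
    rw [dist_eq_norm, dist_eq_norm, add_mul]
    refine (hdiff _ _).trans (add_le_add ?_ ?_)
    · exact mul_le_mul (le_abs_self a) (norm_snd_le _) (norm_nonneg _) (abs_nonneg _)
    · exact mul_le_mul (le_abs_self b) (norm_fst_le _) (norm_nonneg _) (abs_nonneg _)
  obtain ⟨y, hy⟩ := cauchySeq_tendsto_of_complete hcz
  have hq1 := (continuous_fst.tendsto p).comp hqp
  have hq2 := (continuous_snd.tendsto p).comp hqp
  refine ⟨y, ?_, ?_⟩
  · exact _root_.IsClosed.mem_of_tendsto hA' (((W.continuous.tendsto _).comp hq1).prodMk_nhds hy)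
      (Filter.Eventually.of_forall hz)
  · exact le_of_tendsto_of_tendsto' hy.norm
      ((hq2.norm.const_mul a).add (hq1.norm.const_mul b)) hzb

/-- Almost adjointness extends from cores to the closures. -/
theorem almostAdjoint_of_core {A : H →ₗ.[ℂ] H} {A' : H' →ₗ.[ℂ] H'} {g : Submodule ℂ (H × H)}
    {g' : Submodule ℂ (H' × H')} (hg : A.graph = g.topologicalClosure)
    (hg' : A'.graph = g'.topologicalClosure) {K m : ℝ} {W : H →L[ℂ] H'} {W' : H' →L[ℂ] H}
    (h : ∀ p ∈ g, ∀ p' ∈ g', ‖inner ℂ (W' p'.1) p.1 - inner ℂ p'.1 (W p.1)‖ ≤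
      ‖p'.1‖ * ((‖p.2‖ + K * ‖p.1‖) / m) + (‖p'.2‖ + K * ‖p'.1‖) / m * ‖p.1‖) :
    AlmostAdjoint A A' K m W W' := by
  intro x y x' y' hxy hxy'
  rw [hg] at hxy
  rw [hg'] at hxy'
  have hmem : ((x, y), (x', y')) ∈ closure ((g : Set (H × H)) ×ˢ (g' : Set (H' × H'))) := by
    rw [closure_prod_eq]
    exact ⟨hxy, hxy'⟩
  refine closure_minimal (t := {q : (H × H) × (H' × H') |
    ‖inner ℂ (W' q.2.1) q.1.1 - inner ℂ q.2.1 (W q.1.1)‖ ≤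
      ‖q.2.1‖ * ((‖q.1.2‖ + K * ‖q.1.1‖) / m) + (‖q.2.2‖ + K * ‖q.2.1‖) / m * ‖q.1.1‖})
    (fun q hq => h _ hq.1 _ hq.2) ?_ hmem
  simp only [div_eq_mul_inv]
  exact isClosed_le (by fun_prop) (by fun_prop)

end ClosedGraph

section TransferOperator

variable {n : ℕ} {Z : Type*} [TopologicalSpace Z] [ChartedSpace (EuclideanSpace ℝ (Fin n)) Z]
  [SecondCountableTopology Z]
  [RiemannianBundle (fun x : Z => TangentSpace (𝓡 n) x)] [MeasurableSpace Z] [BorelSpace Z]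
  [IsManifold (𝓡 n) ∞ Z] [IsContMDiffRiemannianBundle (𝓡 n) ∞ (EuclideanSpace ℝ (Fin n))
      (fun x : Z => TangentSpace (𝓡 n) x)] [T2Space Z]
  {F : Type*} [NormedAddCommGroup F] [NormedSpace ℂ F] [FiniteDimensional ℂ F]
  {S : Z → Type*} [TopologicalSpace (TotalSpace F S)]
  [∀ x, NormedAddCommGroup (S x)] [∀ x, InnerProductSpace ℂ (S x)] [FiberBundle F S]
  [VectorBundle ℂ F S] [VectorBundle ℝ F S] [IsContMDiffRiemannianBundle (𝓡 n) ∞ F S]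
  {n' : ℕ} {Z' : Type*} [TopologicalSpace Z'] [ChartedSpace (EuclideanSpace ℝ (Fin n')) Z']
  [SecondCountableTopology Z']
  [RiemannianBundle (fun x : Z' => TangentSpace (𝓡 n') x)] [MeasurableSpace Z'] [BorelSpace Z']
  [IsManifold (𝓡 n') ∞ Z'] [IsContMDiffRiemannianBundle (𝓡 n') ∞ (EuclideanSpace ℝ (Fin n'))
      (fun x : Z' => TangentSpace (𝓡 n') x)] [T2Space Z']
  {F' : Type*} [NormedAddCommGroup F'] [NormedSpace ℂ F'] [FiniteDimensional ℂ F']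
  {S' : Z' → Type*} [TopologicalSpace (TotalSpace F' S')]
  [∀ x, NormedAddCommGroup (S' x)] [∀ x, InnerProductSpace ℂ (S' x)] [FiberBundle F' S']
  [VectorBundle ℂ F' S'] [VectorBundle ℝ F' S'] [IsContMDiffRiemannianBundle (𝓡 n') ∞ F' S']

/-- A linear relation `R` between sections that is isometric for the `L²` norms, and under which
every test section supported in `U` has a partner; the operators `P` and `P'` correspond to each
other. -/
structure IsTransplantation (R : Submodule ℂ ((∀ x, S x) × (∀ x, S' x))) (U : Set Z)
    (P : TestSections n F S →ₗ[ℂ] (∀ x, S x)) (P' : TestSections n' F' S' →ₗ[ℂ] (∀ x, S' x)) :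
    Prop where
  norm_eq : ∀ (u : PreL2 n F S) (u' : PreL2 n' F' S'), (u.toSection, u'.toSection) ∈ R → ‖u'‖ = ‖u‖
  exists_push : ∀ (Φ : TestSections n F S) (u v : PreL2 n F S), SupportedIn Φ U →
    u.toSection = Φ.1 → v.toSection = P Φ →
      ∃ (Φ' : TestSections n' F' S') (u' v' : PreL2 n' F' S'), u'.toSection = Φ'.1 ∧
        v'.toSection = P' Φ' ∧ (Φ.1, Φ'.1) ∈ R ∧ ‖v'‖ = ‖v‖

namespace CalliasData

variable {U₀ U₁ : Set Z} {η : Z → ℝ} {σ : SymbolField n S} {K m : ℝ}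
  {L : TestSections n F S →ₗ[ℂ] TestSections n F S} {h : ∀ x, Module.End ℂ (S x)}
  (D : CalliasData U₀ U₁ η σ K L h)
  {U₀' U₁' : Set Z'} {η' : Z' → ℝ} {σ' : SymbolField n' S'}
  {L' : TestSections n' F' S' →ₗ[ℂ] TestSections n' F' S'} {h' : ∀ x, Module.End ℂ (S' x)}
  (D' : CalliasData U₀' U₁' η' σ' K L' h')

/-- The inner and outer parts of a test section in the `L²` sense, with the bounds that result from
coercivity. -/
theorem exists_parts (hm : 0 < m) {Φ : TestSections n F S} {u v : PreL2 n F S}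
    (hu : u.toSection = Φ.1) (hv : v.toSection = withPotential L h m Φ) :
    ∃ u₀ v₀ : PreL2 n F S, u₀.toSection = (D.inner₀ Φ).1 ∧
      v₀.toSection = withPotential L h m (D.inner₀ Φ) ∧ ‖u₀‖ ≤ ‖u‖ ∧
      ‖u - u₀‖ ≤ (‖v‖ + K * ‖u‖) / m ∧ ‖v₀‖ ≤ ‖v‖ + 2 * K * ((‖v‖ + K * ‖u‖) / m) := by
  obtain ⟨w, z, hw, hz, hzb⟩ := D.exists_outer hu hv
  have hwb : ‖w‖ ≤ (‖v‖ + K * ‖u‖) / m := by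
    rw [le_div_iff₀ hm, mul_comm]
    exact (D.mul_norm_le (D.supportedIn_outer Φ) hw hz).trans hzb
  obtain ⟨u₀, v₀, hu₀, hv₀, h1, h2, h3⟩ := D.exists_inner₀ hu hv hw
  refine ⟨u₀, v₀, hu₀, hv₀, h1, h2.trans hwb, h3.trans ?_⟩
  have := D.nonneg
  gcongr

variable {R : Submodule ℂ ((∀ x, S x) × (∀ x, S' x))}

include D' in
/-- The operator that cuts a section off to `U₀` and transplants it. -/
theorem exists_transfer (hm : 0 < m)
    (hR : IsTransplantation R U₀ (withPotential L h m) (withPotential L' h' m)) :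
    ∃ W : L2 n F S →L[ℂ] L2 n' F' S',
      IsTransfer (closureOp (withPotential L h m)) (closureOp (withPotential L' h' m)) K m W ∧
      ∀ (Φ : TestSections n F S) (u v : PreL2 n F S) (u' : PreL2 n' F' S'), u.toSection = Φ.1 →
        v.toSection = withPotential L h m Φ → ((D.inner₀ Φ).1, u'.toSection) ∈ R → W u = u' := by
  have hK := D.nonneg
  let c : (∀ x, S x) →ₗ[ℂ] (∀ x, S x) :=
    LinearMap.pi fun x => ((1 - (1 - η x) ^ 2 : ℝ) : ℂ) • LinearMap.proj x
  have hc : ∀ Φ : TestSections n F S, c Φ.1 = (D.inner₀ Φ).1 := fun Φ =>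
    funext fun x => (D.inner₀_apply Φ x).symm
  -- the relation between `Φ` and the partner of `χ Φ`
  let ρ : Submodule ℂ ((∀ x, S x) × (∀ x, S' x)) :=
    R.comap (c.prodMap LinearMap.id) ⊓ (TestSections n F S).comap (LinearMap.fst ℂ _ _)
  have hρ : ∀ (Φ : TestSections n F S) (u : PreL2 n F S) (u' : PreL2 n' F' S'),
      u.toSection = Φ.1 → ((D.inner₀ Φ).1, u'.toSection) ∈ R →
        (u.toSection, u'.toSection) ∈ ρ := by
    intro Φ u u' hu hu'
    rw [hu]
    refine ⟨?_, Φ.2⟩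
    rw [← hc] at hu'
    exact hu'
  have hpush : ∀ (Φ : TestSections n F S) (u v : PreL2 n F S), u.toSection = Φ.1 →
      v.toSection = withPotential L h m Φ →
      ∃ (Φ' : TestSections n' F' S') (u' v' : PreL2 n' F' S'), u'.toSection = Φ'.1 ∧
        v'.toSection = withPotential L' h' m Φ' ∧ (u.toSection, u'.toSection) ∈ ρ ∧
        ‖u‖ - (‖v‖ + K * ‖u‖) / m ≤ ‖u'‖ ∧ ‖v'‖ ≤ ‖v‖ + 2 * K * ((‖v‖ + K * ‖u‖) / m) := by
    intro Φ u v hu hv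
    obtain ⟨u₀, v₀, hu₀, hv₀, -, h2, h3⟩ := D.exists_parts hm hu hv
    obtain ⟨Φ', u', v', hu', hv', hΦ', h4⟩ :=
      hR.exists_push _ u₀ v₀ (D.supportedIn_inner₀ Φ) hu₀ hv₀
    refine ⟨Φ', u', v', hu', hv', hρ Φ u u' hu (by rwa [hu']), ?_, h4.trans_le h3⟩
    rw [hR.norm_eq u₀ u' (by rwa [hu₀, hu'])]
    have := norm_le_insert u₀ u
    rw [norm_sub_rev] at this
    linarith
  obtain ⟨W, hW⟩ : ∃ W : L2 n F S →L[ℂ] L2 n' F' S', ∀ (u : PreL2 n F S) (v : PreL2 n' F' S'),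
      (u.toSection, v.toSection) ∈ ρ → W u = v := by
    refine exists_clm_of_l2Relation ρ 1 (fun x => closure_mono ?_
      (mem_closure_testSections D.selfAdjoint D.potential m x)) fun u u' huu' => ?_
    · rintro _ ⟨Φ, u, v, hu, hv, rfl⟩
      obtain ⟨Φ', u', v', -, -, huu', -⟩ := hpush Φ u v hu hv
      exact ⟨u, u', huu', rfl⟩
    · obtain ⟨h1, hΦ⟩ := huu'
      have hle : ∀ x, ‖(D.inner₀ ⟨u.toSection, hΦ⟩).1 x‖ ≤ 1 * ‖u.toSection x‖ := fun x => by
        have h2 := D.one_sub_mem_Icc x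
        rw [inner₀_apply, norm_smul, Complex.norm_real, Real.norm_of_nonneg (by nlinarith)]
        exact mul_le_mul_of_nonneg_right (by nlinarith) (norm_nonneg _)
      let u₀ : PreL2 n F S :=
        .mk _ (mem_squareIntegrable_of_le (measurableSection_testSection _) u hle)
      have h2 : (u₀.toSection, u'.toSection) ∈ R := by
        rw [PreL2.toSection_mk, ← hc]
        exact h1
      rw [hR.norm_eq u₀ u' h2]
      exact PreL2.norm_le_of_forall_le zero_le_one hle
  refine ⟨W, ⟨fun x y hxy => ?_, fun x y hxy => ?_⟩, fun Φ u v u' hu _ hu' =>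
    hW u u' (hρ Φ u u' hu hu')⟩
  · rw [graph_closureOp_withPotential D.selfAdjoint D.potential] at hxy
    refine closure_minimal
      (t := {p : L2 n F S × L2 n F S | ‖p.1‖ - (‖p.2‖ + K * ‖p.1‖) / m ≤ ‖W p.1‖}) ?_ ?_ hxy
    · rintro _ ⟨Φ, u, v, hu, hv, rfl⟩
      obtain ⟨Φ', u', v', -, -, huu', h1, -⟩ := hpush Φ u v hu hv
      change ‖(u : L2 n F S)‖ - (‖(v : L2 n F S)‖ + K * ‖(u : L2 n F S)‖) / m ≤ ‖W u‖
      rw [hW u u' huu']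
      simpa only [UniformSpace.Completion.norm_coe] using h1
    · have h1 : Continuous fun p : L2 n F S × L2 n F S => ‖p.1‖ := continuous_fst.norm
      have h2 : Continuous fun p : L2 n F S × L2 n F S => ‖p.2‖ := continuous_snd.norm
      exact isClosed_le (h1.sub ((h2.add (continuous_const.mul h1)).div_const m))
        (W.continuous.comp continuous_fst).norm
  · rw [graph_closureOp_withPotential D.selfAdjoint D.potential] at hxy
    have hb : ∀ s t : ℝ, s + 2 * K * ((s + K * t) / m) =
        (1 + 2 * K / m) * s + (2 * K * K / m) * t := fun s t => by ring
    rw [hb]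
    refine exists_graph_of_mem_closure
      (isSelfAdjoint_closureOp_withPotential D'.selfAdjoint D'.potential m).isClosed W _ ?_ hxy
    rintro _ ⟨Φ, u, v, hu, hv, rfl⟩
    obtain ⟨Φ', u', v', hu', hv', huu', -, h1⟩ := hpush Φ u v hu hv
    refine ⟨v', ?_, ?_⟩
    · rw [graph_closureOp_withPotential D'.selfAdjoint D'.potential, hW u u' huu']
      exact Submodule.le_topologicalClosure _ ⟨Φ', u', v', hu', hv', rfl⟩
    · rw [← hb]
      simpa only [UniformSpace.Completion.norm_coe] using h1

end CalliasData

end TransferOperator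

/-! ### Transplantation as a relation between sections -/

section Excision

variable {n : ℕ} {Z : Type*} [TopologicalSpace Z] [ChartedSpace (EuclideanSpace ℝ (Fin n)) Z]
  [SecondCountableTopology Z]
  [RiemannianBundle (fun x : Z => TangentSpace (𝓡 n) x)] [MeasurableSpace Z] [BorelSpace Z]
  [IsManifold (𝓡 n) ∞ Z] [IsContMDiffRiemannianBundle (𝓡 n) ∞ (EuclideanSpace ℝ (Fin n))
      (fun x : Z => TangentSpace (𝓡 n) x)] [T2Space Z]
  {F : Type*} [NormedAddCommGroup F] [NormedSpace ℂ F] [FiniteDimensional ℂ F]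
  {S : Z → Type*} [TopologicalSpace (TotalSpace F S)]
  [∀ x, NormedAddCommGroup (S x)] [∀ x, InnerProductSpace ℂ (S x)] [FiberBundle F S]
  [VectorBundle ℂ F S] [VectorBundle ℝ F S] [ContMDiffVectorBundle ∞ F S (𝓡 n)]
  [IsContMDiffRiemannianBundle (𝓡 n) ∞ F S]
  {n' : ℕ} {Z' : Type*} [TopologicalSpace Z'] [ChartedSpace (EuclideanSpace ℝ (Fin n')) Z']
  [SecondCountableTopology Z']
  [RiemannianBundle (fun x : Z' => TangentSpace (𝓡 n') x)] [MeasurableSpace Z'] [BorelSpace Z']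
  [IsManifold (𝓡 n') ∞ Z'] [IsContMDiffRiemannianBundle (𝓡 n') ∞ (EuclideanSpace ℝ (Fin n'))
      (fun x : Z' => TangentSpace (𝓡 n') x)] [T2Space Z']
  {F' : Type*} [NormedAddCommGroup F'] [NormedSpace ℂ F'] [FiniteDimensional ℂ F']
  {S' : Z' → Type*} [TopologicalSpace (TotalSpace F' S')]
  [∀ x, NormedAddCommGroup (S' x)] [∀ x, InnerProductSpace ℂ (S' x)] [FiberBundle F' S']
  [VectorBundle ℂ F' S'] [VectorBundle ℝ F' S'] [ContMDiffVectorBundle ∞ F' S' (𝓡 n')]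
  [IsContMDiffRiemannianBundle (𝓡 n') ∞ F' S']
  {U₀ U₁ : Set Z} {η : Z → ℝ} {σ : SymbolField n S} {K m : ℝ}
  {L : TestSections n F S →ₗ[ℂ] TestSections n F S} {h : ∀ x, Module.End ℂ (S x)}
  {U₀' U₁' : Set Z'} {η' : Z' → ℝ} {σ' : SymbolField n' S'}
  {L' : TestSections n' F' S' →ₗ[ℂ] TestSections n' F' S'} {h' : ∀ x, Module.End ℂ (S' x)}

namespace BundleIsometry

/-- The relation between sections over `U` and `U'`, extended by zero, that correspond to each
other under the bundle isometry. -/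
def relation {U : Set Z} {U' : Set Z'} (T : BundleIsometry n F S n' F' S' U U') :
    Submodule ℂ ((∀ x, S x) × (∀ x, S' x)) where
  carrier := {p | (∀ x ∉ U, p.1 x = 0) ∧ (∀ y ∉ U', p.2 y = 0) ∧
    ∀ x ∈ U, p.2 (T.τ x) = T.lift x (p.1 x)}
  zero_mem' := ⟨fun _ _ => rfl, fun _ _ => rfl, fun x _ => (map_zero (T.lift x)).symm⟩
  add_mem' := fun {p q} hp hq => ⟨fun x hx => by simp [hp.1 x hx, hq.1 x hx],
    fun y hy => by simp [hp.2.1 y hy, hq.2.1 y hy],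
    fun x hx => by simp [hp.2.2 x hx, hq.2.2 x hx]⟩
  smul_mem' := fun a p hp => ⟨fun x hx => by simp [hp.1 x hx], fun y hy => by simp [hp.2.1 y hy],
    fun x hx => by simp [hp.2.2 x hx]⟩

variable {T : BundleIsometry n F S n' F' S' U₀ U₀'}

theorem mk_mem_relation {s : ∀ x, S x} {s' : ∀ x, S' x} : (s, s') ∈ T.relation ↔
    (∀ x ∉ U₀, s x = 0) ∧ (∀ y ∉ U₀', s' y = 0) ∧ ∀ x ∈ U₀, s' (T.τ x) = T.lift x (s x) := Iff.rfl

theorem correspondsAE_of_mem {p : (∀ x, S x) × (∀ x, S' x)} (hp : p ∈ T.relation) :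
    T.CorrespondsAE p.1 p.2 :=
  ⟨hp.1, hp.2.1, Filter.Eventually.of_forall hp.2.2⟩

theorem _root_.Excision.Corresponds.mem_relation {Φ : TestSections n F S}
    {Φ' : TestSections n' F' S'} (h : Corresponds T Φ Φ') : (Φ.1, Φ'.1) ∈ T.relation :=
  ⟨h.correspondsAE.eq_zero, h.correspondsAE.eq_zero', h.apply_eq⟩

/-- Intertwined operators map corresponding test sections to corresponding sections. -/
theorem correspondsAE_withPotential (hL : HasSymbol L σ) (hL' : HasSymbol L' σ')
    (hT : T.Intertwines (withPotential L h m) (withPotential L' h' m)) {Φ : TestSections n F S}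
    {Φ' : TestSections n' F' S'} (hΦ : Corresponds T Φ Φ') :
    T.CorrespondsAE (withPotential L h m Φ) (withPotential L' h' m Φ') where
  eq_zero x hx := by
    obtain ⟨C, hC, hCU, hΦC⟩ := hΦ.supportedIn
    exact withPotential_apply_eq_zero_of_notMem hL h m hC hΦC fun h => hx (hCU h)
  eq_zero' y hy := by
    obtain ⟨C, hC, hCU, hΦC⟩ := hΦ.supportedIn'
    exact withPotential_apply_eq_zero_of_notMem hL' h' m hC hΦC fun h => hy (hCU h)
  apply_eq := hT Φ Φ' hΦ.supportedIn hΦ.supportedIn' hΦ.apply_eq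

variable (D : CalliasData U₀ U₁ η σ K L h) (D' : CalliasData U₀' U₁' η' σ' K L' h')
  (hT : T.Intertwines (withPotential L h m) (withPotential L' h' m))

include D D' hT

theorem isTransplantation :
    IsTransplantation T.relation U₀ (withPotential L h m) (withPotential L' h' m) where
  norm_eq u u' huu' := (correspondsAE_of_mem huu').norm_eq
  exists_push Φ u v hΦ hu hv := by
    obtain ⟨Φ', hΦ'⟩ := T.exists_push Φ hΦ
    have h1 := hΦ'.correspondsAE
    have h2 := correspondsAE_withPotential D.hasSymbol D'.hasSymbol hT hΦ'
    have hu' : Φ'.1 ∈ squareIntegrable n' F' S' := (h1.mem_squareIntegrable_iff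
      (measurableSection_testSection _) (measurableSection_testSection _)).2 (hu ▸ u.toSection_mem)
    have hv' : withPotential L' h' m Φ' ∈ squareIntegrable n' F' S' :=
      (h2.mem_squareIntegrable_iff (D.measurableSection_withPotential m Φ)
        (D'.measurableSection_withPotential m Φ')).2 (hv ▸ v.toSection_mem)
    refine ⟨Φ', .mk _ hu', .mk _ hv', rfl, rfl, hΦ'.mem_relation, ?_⟩
    exact CorrespondsAE.norm_eq (T := T) (by rwa [hv])

theorem isTransplantation_symm :
    IsTransplantation (T.relation.comap (LinearEquiv.prodComm ℂ (∀ x, S' x) (∀ x, S x)).toLinearMap)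
      U₀' (withPotential L' h' m) (withPotential L h m) where
  norm_eq u' u huu' := (CorrespondsAE.norm_eq (correspondsAE_of_mem huu')).symm
  exists_push Φ' u' v' hΦ' hu' hv' := by
    obtain ⟨Φ, hΦ⟩ := T.exists_pull Φ' hΦ'
    have h1 := hΦ.correspondsAE
    have h2 := correspondsAE_withPotential D.hasSymbol D'.hasSymbol hT hΦ
    have hu : Φ.1 ∈ squareIntegrable n F S := (h1.mem_squareIntegrable_iff
      (measurableSection_testSection _) (measurableSection_testSection _)).1 (hu' ▸ u'.toSection_mem)
    have hv : withPotential L h m Φ ∈ squareIntegrable n F S :=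
      (h2.mem_squareIntegrable_iff (D.measurableSection_withPotential m Φ)
        (D'.measurableSection_withPotential m Φ')).1 (hv' ▸ v'.toSection_mem)
    refine ⟨Φ, .mk _ hu, .mk _ hv, rfl, rfl, hΦ.mem_relation, ?_⟩
    exact (CorrespondsAE.norm_eq (T := T) (by rwa [hv'])).symm

/-- The operators that cut off and transplant in the two directions are almost adjoint. -/
theorem almostAdjoint (hm : 0 < m) {W : L2 n F S →L[ℂ] L2 n' F' S'}
    {W' : L2 n' F' S' →L[ℂ] L2 n F S}
    (hW : ∀ (Φ : TestSections n F S) (u v : PreL2 n F S) (u' : PreL2 n' F' S'),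
      u.toSection = Φ.1 → v.toSection = withPotential L h m Φ →
        ((D.inner₀ Φ).1, u'.toSection) ∈ T.relation → W u = u')
    (hW' : ∀ (Φ' : TestSections n' F' S') (u' v' : PreL2 n' F' S') (u : PreL2 n F S),
      u'.toSection = Φ'.1 → v'.toSection = withPotential L' h' m Φ' →
        (u.toSection, (D'.inner₀ Φ').1) ∈ T.relation → W' u' = u) :
    AlmostAdjoint (closureOp (withPotential L h m)) (closureOp (withPotential L' h' m)) K m W W' := by
  refine almostAdjoint_of_core (graph_closureOp_withPotential D.selfAdjoint D.potential m)
    (graph_closureOp_withPotential D'.selfAdjoint D'.potential m) ?_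
  rintro _ ⟨Φ, u, v, hu, hv, rfl⟩ _ ⟨Φ', u', v', hu', hv', rfl⟩
  obtain ⟨u₀, v₀, hu₀, hv₀, hn, hb, -⟩ := D.exists_parts hm hu hv
  obtain ⟨u₀', v₀', hu₀', hv₀', hn', hb', -⟩ := D'.exists_parts hm hu' hv'
  obtain ⟨Ψ', w', -, hw', -, hR', -⟩ := (isTransplantation D D' hT).exists_push _ u₀ v₀
    (D.supportedIn_inner₀ Φ) hu₀ hv₀
  obtain ⟨Ψ, w, -, hw, -, hR, -⟩ := (isTransplantation_symm D D' hT).exists_push _ u₀' v₀'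
    (D'.supportedIn_inner₀ Φ') hu₀' hv₀'
  have hR₁ : (u₀.toSection, w'.toSection) ∈ T.relation := by rwa [hu₀, hw']
  have hR₂ : (w.toSection, u₀'.toSection) ∈ T.relation := by
    rw [hw, hu₀']
    exact hR
  have h1 : W u = w' := hW Φ u v w' hu hv (by rwa [hw'])
  have h2 : W' u' = w := hW' Φ' u' v' w hu' hv' (by rwa [← hu₀'])
  have h3 : inner ℂ u₀' w' = inner ℂ w u₀ :=
    CorrespondsAE.inner_eq (correspondsAE_of_mem hR₂) (correspondsAE_of_mem hR₁)
  have h4 : ‖w‖ ≤ ‖u'‖ := by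
    rwa [← CorrespondsAE.norm_eq (correspondsAE_of_mem hR₂)]
  have h5 : ‖w'‖ ≤ ‖u‖ := by
    rw [CorrespondsAE.norm_eq (correspondsAE_of_mem hR₁)]
    exact hn
  simp only [h1, h2, UniformSpace.Completion.inner_coe, UniformSpace.Completion.norm_coe]
  -- the inner parts contribute equally, so that only the outer parts remain
  have h6 : inner ℂ w u - inner ℂ u' w' = inner ℂ w (u - u₀) - inner ℂ (u' - u₀') w' := by
    rw [inner_sub_right, inner_sub_left, h3]
    ring
  rw [h6]
  refine (norm_sub_le _ _).trans (add_le_add ?_ ?_)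
  · refine (norm_inner_le_norm _ _).trans (mul_le_mul h4 hb (norm_nonneg _) (norm_nonneg _))
  · refine (norm_inner_le_norm _ _).trans (mul_le_mul hb' h5 (norm_nonneg _) ?_)
    exact (norm_nonneg _).trans hb'

/-- The cut-off and transplantation commutes with the gradings. -/
theorem transfer_grading (hm : 0 < m) {W : L2 n F S →L[ℂ] L2 n' F' S'}
    (hW : ∀ (Φ : TestSections n F S) (u v : PreL2 n F S) (u' : PreL2 n' F' S'),
      u.toSection = Φ.1 → v.toSection = withPotential L h m Φ →
        ((D.inner₀ Φ).1, u'.toSection) ∈ T.relation → W u = u')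
    {Γ : ∀ x, Module.End ℂ (S x)} {Γ' : ∀ x, Module.End ℂ (S' x)} (hΓ : IsGrading n F Γ)
    (hΓ' : IsGrading n' F' Γ') (hL : IsOddOp L Γ) (hh : IsOddEnd h Γ) (hTΓ : T.IsEven Γ Γ')
    {γ : L2 n F S →L[ℂ] L2 n F S} {γ' : L2 n' F' S' →L[ℂ] L2 n' F' S'}
    (hγ : ∀ u v : PreL2 n F S, v.toSection = (fun x => Γ x (u.toSection x)) → γ u = v)
    (hγ' : ∀ u v : PreL2 n' F' S', v.toSection = (fun x => Γ' x (u.toSection x)) → γ' u = v)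
    (x : L2 n F S) : W (γ x) = γ' (W x) := by
  refine closure_minimal (t := {x | W (γ x) = γ' (W x)}) ?_
    (isClosed_eq (W.continuous.comp γ.continuous) (γ'.continuous.comp W.continuous))
    (mem_closure_testSections D.selfAdjoint D.potential m x)
  rintro _ ⟨Φ, u, v, hu, hv, rfl⟩
  obtain ⟨u₀, v₀, hu₀, hv₀, -, -, -⟩ := D.exists_parts hm hu hv
  obtain ⟨Ψ', w', -, hw', -, hR, -⟩ := (isTransplantation D D' hT).exists_push _ u₀ v₀
    (D.supportedIn_inner₀ Φ) hu₀ hv₀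
  obtain ⟨z, hz, -⟩ := hΓ.exists_endTest hu
  obtain ⟨z', hz', -⟩ := hΓ'.exists_endTest hw'
  have hq : withPotential L h m (endTest hΓ.smooth Φ) ∈ squareIntegrable n F S :=
    mem_squareIntegrable_of_le (c := 1) (D.measurableSection_withPotential m _) v fun x => by
      rw [withPotential_endTest hΓ hL hh, norm_neg, hΓ.norm_apply, hv, one_mul]
  have h1 : γ u = z := hγ u z (by rw [hz, hu]; rfl)
  have h2 : γ' w' = z' := hγ' w' z' (by rw [hz', hw']; rfl)
  have h3 : W u = w' := hW Φ u v w' hu hv (by rwa [hw'])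
  have h4 : W z = z' := by
    refine hW (endTest hΓ.smooth Φ) z (.mk _ hq) z' hz rfl ?_
    rw [hz']
    have e1 : (D.inner₀ (endTest hΓ.smooth Φ)).1 = fun x => Γ x ((D.inner₀ Φ).1 x) := by
      funext x
      rw [D.inner₀_apply, D.inner₀_apply, endTest_apply, map_smul]
    rw [e1]
    obtain ⟨r1, r2, r3⟩ := mk_mem_relation.1 hR
    refine mk_mem_relation.2 ⟨fun x hx => ?_, fun y hy => ?_, fun x hx => ?_⟩
    · rw [r1 x hx, map_zero]
    · rw [endTest_apply, r2 y hy, map_zero]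
    · rw [endTest_apply, r3 x hx, hTΓ x hx]
  change W (γ u) = γ' (W u)
  rw [h1, h3, h4, h2]

end BundleIsometry

/-- Excision for the index, with the constant expressed by a bound `K` on `|σ(dη)|`. -/
theorem index_eq_of_bundleIsometry (D : CalliasData U₀ U₁ η σ K L h)
    (D' : CalliasData U₀' U₁' η' σ' K L' h')
    {Γ : ∀ x, Module.End ℂ (S x)} (hΓ : IsGrading n F Γ) (hL : IsOddOp L Γ) (hh : IsOddEnd h Γ)
    {Γ' : ∀ x, Module.End ℂ (S' x)} (hΓ' : IsGrading n' F' Γ') (hL' : IsOddOp L' Γ')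
    (hh' : IsOddEnd h' Γ') {C Λ : ℝ} (hC : 0 < C) (hKC : 4 * K ≤ C) (hΛ : 0 < Λ) (hm0 : 0 < m)
    (T : BundleIsometry n F S n' F' S' U₀ U₀') (hTΓ : T.IsEven Γ Γ')
    (hT : T.Intertwines (withPotential L h m) (withPotential L' h' m))
    (hF : IsFredholm (closureOp (withPotential L h m)))
    (hspec : ∀ t : ℝ, t ∈ Set.Icc (-Λ) Λ →
      (t : ℂ) ∈ Excision.spectrum (closureOp (withPotential L h m)) → t = 0)
    (hm : 2 * (C ^ 2 + Λ ^ 2) / Λ < m) :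
    IsFredholm (closureOp (withPotential L' h' m)) ∧
      index (closureOp (withPotential L h m)) Γ = index (closureOp (withPotential L' h' m)) Γ' := by
  obtain ⟨W, hWt, hW⟩ := D.exists_transfer D' hm0 (BundleIsometry.isTransplantation D D' hT)
  obtain ⟨W', hWt', hW'⟩ := D'.exists_transfer D hm0
    (BundleIsometry.isTransplantation_symm D D' hT)
  obtain ⟨γ, -, hsq, hγ⟩ := hΓ.exists_clm D.selfAdjoint D.potential
  obtain ⟨γ', hγs', hsq', hγ'⟩ := hΓ'.exists_clm D'.selfAdjoint D'.potential
  exact index_eq_of_transfer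
    (isSelfAdjoint_closureOp_withPotential D.selfAdjoint D.potential m)
    (isSelfAdjoint_closureOp_withPotential D'.selfAdjoint D'.potential m)
    D.nonneg hC hKC hΛ hm hF hspec hWt hWt'
    (BundleIsometry.almostAdjoint D D' hT hm0 hW hW')
    (fun x y => mem_graph_closureOp_of_isOdd hΓ D.selfAdjoint D.potential hL hh m
      (D.measurableSection_withPotential m) hγ)
    hγs'
    (fun x y => mem_graph_closureOp_of_isOdd hΓ' D'.selfAdjoint D'.potential hL' hh' m
      (D'.measurableSection_withPotential m) hγ')
    (BundleIsometry.transfer_grading D D' hT hm0 hW hΓ hΓ' hL hh hTΓ hγ hγ')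
    (gradedPart n F Γ) (mem_gradedPart_iff hΓ D.selfAdjoint D.potential hsq hγ)
    (gradedPart n' F' Γ') (mem_gradedPart_iff hΓ' D'.selfAdjoint D'.potential hsq' hγ')

end Excision

end Excision

end

theorem mainTheorem2
    -- the complete Riemannian manifold `Z` and the hermitian vector bundle `S`
    {n : ℕ} {Z : Type*} [EMetricSpace Z] [ChartedSpace (EuclideanSpace ℝ (Fin n)) Z]
    [IsManifold (𝓡 n) ∞ Z] [SecondCountableTopology Z]
    [RiemannianBundle (fun x : Z => TangentSpace (𝓡 n) x)]
    [IsContMDiffRiemannianBundle (𝓡 n) ∞ (EuclideanSpace ℝ (Fin n))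
      (fun x : Z => TangentSpace (𝓡 n) x)]
    [IsRiemannianManifold (𝓡 n) Z] [CompleteSpace Z] [MeasurableSpace Z] [BorelSpace Z]
    {F : Type*} [NormedAddCommGroup F] [NormedSpace ℂ F] [FiniteDimensional ℂ F]
    {S : Z → Type*} [TopologicalSpace (TotalSpace F S)]
    [∀ x, NormedAddCommGroup (S x)] [∀ x, InnerProductSpace ℂ (S x)]
    [FiberBundle F S] [VectorBundle ℂ F S] [VectorBundle ℝ F S]
    [ContMDiffVectorBundle ∞ F S (𝓡 n)] [IsContMDiffRiemannianBundle (𝓡 n) ∞ F S]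
    -- the complete Riemannian manifold `Z'` and the hermitian vector bundle `S'`
    {n' : ℕ} {Z' : Type*} [EMetricSpace Z'] [ChartedSpace (EuclideanSpace ℝ (Fin n')) Z']
    [IsManifold (𝓡 n') ∞ Z'] [SecondCountableTopology Z']
    [RiemannianBundle (fun x : Z' => TangentSpace (𝓡 n') x)]
    [IsContMDiffRiemannianBundle (𝓡 n') ∞ (EuclideanSpace ℝ (Fin n'))
      (fun x : Z' => TangentSpace (𝓡 n') x)]
    [IsRiemannianManifold (𝓡 n') Z'] [CompleteSpace Z'] [MeasurableSpace Z'] [BorelSpace Z']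
    {F' : Type*} [NormedAddCommGroup F'] [NormedSpace ℂ F'] [FiniteDimensional ℂ F']
    {S' : Z' → Type*} [TopologicalSpace (TotalSpace F' S')]
    [∀ x, NormedAddCommGroup (S' x)] [∀ x, InnerProductSpace ℂ (S' x)]
    [FiberBundle F' S'] [VectorBundle ℂ F' S'] [VectorBundle ℝ F' S']
    [ContMDiffVectorBundle ∞ F' S' (𝓡 n')] [IsContMDiffRiemannianBundle (𝓡 n') ∞ F' S']
    -- coverings and partitions of unity
    (U₀ U₁ : Set Z) (η₀ : Z → ℝ) (hη : Excision.IsPartition n U₀ U₁ η₀)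
    (U₀' U₁' : Set Z') (η₀' : Z' → ℝ) (hη' : Excision.IsPartition n' U₀' U₁' η₀')
    -- elliptic symbols, with `|σ(dη₀)|` bounded on the overlaps
    (σ : Excision.SymbolField n S) (hσ : Excision.IsElliptic σ)
    (hσ_bdd : ∃ K : ℝ, ∀ x ∈ U₀ ∩ U₁, ∀ v, ‖σ x (mvfderiv (𝓡 n) η₀ x) v‖ ≤ K * ‖v‖)
    (σ' : Excision.SymbolField n' S') (hσ' : Excision.IsElliptic σ')
    (hσ'_bdd : ∃ K : ℝ, ∀ x ∈ U₀' ∩ U₁', ∀ v, ‖σ' x (mvfderiv (𝓡 n') η₀' x) v‖ ≤ K * ‖v‖) :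
    ∃ C : ℝ, 0 < C ∧
      ∀ -- gradings, operators and potentials
        (Γ : ∀ x, Module.End ℂ (S x)) (_ : Excision.IsGrading n F Γ)
        (L : Excision.TestSections n F S →ₗ[ℂ] Excision.TestSections n F S)
        (_ : Excision.HasSymbol L σ) (_ : Excision.IsEssentiallySelfAdjoint L)
        (_ : Excision.IsOddOp L Γ)
        (h : ∀ x, Module.End ℂ (S x)) (_ : Excision.IsPotential n F h)
        (_ : Excision.IsOddEnd h Γ) (_ : Excision.SmoothEndOn n F h U₁)
        (_ : Excision.AnticommutesOn L h U₁) (_ : Excision.SqEigenvaluesGeOneOn h U₁)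
        (Γ' : ∀ x, Module.End ℂ (S' x)) (_ : Excision.IsGrading n' F' Γ')
        (L' : Excision.TestSections n' F' S' →ₗ[ℂ] Excision.TestSections n' F' S')
        (_ : Excision.HasSymbol L' σ') (_ : Excision.IsEssentiallySelfAdjoint L')
        (_ : Excision.IsOddOp L' Γ')
        (h' : ∀ x, Module.End ℂ (S' x)) (_ : Excision.IsPotential n' F' h')
        (_ : Excision.IsOddEnd h' Γ') (_ : Excision.SmoothEndOn n' F' h' U₁')
        (_ : Excision.AnticommutesOn L' h' U₁') (_ : Excision.SqEigenvaluesGeOneOn h' U₁')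
        (Λ m : ℝ) (_ : 0 < Λ) (_ : 0 < m)
        -- `L_m` and `L'_m` coincide over `U₀ ≅ U₀'`
        (T : Excision.BundleIsometry n F S n' F' S' U₀ U₀') (_ : T.IsEven Γ Γ')
        (_ : T.Intertwines (Excision.withPotential L h m) (Excision.withPotential L' h' m)),
        -- `L_m` is Fredholm with `spec L_m ∩ [-Λ, Λ] ⊆ {0}`
        Excision.IsFredholm (Excision.closureOp (Excision.withPotential L h m)) →
        (∀ t : ℝ, t ∈ Set.Icc (-Λ) Λ →
          (t : ℂ) ∈ Excision.spectrum (Excision.closureOp (Excision.withPotential L h m)) →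
          t = 0) →
        2 * (C ^ 2 + Λ ^ 2) / Λ < m →
        Excision.IsFredholm (Excision.closureOp (Excision.withPotential L' h' m)) ∧
        Excision.index (Excision.closureOp (Excision.withPotential L h m)) Γ =
          Excision.index (Excision.closureOp (Excision.withPotential L' h' m)) Γ' := by
  obtain ⟨k, hk⟩ := hσ_bdd
  obtain ⟨k', hk'⟩ := hσ'_bdd
  set K := max (max k 0) (max k' 0) with hK_def
  have hK : 0 ≤ K := (le_max_right k 0).trans (le_max_left _ _)
  -- the estimates in Hilbert space ask for `4 K ≤ C`; the summand `1` makes `C` positive for `K = 0`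
  refine ⟨4 * K + 1, by positivity, ?_⟩
  intro Γ hΓ L hLσ hLsa hLo h hh hho hhs hLh hh1 Γ' hΓ' L' hLσ' hLsa' hLo' h' hh' hho' hhs' hLh' hh1'
    Λ m hΛ hm0 T hTΓ hT hF hspec hm
  have D : Excision.CalliasData U₀ U₁ η₀ σ K L h :=
    ⟨hη, hK, fun x v => (Excision.norm_symbol_le hη hk x v).trans
      (mul_le_mul_of_nonneg_right (le_max_left _ _) (norm_nonneg _)), hLσ, hLsa, hh, hhs, hLh, hh1⟩
  have D' : Excision.CalliasData U₀' U₁' η₀' σ' K L' h' :=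
    ⟨hη', hK, fun x v => (Excision.norm_symbol_le hη' hk' x v).trans
      (mul_le_mul_of_nonneg_right (le_max_right _ _) (norm_nonneg _)), hLσ', hLsa', hh', hhs', hLh',
      hh1'⟩
  exact Excision.index_eq_of_bundleIsometry D D' hΓ hLo hho hΓ' hLo' hho' (by positivity)
    (by linarith) hΛ hm0 T hTΓ hT hF hspec hm
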